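/- **Setting.** A *network* is a finite straight-line planar crease pattern in the plane in which every interior vertex $v$ has exactly four creases $e_0,e_1,e_2,e_3$ (in counterclockwise order, with unit directions $u_{v,0},\dots,u_{v,3}$); a crease either joins two vertices or runs from a vertex to the boundary of the sheet, and two creases meet at most in a common vertex. The network is *flat-foldable* if at every vertex the sector angles are $\alpha_v,\beta_v,\pi-\alpha_v,\pi-\beta_v$ in order ($e_1$ lying between $\alpha_v$ and $\beta_v$), and it is a *tree* if the graph of its vertices and of the creases between them is a tree. A *rigid folded state* with fold angles $\rho$ places every face in $\mathbb R^3$ isometrically, so that the placements of the two faces at each crease $e$ agree along $e$ and their normals make the signed angle $\rho_e\in(-\pi,\pi)$. The *configuration space* is the set of fold angle vectors of rigid folded states, and a *rigid folding motion* is a path $\tau\mapsto\rho(\tau)$ ($\tau\in\mathbb R$) in it with $\rho(0)=0$. A pattern is *rigidly foldable* if it has such a path with $\rho(\tau)\neq0$ for all $\tau\ne0$. A *double-line version* with angles $\theta_v\in(0,\pi)$ replaces each vertex $v$ by a central quadrilateral with corners $c_{v,0},\dots,c_{v,3}$, whose side from $c_{v,i-1}$ to $c_{v,i}$ crosses $e_i$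 at some distance $r_{v,i}>0$ from $v$ and has the direction of $e_i$ turned by $\theta_v$, its ends lying on the two sides of $e_i$; and it replaces each crease $e_i$ by the two lines parallel to $e_i$ that start at $c_{v,i-1}$ and $c_{v,i}$. The two lines of a crease between two vertices join the corresponding corners of the two quadrilaterals; those of a crease to the boundary run to the perpendicular through its end. The result has to be a straight-line planar crease pattern. With $p(\alpha,\beta)=\frac{1-\tan\frac\alpha2\tan\frac\beta2}{1+\tan\frac\alpha2\tan\frac\beta2}$ and $q(\alpha,\beta)=\frac{-\tan\frac\alpha2+\tan\frac\beta2}{\tan\frac\alpha2+\tan\frac\beta2}$, the mode vectors of a vertex are $(1,-p,1,p)$ for mode (a) and $(-q,1,q,1)$ for mode (b), with $p=p(\alpha_v,\beta_v)$ and $q=q(\alpha_v,\beta_v)$. A *folding mode* of the network is a choice of a mode at every vertex together with real speeds $s_e$ of the creases such that at each vertex the speeds of its four creases are a multiple of the vector of the chosen mode; its motion is $\rho_e(\tau)=2\arctan(s_e\tau)$. **Theorem.** Let $C$ be a network of flat-foldable degree-4 vertices that forms a tree. Then: 1. $C$ has a rigidly foldable double-line version. 2. For every choice of modes at the vertices whose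 mode vectors have no zero entry there is a folding mode of $C$ with these modes in which all speeds are nonzero. 3. For every folding mode $s$ of $C$, its motion $\rho$ is a rigid folding motion of $C$, and there are angles $\theta_v$ and a double-line version of $C$ with these angles that folds along it: it has a rigid folding motion $\delta$ such that for every crease $e$ of $C$ and every $\tau\in\mathbb R$ the fold angles of the two lines of $e$ add up to $\rho_e(\tau)$. If all speeds $s_e$ are nonzero, the version and $\delta$ can be chosen so that every crease of the double-line version has a nonzero fold angle for all $\tau\neq0$, and so that the two lines of each crease of $C$ have a constant finite nonzero double-line ratio (the ratio of the tangents of their half fold angles). -/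

import Mathlib

/-- Euclidean three-space. -/
abbrev Space : Type := EuclideanSpace ℝ (Fin 3)

/-- The vector product of Euclidean three-space. -/
noncomputable def vecCross (x y : Space) : Space :=
  WithLp.toLp 2 (crossProduct (WithLp.ofLp x) (WithLp.ofLp y))

/-- A straight-line crease pattern in the plane `ℂ`, with its interior vertices indexed by `X`, its
oriented creases indexed by `E` and its faces indexed by `F`. Every crease starts at an interior
vertex and ends at an interior vertex or at a point of the boundary of the sheet. `left e` and
`right e` are the faces on the two sides of `e`, seen in the direction of travel. A crease between
two interior vertices may be listed once, or twice with its two orientations. -/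
structure CreasePattern (X E F : Type*) where
  pos : X → ℂ
  tail : E → X
  head : E → X ⊕ ℂ
  left : E → F
  right : E → F

namespace CreasePattern

variable {X E F : Type*} (P : CreasePattern X E F)

/-- The point of the plane at which a crease starts. -/
def src (e : E) : ℂ := P.pos (P.tail e)

/-- The point of the plane at which a crease ends. -/
def tgt (e : E) : ℂ := Sum.elim P.pos id (P.head e)

/-- The vertex `x` is an end of the crease `e`. -/
def Incident (x : X) (e : E) : Prop := P.tail e = x ∨ P.head e = Sum.inl x

/-- `e` and `e'` list the same crease with its two orientations. -/
def IsReverse (e e' : E) : Prop :=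
  P.head e = Sum.inl (P.tail e') ∧ P.head e' = Sum.inl (P.tail e)

/-- The pattern is a straight-line planar graph: the vertices are distinct points, no crease is
degenerate, and two different creases meet at most in a common interior vertex. -/
structure IsPlanar : Prop where
  pos_injective : Function.Injective P.pos
  src_ne_tgt : ∀ e, P.src e ≠ P.tgt e
  noncrossing : ∀ e e', e ≠ e' → ¬ P.IsReverse e e' →
    ∀ z ∈ segment ℝ (P.src e) (P.tgt e) ∩ segment ℝ (P.src e') (P.tgt e'),
      ∃ x, z = P.pos x ∧ P.Incident x e ∧ P.Incident x e'

/-- The unit direction of a crease. -/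
noncomputable def unitDir (e : E) : ℂ := (P.tgt e - P.src e) / (‖P.tgt e - P.src e‖ : ℂ)

/-- A rigid folded state with fold angles `ρ`: every face `f` is placed in space by an isometry
`σ f` of its plane; the placements of the two faces at a crease agree along the crease; and the
fold angle `ρ e` is the signed angle between their normals, measured about the crease. With `U` the
image of the direction of the crease, `N` the image under the placement of the left face of the
normal of the crease in the plane, and `U × N` the normal of the left face, the right face has the
direction `cos ρ • N - sin ρ • (U × N)` in place of `N`: a positive angle is a valley, a negative
angle a mountain. -/
def IsFoldedState (σ : F → ℂ →ᵃⁱ[ℝ] Space) (ρ : E → ℝ) : Prop :=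
  ∀ e,
    σ (P.left e) (P.src e) = σ (P.right e) (P.src e) ∧
    σ (P.left e) (P.tgt e) = σ (P.right e) (P.tgt e) ∧
    (σ (P.right e)).linearIsometry (Complex.I * P.unitDir e) =
      Real.cos (ρ e) • (σ (P.left e)).linearIsometry (Complex.I * P.unitDir e) -
      Real.sin (ρ e) • vecCross ((σ (P.left e)).linearIsometry (P.unitDir e))
        ((σ (P.left e)).linearIsometry (Complex.I * P.unitDir e))

/-- The configuration space: the fold angle vectors of the rigid folded states. -/
def configSpace : Set (E → ℝ) :=
  {ρ | (∀ e, ρ e ∈ Set.Ioo (-Real.pi) Real.pi) ∧ ∃ σ, P.IsFoldedState σ ρ}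

/-- A rigid folding motion through the flat unfolded state: a path in the configuration space that
is in the unfolded state at time `0`. -/
structure IsFoldingMotion (γ : ℝ → E → ℝ) : Prop where
  continuous : Continuous γ
  mem_configSpace : ∀ τ, γ τ ∈ P.configSpace
  unfolded : γ 0 = 0

/-- The pattern has a rigid folding motion that leaves the flat unfolded state. -/
def IsRigidlyFoldable : Prop :=
  ∃ γ : ℝ → E → ℝ, P.IsFoldingMotion γ ∧ ∀ τ, τ ≠ 0 → γ τ ≠ 0

end CreasePattern

/-- A straight-line network of degree-4 vertices. The creases `e₀, e₁, e₂, e₃` at the vertex `v`, in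
counterclockwise order, have the unit directions `dir v i` and the lengths `len v i`, and
`angle v i` is the sector angle from `eᵢ` to `eᵢ₊₁`. The crease that leaves `v` as its `i`-th crease
and arrives at `w` as the `j`-th crease of `w` is recorded by `mate (v, i) = (w, j)`; if
`mate (v, i) = (v, i)`, the crease runs to the boundary of the sheet. -/
structure OrigamiNetwork (V : Type*) where
  pos : V → ℂ
  dir : V → ZMod 4 → ℂ
  angle : V → ZMod 4 → ℝ
  len : V → ZMod 4 → ℝ
  mate : V × ZMod 4 → V × ZMod 4
  norm_dir : ∀ v i, ‖dir v i‖ = 1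
  dir_succ : ∀ v i, dir v (i + 1) = Complex.exp (angle v i * Complex.I) * dir v i
  angle_pos : ∀ v i, 0 < angle v i
  angle_sum : ∀ v, ∑ i, angle v i = 2 * Real.pi
  len_pos : ∀ v i, 0 < len v i
  mate_mate : ∀ d, mate (mate d) = d
  pos_mate : ∀ v i, mate (v, i) ≠ (v, i) → pos (mate (v, i)).1 = pos v + len v i * dir v i

/-- The two folding modes of a flat-foldable degree-4 vertex. -/
inductive FoldMode
  | a
  | b

/-- The multiplier of mode (a). -/
noncomputable def modeP (α β : ℝ) : ℝ :=
  (1 - Real.tan (α / 2) * Real.tan (β / 2)) / (1 + Real.tan (α / 2) * Real.tan (β / 2))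

/-- The multiplier of mode (b). -/
noncomputable def modeQ (α β : ℝ) : ℝ :=
  (-Real.tan (α / 2) + Real.tan (β / 2)) / (Real.tan (α / 2) + Real.tan (β / 2))

/-- The tangents of the half fold angles of `e₀, e₁, e₂, e₃`, up to a common factor, of a vertex
with sector angles `α, β, π - α, π - β`, where `e₁` lies between `α` and `β`. -/
noncomputable def modeVector (α β : ℝ) : FoldMode → ZMod 4 → ℝ
  | .a => ![1, -modeP α β, 1, modeP α β]
  | .b => ![-modeQ α β, 1, modeQ α β, 1]

/-- The motion with the folding speeds `s`: the tangents of the half fold angles are `s d * τ`. It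
runs between the two flat-folded states as `τ` runs over `ℝ`. -/
noncomputable def modeMotion {V : Type*} (s : V × ZMod 4 → ℝ) (τ : ℝ) (d : V × ZMod 4) : ℝ :=
  2 * Real.arctan (s d * τ)

namespace OrigamiNetwork

variable {V : Type*} (N : OrigamiNetwork V)

/-- Opposite sector angles are supplementary at every vertex. -/
def IsFlatFoldable : Prop := ∀ v i, N.angle v i + N.angle v (i + 2) = Real.pi

/-- The graph of the vertices of the network; its edges are the creases between two vertices. -/
def graph : SimpleGraph V := SimpleGraph.fromRel fun v w => ∃ i, (N.mate (v, i)).1 = w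

/-- The far end of the `i`-th crease at `v`. -/
noncomputable def tip (v : V) (i : ZMod 4) : ℂ := N.pos v + N.len v i * N.dir v i

/-- A face is a class of corners. The corner `(v, i)` is the sector from `eᵢ` to `eᵢ₊₁` at `v`. Along
a crease from `(v, i)` to `(w, j)`, the face on the left is seen as the corner `(v, i)` from `v` and
as the corner `(w, j - 1)` from `w`. -/
def Face : Type _ :=
  Quot fun c c' : V × ZMod 4 =>
    N.mate c ≠ c ∧ c' = ((N.mate c).1, (N.mate c).2 - 1)

/-- The face that contains a corner. -/
def face (v : V) (i : ZMod 4) : N.Face := Quot.mk _ (v, i)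

open Classical in
/-- The network as a crease pattern. -/
noncomputable def pattern : CreasePattern V (V × ZMod 4) N.Face where
  pos := N.pos
  tail := fun d => d.1
  head := fun d => if N.mate d = d then Sum.inr (N.tip d.1 d.2) else Sum.inl (N.mate d).1
  left := fun d => N.face d.1 d.2
  right := fun d => N.face d.1 (d.2 - 1)

/-- `s` are the folding speeds of a folding mode of the network, in which the vertex `v` folds in
the mode `m v`: at each vertex they are proportional to the vector of the mode, and every crease
between two vertices has one speed. -/
def IsFoldingMode (m : V → FoldMode) (s : V × ZMod 4 → ℝ) : Prop :=
  (∀ v, ∃ t : ℝ, ∀ i, s (v, i) = t * modeVector (N.angle v 0) (N.angle v 1) (m v) i) ∧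
  ∀ d, s (N.mate d) = s d

/-- The creases of the network: a crease between two vertices is the class of its two darts. In the
double-line pattern each of them becomes a strip. -/
def Strip : Type _ := Quot fun d d' : V × ZMod 4 => d' = N.mate d

end OrigamiNetwork

/-- The creases of a double-line pattern: for the `i`-th crease of the vertex `v`, the side of the
central polygon at `v` across it, and the two lines parallel to it. -/
inductive DLCrease (V : Type*)
  | side (d : V × ZMod 4)
  | leftLine (d : V × ZMod 4)
  | rightLine (d : V × ZMod 4)

/-- The faces of a double-line pattern: the faces of the network, one strip for each crease of the
network, and one central polygon for each vertex. -/
inductive DLFace {V : Type*} (N : OrigamiNetwork V)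
  | sector (f : N.Face)
  | strip (s : N.Strip)
  | center (v : V)

namespace OrigamiNetwork

variable {V : Type*} (N : OrigamiNetwork V)

/-- The length of the line that starts at `z`, runs in the direction of the `i`-th crease of `v`
and ends on the perpendicular to this crease at its far end. -/
noncomputable def boundaryLen (v : V) (i : ZMod 4) (z : ℂ) : ℝ :=
  ((N.tip v i - z) * (starRingEnd ℂ) (N.dir v i)).re

open Classical in
/-- The double-line pattern whose central polygon at `v` has the corners `corner (v, i)`, the `i`-th
one lying in the sector between `eᵢ` and `eᵢ₊₁`. The side across `eᵢ` runs from the corner `i - 1` to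
the corner `i`, and the lines parallel to `eᵢ` on its right and left start at these two corners.
The lines of a crease between two vertices connect the two central polygons. -/
noncomputable def doubleLine (corner : V × ZMod 4 → ℂ) :
    CreasePattern (V × ZMod 4) (DLCrease V) (DLFace N) where
  pos := corner
  tail
    | .side d => (d.1, d.2 - 1)
    | .leftLine d => d
    | .rightLine d => (d.1, d.2 - 1)
  head
    | .side d => Sum.inl d
    | .leftLine d =>
        if N.mate d = d then
          Sum.inr (corner d + N.boundaryLen d.1 d.2 (corner d) * N.dir d.1 d.2)
        else Sum.inl ((N.mate d).1, (N.mate d).2 - 1)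
    | .rightLine d =>
        if N.mate d = d then
          Sum.inr (corner (d.1, d.2 - 1) +
            N.boundaryLen d.1 d.2 (corner (d.1, d.2 - 1)) * N.dir d.1 d.2)
        else Sum.inl (N.mate d)
  left
    | .side d => .center d.1
    | .leftLine d => .sector (N.face d.1 d.2)
    | .rightLine d => .strip (Quot.mk _ d)
  right
    | .side d => .strip (Quot.mk _ d)
    | .leftLine d => .strip (Quot.mk _ d)
    | .rightLine d => .sector (N.face d.1 (d.2 - 1))

/-- `corner` gives a double-line version of the network with the angles `θ`. -/
structure IsDoubleLine (θ : V → ℝ) (corner : V × ZMod 4 → ℂ) : Prop where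
  angle_mem : ∀ v, θ v ∈ Set.Ioo 0 Real.pi
  /-- The side of the central polygon of `v` across `eᵢ` meets `eᵢ` at a distance `r > 0` from `v`
  and at the angle `θ v`, with one end on each side of `eᵢ`. -/
  side : ∀ v i, ∃ r x y : ℝ, 0 < r ∧ 0 < x ∧ 0 < y ∧
    corner (v, i) = N.pos v + r * N.dir v i + x * (Complex.exp (θ v * Complex.I) * N.dir v i) ∧
    corner (v, i - 1) = N.pos v + r * N.dir v i - y * (Complex.exp (θ v * Complex.I) * N.dir v i)
  /-- The two lines of a crease between two vertices are parallel to the crease and line up. -/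
  line : ∀ v i, N.mate (v, i) ≠ (v, i) → ∃ r : ℝ, 0 < r ∧
    corner ((N.mate (v, i)).1, (N.mate (v, i)).2 - 1) = corner (v, i) + r * N.dir v i
  /-- The two lines of a crease to the boundary run outwards. -/
  boundary : ∀ v i, N.mate (v, i) = (v, i) →
    0 < N.boundaryLen v i (corner (v, i)) ∧ 0 < N.boundaryLen v i (corner (v, i - 1))
  planar : (N.doubleLine corner).IsPlanar

end OrigamiNetwork

/-! A fold about an axis of direction `u`, with `t` the tangent of half its angle, is the quaternion
`1 + t u j`. Two folds `z`, `w` about axes through one point compose to `1 - z * conj w + (z + w) j`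
(`Placement.fold_fold_congr`). Hence the four folds around a degree-4 vertex close up as soon as one
product and one sum of the numbers `t u` match. Both equations are homogeneous in the tangents, so a
solution may be multiplied by any real number, and one vector of speeds gives a whole motion. The
mode vectors of a flat-foldable vertex are such solutions. On a tree, faces, speeds and shapes can
be chosen vertex by vertex without any cycle condition (`exists_compatible`).

Each corner of a central polygon is again a degree-4 vertex. Because all sides at `v` are turned by
the same angle, the corner equations are solved by monomials in a scale `k` and two multipliers `p`,
`q`, which depend on that angle and on two consecutive sector angles (`add_sideSpeed`). The two
lines of every strip at `v` then have the same product of speeds `c = -k² p q`. Since `(p - q) / (1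
- p q)` does not depend on the angle, a suitable `k` makes the sums of their speeds equal to the
given speeds of the network. If `c` is common to all vertices, the two ends of a strip see the same
sum and product, hence the same pair of speeds, and a suitable choice of base corners puts the
larger speed on the same line (`exists_isDLSpeed`). With `T = τ (1 - c T²)` the addition formula of
the arctangent turns the two fold angles of a strip into `2 arctan (s τ)`.

At the angle `π - α`, with `α` the base sector angle, `p = 0` and so `c = 0`. If no speed vanishes,
this zero of `c` is simple at every vertex, and a small common `c > 0` is attained at nearby angles;
otherwise `c = 0` is used (`exists_speedProduct`). Polygons with matching strip widths exist at
these special angles (`exists_flat_polygons`) and persist nearby (`eventually_isPolygonData`).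
Shrinking them makes the pattern planar (`IsPolygonData.exists_isDoubleLine`). Rigid foldability
follows from any folding mode with one nonzero speed. -/

/-! ### Extending local choices along a tree. -/

/-- On a tree, a local choice at one vertex extends along the edges to a choice at all vertices. -/
theorem SimpleGraph.IsTree.exists_compatible {V S : Type*} {G : SimpleGraph V} (hG : G.IsTree)
    (good : V → S → Prop) (rel : V → V → S → S → Prop)
    (root : V) (s₀ : S) (hs₀ : good root s₀)
    (hstep : ∀ v w, G.Adj v w → ∀ s, good v s → ∃ s', good w s' ∧ rel v w s s')
    (hsymm : ∀ v w s s', G.Adj v w → rel v w s s' → rel w v s' s) :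
    ∃ f : V → S, f root = s₀ ∧ (∀ v, good v (f v)) ∧
      ∀ v w, G.Adj v w → rel v w (f v) (f w) := by
  classical
  have : Nonempty S := ⟨s₀⟩
  have hchoice : ∀ v w, G.Adj v w → ∃ F : S → S, ∀ s, good v s → good w (F s) ∧ rel v w s (F s) := by
    intro v w h
    choose! F hF using hstep v w h
    exact ⟨F, hF⟩
  choose! F hF using hchoice
  let g : ∀ {v : V}, G.Walk v root → S := fun {v} p =>
    SimpleGraph.Walk.rec (motive := fun _ _ _ => S) (fun {_} => s₀)
      (fun {v w _} _ _ s => F w v s) p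
  have hgcons : ∀ {v w : V} (h : G.Adj v w) (p : G.Walk w root),
      g (SimpleGraph.Walk.cons h p) = F w v (g p) := fun _ _ => rfl
  -- The end of the walk is a free variable here, so that induction on the walk applies.
  have key : ∀ (u v : V) (p : G.Walk v u) (hu : u = root), good v (g (p.copy rfl hu)) := by
    intro u v p
    induction p with
    | nil => intro hu; subst hu; exact hs₀
    | cons h p ih =>
      intro hu
      subst hu
      exact (hF _ _ h.symm _ (ih rfl)).1
  choose P hP _ using fun v => hG.existsUnique_path v root
  have huniq : ∀ v (p q : G.Walk v root), p.IsPath → q.IsPath → p = q := fun v p q hp hq =>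
    (hG.existsUnique_path v root).unique hp hq
  refine ⟨fun v => g (P v), ?_, fun v => key root v (P v) rfl, ?_⟩
  · change g (P root) = s₀
    rw [show P root = SimpleGraph.Walk.nil from huniq root _ _ (hP root) .nil]
  -- If the path from `w` to the root avoids `v`, then prefixing the edge gives the unique path from
  -- `v`, so the value at `v` was obtained from the value at `w`. Acyclicity puts every edge in this
  -- situation in one of its two directions.
  have main : ∀ v w, G.Adj v w → v ∉ (P w).support → rel v w (g (P v)) (g (P w)) := by
    intro v w h hv
    have : P v = SimpleGraph.Walk.cons h (P w) := huniq v _ _ (hP v) ((hP w).cons hv)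
    rw [this, hgcons h]
    exact hsymm _ _ _ _ h.symm (hF _ _ h.symm _ (key root w (P w) rfl)).2
  intro v w h
  by_cases hv : v ∈ (P w).support
  · have hw : w ∉ (P v).support := by
      have := hG.isAcyclic.ne_mem_support_of_support_of_adj_of_isPath
        (hP w).reverse (hP v).reverse h.symm (by simpa using hv)
      simpa using this
    exact hsymm _ _ _ _ h.symm (main w v h.symm hw)
  · exact main v w h hv

theorem ZMod.eq_add_of_four : ∀ b i : ZMod 4, i = b ∨ i = b + 1 ∨ i = b + 2 ∨ i = b + 3 := by
  decide

theorem ZMod.forall_four {p : ZMod 4 → Prop} (b : ZMod 4) (h0 : p b) (h1 : p (b + 1))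
    (h2 : p (b + 2)) (h3 : p (b + 3)) (i : ZMod 4) : p i := by
  rcases ZMod.eq_add_of_four b i with rfl | rfl | rfl | rfl <;> assumption

/-! ### Creases of the network seen from their two ends. -/

namespace OrigamiNetwork

variable {V : Type*} (N : OrigamiNetwork V)

theorem dir_ne_zero (v : V) (i : ZMod 4) : N.dir v i ≠ 0 := by
  intro h
  have := N.norm_dir v i
  simp [h] at this

theorem angle_lt_pi {N : OrigamiNetwork V} (hflat : N.IsFlatFoldable) (v : V) (i : ZMod 4) :
    N.angle v i < Real.pi := by
  have := hflat v i
  have := N.angle_pos v (i + 2)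
  linarith

theorem pattern_src (d : V × ZMod 4) : N.pattern.src d = N.pos d.1 := rfl

theorem pattern_tgt (d : V × ZMod 4) :
    N.pattern.tgt d = N.pos d.1 + N.len d.1 d.2 * N.dir d.1 d.2 := by
  by_cases h : N.mate d = d
  · simp [CreasePattern.tgt, pattern, h, tip]
  · simpa [CreasePattern.tgt, pattern, h] using N.pos_mate d.1 d.2 h

theorem mate_fst_ne {d : V × ZMod 4} (h : N.mate d ≠ d) : (N.mate d).1 ≠ d.1 := by
  intro h'
  have := N.pos_mate d.1 d.2 h
  change N.pos (N.mate d).1 = _ at this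
  rw [h'] at this
  have h2 : (N.len d.1 d.2 : ℂ) * N.dir d.1 d.2 = 0 := by
    linear_combination -this
  rcases mul_eq_zero.1 h2 with h3 | h3
  · exact (N.len_pos d.1 d.2).ne' (by exact_mod_cast h3)
  · exact N.dir_ne_zero _ _ h3

theorem mate_mate_ne {d : V × ZMod 4} (h : N.mate d ≠ d) : N.mate (N.mate d) ≠ N.mate d := by
  rw [N.mate_mate]; exact h.symm

theorem len_mul_dir_mate {d : V × ZMod 4} (h : N.mate d ≠ d) :
    (N.len (N.mate d).1 (N.mate d).2 : ℂ) * N.dir (N.mate d).1 (N.mate d).2 =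
      -(N.len d.1 d.2 * N.dir d.1 d.2) := by
  have h1 := N.pos_mate d.1 d.2 h
  have h2 := N.pos_mate (N.mate d).1 (N.mate d).2 (N.mate_mate_ne h)
  change N.pos (N.mate d).1 = _ at h1
  change N.pos (N.mate (N.mate d)).1 = _ at h2
  rw [N.mate_mate] at h2
  linear_combination -h1 - h2

theorem len_mate {d : V × ZMod 4} (h : N.mate d ≠ d) :
    N.len (N.mate d).1 (N.mate d).2 = N.len d.1 d.2 := by
  have := congrArg norm (N.len_mul_dir_mate h)
  simpa [N.norm_dir, abs_of_pos (N.len_pos _ _)] using this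

theorem dir_mate {d : V × ZMod 4} (h : N.mate d ≠ d) :
    N.dir (N.mate d).1 (N.mate d).2 = -N.dir d.1 d.2 := by
  have h1 := N.len_mul_dir_mate h
  rw [N.len_mate h] at h1
  have h2 : (N.len d.1 d.2 : ℂ) ≠ 0 := by exact_mod_cast (N.len_pos _ _).ne'
  exact mul_left_cancel₀ h2 (by linear_combination h1)

theorem adj_mate {d : V × ZMod 4} (h : N.mate d ≠ d) : N.graph.Adj d.1 (N.mate d).1 := by
  rw [graph, SimpleGraph.fromRel_adj]
  exact ⟨(N.mate_fst_ne h).symm, Or.inl ⟨d.2, rfl⟩⟩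

theorem exists_mate_of_adj {v w : V} (h : N.graph.Adj v w) :
    ∃ d, N.mate d ≠ d ∧ d.1 = v ∧ (N.mate d).1 = w := by
  rw [graph, SimpleGraph.fromRel_adj] at h
  obtain ⟨hne, ⟨i, hi⟩ | ⟨i, hi⟩⟩ := h
  · exact ⟨(v, i), fun h' => hne (by rw [← hi, h']), rfl, hi⟩
  · refine ⟨N.mate (w, i), fun h' => hne ?_, hi, by rw [N.mate_mate]⟩
    rw [N.mate_mate] at h'
    rw [← hi, ← h']

variable {N}

/-- Two vertices are joined by at most one crease. -/
theorem dart_unique (hplanar : N.pattern.IsPlanar) {d d' : V × ZMod 4} (h : N.mate d ≠ d)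
    (h' : N.mate d' ≠ d') (h1 : d.1 = d'.1) (h2 : (N.mate d).1 = (N.mate d').1) : d = d' := by
  by_contra hne
  have e1 : N.pattern.tgt d = N.pos (N.mate d).1 := by
    simp [CreasePattern.tgt, pattern, h]
  have e2 : N.pattern.tgt d' = N.pos (N.mate d).1 := by
    simp [CreasePattern.tgt, pattern, h', h2]
  have hrev : ¬ N.pattern.IsReverse d d' := by
    rintro ⟨h3, -⟩
    simp only [pattern, h, if_false] at h3
    exact N.mate_fst_ne h ((Sum.inl_injective h3).trans h1.symm)
  -- Two straight creases with the same ends would share their midpoint, which is not a vertex at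
  -- either end.
  have hmid : midpoint ℝ (N.pos d.1) (N.pos (N.mate d).1) ∈
      segment ℝ (N.pos d.1) (N.pos (N.mate d).1) := midpoint_mem_segment _ _
  obtain ⟨x, hx, hi, -⟩ := hplanar.noncrossing d d' hne hrev _
    ⟨by rw [e1, pattern_src]; exact hmid, by rw [e2, pattern_src, ← h1]; exact hmid⟩
  have hpos : N.pos d.1 ≠ N.pos (N.mate d).1 := fun h3 =>
    N.mate_fst_ne h (hplanar.pos_injective h3).symm
  rcases hi with hi | hi
  · subst hi
    have := (midpoint_eq_left_iff (R := ℝ)).1 hx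
    exact hpos this
  · simp only [pattern, h, if_false] at hi
    have hi := Sum.inl_injective hi
    subst hi
    have := (midpoint_eq_right_iff (R := ℝ)).1 hx
    exact hpos this

/-- On a network that is a tree, a local choice at one vertex extends along the creases to a choice
at all vertices. -/
theorem exists_compatible (hplanar : N.pattern.IsPlanar) (htree : N.graph.IsTree) {S : Type*}
    (good : V → S → Prop) (rel : V × ZMod 4 → S → S → Prop)
    (root : V) (s₀ : S) (hs₀ : good root s₀)
    (hstep : ∀ d, N.mate d ≠ d → ∀ s, good d.1 s → ∃ s', good (N.mate d).1 s' ∧ rel d s s')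
    (hsymm : ∀ d s s', N.mate d ≠ d → rel d s s' → rel (N.mate d) s' s) :
    ∃ f : V → S, f root = s₀ ∧ (∀ v, good v (f v)) ∧
      ∀ d, N.mate d ≠ d → rel d (f d.1) (f (N.mate d).1) := by
  obtain ⟨f, hr, hf, hf'⟩ := htree.exists_compatible good
    (fun v w s s' => ∀ d, N.mate d ≠ d → d.1 = v → (N.mate d).1 = w → rel d s s') root s₀ hs₀
    (by
      intro v w h s hs
      obtain ⟨d, hd, rfl, rfl⟩ := N.exists_mate_of_adj h
      obtain ⟨s', hs', hr⟩ := hstep d hd s hs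
      refine ⟨s', hs', fun d' hd' h1 h2 => ?_⟩
      rwa [dart_unique hplanar hd' hd h1 h2])
    (by
      intro v w s s' _ hr d hd h1 h2
      have := hsymm (N.mate d) s s' (N.mate_mate_ne hd)
        (hr (N.mate d) (N.mate_mate_ne hd) h2 (by rw [N.mate_mate]; exact h1))
      rwa [N.mate_mate] at this)
  exact ⟨f, hr, hf, fun d hd => hf' _ _ (N.adj_mate hd) d hd rfl rfl⟩

end OrigamiNetwork

/-! ### Placed planes, quaternions and folds. -/

theorem vecCross_add_left (x y z : Space) : vecCross (x + y) z = vecCross x z + vecCross y z := by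
  simp [vecCross]

theorem vecCross_add_right (x y z : Space) : vecCross x (y + z) = vecCross x y + vecCross x z := by
  simp [vecCross]

theorem vecCross_smul_left (r : ℝ) (x y : Space) : vecCross (r • x) y = r • vecCross x y := by
  simp [vecCross]

theorem vecCross_smul_right (r : ℝ) (x y : Space) : vecCross x (r • y) = r • vecCross x y := by
  simp [vecCross]

theorem vecCross_self (x : Space) : vecCross x x = 0 := by
  simp [vecCross]

theorem vecCross_anticomm (x y : Space) : vecCross y x = -vecCross x y := by
  simp only [vecCross, ← cross_anticomm (WithLp.ofLp x), WithLp.toLp_neg]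

theorem inner_space (x y : Space) : inner ℝ x y = x 0 * y 0 + x 1 * y 1 + x 2 * y 2 := by
  simp [PiLp.inner_apply, Fin.sum_univ_three, mul_comm]

theorem vecCross_vecCross (x y : Space) :
    vecCross y (vecCross x y) = inner ℝ y y • x - inner ℝ x y • y := by
  rw [inner_space, inner_space]
  ext i
  fin_cases i <;> simp [vecCross, crossProduct] <;> ring

theorem inner_vecCross_left (x y : Space) : inner ℝ x (vecCross x y) = 0 := by
  rw [inner_space]
  simp [vecCross, crossProduct]; ring

theorem inner_vecCross_right (x y : Space) : inner ℝ y (vecCross x y) = 0 := by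
  rw [inner_space]
  simp [vecCross, crossProduct]; ring

theorem inner_vecCross_vecCross (x y : Space) :
    inner ℝ (vecCross x y) (vecCross x y) =
      inner ℝ x x * inner ℝ y y - inner ℝ x y * inner ℝ x y := by
  simp only [inner_space]
  simp [vecCross, crossProduct]; ring

namespace Placement

/-- The unit normal of a placed plane. -/
noncomputable def normal (L : ℂ →ₗᵢ[ℝ] Space) : Space := vecCross (L 1) (L Complex.I)

theorem apply_eq (L : ℂ →ₗᵢ[ℝ] Space) (w : ℂ) : L w = w.re • L 1 + w.im • L Complex.I := by
  rw [← L.map_smul, ← L.map_smul, ← L.map_add]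
  congr 1
  apply Complex.ext <;> simp

theorem inner_one_one (L : ℂ →ₗᵢ[ℝ] Space) : inner ℝ (L 1) (L 1) = (1 : ℝ) := by
  rw [L.inner_map_map]; simp

theorem inner_I_I (L : ℂ →ₗᵢ[ℝ] Space) : inner ℝ (L Complex.I) (L Complex.I) = (1 : ℝ) := by
  rw [L.inner_map_map]; simp

theorem inner_one_I (L : ℂ →ₗᵢ[ℝ] Space) : inner ℝ (L 1) (L Complex.I) = (0 : ℝ) := by
  rw [L.inner_map_map]; simp [Complex.inner]

theorem vecCross_I_normal (L : ℂ →ₗᵢ[ℝ] Space) : vecCross (L Complex.I) (normal L) = L 1 := by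
  rw [normal, vecCross_vecCross, inner_I_I, inner_one_I]; simp

theorem vecCross_normal_one (L : ℂ →ₗᵢ[ℝ] Space) : vecCross (normal L) (L 1) = L Complex.I := by
  rw [normal, vecCross_anticomm, vecCross_anticomm (L Complex.I) (L 1), ← neg_one_smul ℝ,
    ← neg_one_smul ℝ (vecCross _ _), vecCross_smul_right, vecCross_vecCross, inner_one_one,
    real_inner_comm, inner_one_I]
  simp

/-- The vector with the coordinates `a, b, c` in the frame of a placed plane. -/
noncomputable def vec (L : ℂ →ₗᵢ[ℝ] Space) (a b c : ℝ) : Space :=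
  a • L 1 + b • L Complex.I + c • normal L

theorem vecCross_vec (L : ℂ →ₗᵢ[ℝ] Space) (a b c a' b' c' : ℝ) :
    vecCross (vec L a b c) (vec L a' b' c') =
      vec L (b * c' - c * b') (c * a' - a * c') (a * b' - b * a') := by
  simp only [vec, vecCross_add_left, vecCross_add_right, vecCross_smul_left, vecCross_smul_right,
    vecCross_self, vecCross_I_normal, vecCross_normal_one]
  rw [vecCross_anticomm (L 1) (L Complex.I), vecCross_anticomm (L Complex.I) (normal L),
    vecCross_anticomm (normal L) (L 1), vecCross_I_normal, vecCross_normal_one]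
  rw [← normal]
  module

theorem norm_vec_sq (L : ℂ →ₗᵢ[ℝ] Space) (a b c : ℝ) :
    ‖vec L a b c‖ ^ 2 = a ^ 2 + b ^ 2 + c ^ 2 := by
  have h1 : inner ℝ (L 1) (normal L) = (0 : ℝ) := inner_vecCross_left _ _
  have h2 : inner ℝ (L Complex.I) (normal L) = (0 : ℝ) := inner_vecCross_right _ _
  have h3 : inner ℝ (normal L) (normal L) = (1 : ℝ) := by
    rw [normal, inner_vecCross_vecCross, inner_one_one, inner_I_I, inner_one_I]; norm_num
  have h4 := inner_one_I L
  rw [← real_inner_self_eq_norm_sq, vec]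
  simp only [inner_add_left, inner_add_right, real_inner_smul_left, real_inner_smul_right,
    inner_one_one, inner_I_I, h1, h2, h3, h4,
    (real_inner_comm _ _).trans h4, (real_inner_comm _ _).trans h1, (real_inner_comm _ _).trans h2]
  ring

/-- The image of `w` under the rotation of the quaternion `a + z j`, in the frame of `L`. -/
noncomputable def spin (L : ℂ →ₗᵢ[ℝ] Space) (a z w : ℂ) : Space :=
  vec L ((a ^ 2 * w + z ^ 2 * (starRingEnd ℂ) w).re / (Complex.normSq a + Complex.normSq z))
    ((a ^ 2 * w + z ^ 2 * (starRingEnd ℂ) w).im / (Complex.normSq a + Complex.normSq z))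
    (2 * (a * w * (starRingEnd ℂ) z).im / (Complex.normSq a + Complex.normSq z))

/-- The rotation with the quaternion `1 + z j`, in the frame of `L`. -/
noncomputable def spinIsometry (L : ℂ →ₗᵢ[ℝ] Space) (z : ℂ) : ℂ →ₗᵢ[ℝ] Space where
  toFun := spin L 1 z
  map_add' w w' := by
    simp only [spin, vec, map_add, mul_add, add_mul, Complex.add_re, Complex.add_im]
    module
  map_smul' r w := by
    simp only [spin, vec, Complex.real_smul, map_mul, Complex.conj_ofReal]
    have h1 : (1 : ℂ) ^ 2 * (r * w) + z ^ 2 * (r * (starRingEnd ℂ) w) =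
      r * (1 ^ 2 * w + z ^ 2 * (starRingEnd ℂ) w) := by ring
    have h2 : 1 * (r * w) * (starRingEnd ℂ) z = r * (1 * w * (starRingEnd ℂ) z) := by ring
    rw [h1, h2, Complex.re_ofReal_mul, Complex.im_ofReal_mul, Complex.im_ofReal_mul]
    simp only [RingHom.id_apply]
    module
  norm_map' w := by
    have hn : (0 : ℝ) < Complex.normSq 1 + Complex.normSq z := by
      have := Complex.normSq_nonneg z
      simp; linarith
    have : ‖spin L 1 z w‖ ^ 2 = ‖w‖ ^ 2 := by
      rw [spin, norm_vec_sq, Complex.sq_norm]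
      simp only [Complex.normSq_apply] at hn ⊢
      simp only [pow_two, Complex.add_re, Complex.add_im, Complex.mul_re, Complex.mul_im,
        Complex.conj_re, Complex.conj_im, Complex.one_re, Complex.one_im] at hn ⊢
      field_simp
      ring
    exact (sq_eq_sq₀ (norm_nonneg _) (norm_nonneg _)).1 this

theorem spinIsometry_apply (L : ℂ →ₗᵢ[ℝ] Space) (z w : ℂ) : spinIsometry L z w = spin L 1 z w := rfl

theorem vec_vec (L L' : ℂ →ₗᵢ[ℝ] Space) {a₁ b₁ c₁ a₂ b₂ c₂ : ℝ} (h1 : L' 1 = vec L a₁ b₁ c₁)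
    (h2 : L' Complex.I = vec L a₂ b₂ c₂) (a b c : ℝ) :
    vec L' a b c = vec L (a * a₁ + b * a₂ + c * (b₁ * c₂ - c₁ * b₂))
      (a * b₁ + b * b₂ + c * (c₁ * a₂ - a₁ * c₂)) (a * c₁ + b * c₂ + c * (a₁ * b₂ - b₁ * a₂)) := by
  have : normal L' = vec L (b₁ * c₂ - c₁ * b₂) (c₁ * a₂ - a₁ * c₂) (a₁ * b₂ - b₁ * a₂) := by
    rw [normal, h1, h2, vecCross_vec]
  simp only [vec] at *
  rw [this, h1, h2]
  module

/-- The second rotation is taken in the frame moved by the first, so the quaternions multiply in the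
order `(1 + z j) (1 + w j)`, where `j w = conj w j` and `j² = -1`. -/
theorem spin_spinIsometry (L : ℂ →ₗᵢ[ℝ] Space) (z w v : ℂ) :
    spin (spinIsometry L z) 1 w v = spin L (1 - z * (starRingEnd ℂ) w) (w + z) v := by
  rw [spin, vec_vec L _ (spinIsometry_apply L z 1) (spinIsometry_apply L z Complex.I), spin]
  have hn : 1 + (z.re * z.re + z.im * z.im) ≠ 0 := by nlinarith [mul_self_nonneg z.re, mul_self_nonneg z.im]
  have hn' : 1 + (w.re * w.re + w.im * w.im) ≠ 0 := by nlinarith [mul_self_nonneg w.re, mul_self_nonneg w.im]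
  have hm : Complex.normSq (1 - z * (starRingEnd ℂ) w) + Complex.normSq (w + z) =
    (1 + (z.re * z.re + z.im * z.im)) * (1 + (w.re * w.re + w.im * w.im)) := by
    simp [Complex.normSq_apply]; ring
  rw [hm]
  simp only [Complex.normSq_apply, pow_two, Complex.add_re, Complex.add_im, Complex.mul_re,
    Complex.mul_im, Complex.sub_re, Complex.sub_im, Complex.I_re, Complex.I_im,
    Complex.conj_re, Complex.conj_im, Complex.one_re, Complex.one_im]
  congr 1 <;> · simp only [mul_zero, mul_one, zero_mul, add_zero, zero_add, sub_zero, zero_sub]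
                field_simp
                ring

end Placement

namespace Placement

theorem nonempty_linearIsometry : Nonempty (ℂ →ₗᵢ[ℝ] Space) :=
  ⟨{ toFun := fun w => !₂[w.re, w.im, 0]
     map_add' := fun w w' => by ext i; fin_cases i <;> simp
     map_smul' := fun r w => by ext i; fin_cases i <;> simp
     norm_map' := fun w => by
      change ‖!₂[w.re, w.im, 0]‖ = ‖w‖
      rw [EuclideanSpace.norm_eq, Complex.norm_eq_sqrt_sq_add_sq]
      simp [Fin.sum_univ_three] }⟩

/-- `spin` divides by the norm, so a real quaternion acts as the identity. This is what makes `z`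
and `-z` inverse folds. -/
theorem spin_smul_one (L : ℂ →ₗᵢ[ℝ] Space) {r : ℝ} (hr : r ≠ 0) (w : ℂ) :
    spin L r 0 w = L w := by
  rw [spin, vec, apply_eq L w]
  have h : (r : ℂ) ^ 2 * w + 0 ^ 2 * (starRingEnd ℂ) w = ((r ^ 2 : ℝ) : ℂ) * w := by
    push_cast; ring
  rw [h, Complex.re_ofReal_mul, Complex.im_ofReal_mul]
  simp only [Complex.normSq_ofReal, map_zero, mul_zero, Complex.zero_im, add_zero, zero_div,
    zero_smul]
  congr 2 <;> field_simp

theorem spin_one_line (L : ℂ →ₗᵢ[ℝ] Space) (t r : ℝ) (u : ℂ) :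
    spin L 1 (t * u) (r * u) = L (r * u) := by
  rw [spin, vec, apply_eq L (r * u)]
  have hn : 1 + t ^ 2 * (u.re * u.re + u.im * u.im) ≠ 0 := by
    nlinarith [mul_self_nonneg u.re, mul_self_nonneg u.im,
      mul_nonneg (sq_nonneg t) (mul_self_nonneg u.re),
      mul_nonneg (sq_nonneg t) (mul_self_nonneg u.im)]
  have hm : Complex.normSq 1 + Complex.normSq (t * u) =
      1 + t ^ 2 * (u.re * u.re + u.im * u.im) := by
    simp [Complex.normSq_apply]; ring
  have h3 : (1 * (r * u) * (starRingEnd ℂ) (t * u)).im = 0 := by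
    simp; ring
  rw [hm, h3]
  simp only [mul_zero, zero_div, zero_smul, add_zero]
  congr 2
  · rw [div_eq_iff hn]; simp [pow_two]; ring
  · rw [div_eq_iff hn]; simp [pow_two]; ring

/-- The placement `A` turned about an axis in its plane through the point `p`: `z` has the direction
of the axis, and its length is the tangent of half the angle. -/
noncomputable def fold (p z : ℂ) (A : ℂ →ᵃⁱ[ℝ] Space) : ℂ →ᵃⁱ[ℝ] Space where
  toFun q := A p + spinIsometry A.linearIsometry z (q - p)
  linear := (spinIsometry A.linearIsometry z).toLinearMap
  map_vadd' q v := by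
    simp only [vadd_eq_add, add_sub_assoc, map_add]
    change _ = spinIsometry A.linearIsometry z v + _
    abel
  norm_map v := (spinIsometry A.linearIsometry z).norm_map v

theorem fold_apply (p z : ℂ) (A : ℂ →ᵃⁱ[ℝ] Space) (q : ℂ) :
    fold p z A q = A p + spin A.linearIsometry 1 z (q - p) := rfl

theorem fold_linearIsometry (p z : ℂ) (A : ℂ →ᵃⁱ[ℝ] Space) :
    (fold p z A).linearIsometry = spinIsometry A.linearIsometry z := rfl

theorem apply_eq_add (A : ℂ →ᵃⁱ[ℝ] Space) (p q : ℂ) :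
    A q = A p + A.linearIsometry (q - p) := by
  have := A.map_vadd p (q - p)
  simpa [add_comm] using this

theorem fold_self (p z : ℂ) (A : ℂ →ᵃⁱ[ℝ] Space) : fold p z A p = A p := by
  rw [fold_apply, sub_self, ← spinIsometry_apply, map_zero, add_zero]

/-- The two coordinates of the product quaternion determine the composite. All closing conditions at
vertices and corners reduce to this lemma. -/
theorem fold_fold_congr (p : ℂ) {z w z' w' : ℂ} (A : ℂ →ᵃⁱ[ℝ] Space)
    (h1 : z * (starRingEnd ℂ) w = z' * (starRingEnd ℂ) w') (h2 : z + w = z' + w') :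
    fold p w (fold p z A) = fold p w' (fold p z' A) := by
  ext1 q
  rw [fold_apply, fold_apply p w', fold_self, fold_self, fold_linearIsometry, fold_linearIsometry,
    spin_spinIsometry, spin_spinIsometry, h1, add_comm w, h2, add_comm w']

theorem fold_fold_neg (p z : ℂ) (A : ℂ →ᵃⁱ[ℝ] Space) : fold p (-z) (fold p z A) = A := by
  ext1 q
  rw [fold_apply, fold_self, fold_linearIsometry, spin_spinIsometry, neg_add_cancel,
    apply_eq_add A p q]
  have : 1 - z * (starRingEnd ℂ) (-z) = ((1 + Complex.normSq z : ℝ) : ℂ) := by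
    rw [map_neg, mul_neg, Complex.mul_conj]; push_cast; ring
  rw [this, spin_smul_one]
  have := Complex.normSq_nonneg z
  positivity

theorem fold_neg_fold (p z : ℂ) (A : ℂ →ᵃⁱ[ℝ] Space) : fold p z (fold p (-z) A) = A := by
  simpa using fold_fold_neg p (-z) A

theorem fold_apply_line (p u : ℂ) (t r : ℝ) (A : ℂ →ᵃⁱ[ℝ] Space) :
    fold p (t * u) A (p + r * u) = A (p + r * u) := by
  rw [fold_apply, add_sub_cancel_left, spin_one_line, apply_eq_add A p (p + r * u),
    add_sub_cancel_left]

/-- The axis is fixed pointwise, so any of its points may serve as the base point. This lets a fold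
be read from either end of a crease. -/
theorem fold_add_line (p u : ℂ) (t r : ℝ) (A : ℂ →ᵃⁱ[ℝ] Space) :
    fold (p + r * u) (t * u) A = fold p (t * u) A := by
  ext1 q
  rw [apply_eq_add (fold p _ A) (p + r * u), fold_apply_line, fold_apply, fold_linearIsometry]
  rfl

/-- The sign is fixed by the convention of `IsFoldedState`: going from the left face to the right
face with fold angle `2 arctan t` is the fold by `-(t * u)`. -/
theorem fold_crease (p u : ℂ) (hu : ‖u‖ = 1) (t : ℝ) (A : ℂ →ᵃⁱ[ℝ] Space) :
    (fold p (-(t * u)) A).linearIsometry (Complex.I * u) =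
      Real.cos (2 * Real.arctan t) • A.linearIsometry (Complex.I * u) -
      Real.sin (2 * Real.arctan t) • vecCross (A.linearIsometry u)
        (A.linearIsometry (Complex.I * u)) := by
  have hu' : u.re * u.re + u.im * u.im = 1 := by
    rw [← Complex.normSq_apply, ← Complex.sq_norm, hu, one_pow]
  have ht : (1 + t ^ 2) ≠ 0 := by positivity
  have hc : Real.cos (2 * Real.arctan t) = (1 - t ^ 2) / (1 + t ^ 2) := by
    rw [Real.cos_two_mul, Real.cos_sq_arctan]; field_simp; ring
  have hs : Real.sin (2 * Real.arctan t) = 2 * t / (1 + t ^ 2) := by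
    rw [Real.sin_two_mul, Real.sin_arctan, Real.cos_arctan]
    have h : √(1 + t ^ 2) * √(1 + t ^ 2) = 1 + t ^ 2 := Real.mul_self_sqrt (by positivity)
    rw [show 2 * (t / √(1 + t ^ 2)) * (1 / √(1 + t ^ 2)) = 2 * t / (√(1 + t ^ 2) * √(1 + t ^ 2)) by
      field_simp, h]
  have h1 : A.linearIsometry u = vec A.linearIsometry u.re u.im 0 := by
    rw [apply_eq, vec]; simp
  have h2 : A.linearIsometry (Complex.I * u) = vec A.linearIsometry (-u.im) u.re 0 := by
    rw [apply_eq, vec]; simp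
  have hn : Complex.normSq 1 + Complex.normSq (-(t * u)) = 1 + t ^ 2 := by
    simp [Complex.normSq_apply]; linear_combination t ^ 2 * hu'
  rw [fold_linearIsometry, spinIsometry_apply, spin, hn, h1, h2, vecCross_vec, hc, hs]
  have e1 : (1 ^ 2 * (Complex.I * u) + (-(t * u)) ^ 2 * (starRingEnd ℂ) (Complex.I * u)).re =
      -u.im * (1 - t ^ 2) := by
    simp [pow_two]; linear_combination (u.im * t ^ 2) * hu'
  have e2 : (1 ^ 2 * (Complex.I * u) + (-(t * u)) ^ 2 * (starRingEnd ℂ) (Complex.I * u)).im =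
      u.re * (1 - t ^ 2) := by
    simp [pow_two]; linear_combination (-u.re * t ^ 2) * hu'
  have e3 : (1 * (Complex.I * u) * (starRingEnd ℂ) (-(t * u))).im = -t := by
    simp; linear_combination (-t) * hu'
  rw [e1, e2, e3]
  simp only [vec]
  match_scalars
  · ring
  · ring
  · field_simp; linear_combination (2 * t) * hu'

/-- The placements of the four sectors at a flat-foldable vertex close up. -/
theorem exists_vertex_state (p : ℂ) (z : ZMod 4 → ℂ) (b : ZMod 4)
    (h1 : z (b + 1) * (starRingEnd ℂ) (z b) = z (b + 2) * (starRingEnd ℂ) (z (b + 3)))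
    (h2 : z b + z (b + 1) + z (b + 2) + z (b + 3) = 0) (j : ZMod 4) :
    ∀ A : ℂ →ᵃⁱ[ℝ] Space, ∃ φ : ZMod 4 → ℂ →ᵃⁱ[ℝ] Space, φ j = A ∧
      ∀ i, φ (i - 1) = fold p (-z i) (φ i) := by
  -- Prescribing the sector `j - 1` is the same as prescribing the sector `j`, because the fold
  -- between them is invertible. One base sector therefore suffices.
  have hstep : ∀ j : ZMod 4, (∀ A : ℂ →ᵃⁱ[ℝ] Space, ∃ φ : ZMod 4 → ℂ →ᵃⁱ[ℝ] Space, φ j = A ∧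
      ∀ i, φ (i - 1) = fold p (-z i) (φ i)) → ∀ A : ℂ →ᵃⁱ[ℝ] Space,
      ∃ φ : ZMod 4 → ℂ →ᵃⁱ[ℝ] Space, φ (j - 1) = A ∧
      ∀ i, φ (i - 1) = fold p (-z i) (φ i) := by
    intro j hj A
    obtain ⟨φ, hφ, hφ'⟩ := hj (fold p (z j) A)
    exact ⟨φ, by rw [hφ', hφ, fold_fold_neg], hφ'⟩
  have hbase : ∀ A : ℂ →ᵃⁱ[ℝ] Space, ∃ φ : ZMod 4 → ℂ →ᵃⁱ[ℝ] Space, φ (b + 1) = A ∧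
      ∀ i, φ (i - 1) = fold p (-z i) (φ i) := by
    intro A
    have hb : ∀ b : ZMod 4, b - 1 = b + 3 ∧ b + 1 - 1 = b ∧ b + 2 - 1 = b + 1 ∧ b + 3 - 1 = b + 2 ∧
        b + 3 ≠ b + 1 ∧ b + 3 ≠ b ∧ b + 3 ≠ b + 2 ∧ b + 2 ≠ b + 1 ∧ b + 2 ≠ b ∧ b ≠ b + 1 := by
      decide
    obtain ⟨k0, k1, k2, k3, n1, n2, n3, n4, n5, n6⟩ := hb b
    refine ⟨fun i => if i = b + 1 then A else if i = b then fold p (-z (b + 1)) A else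
      if i = b + 2 then fold p (z (b + 2)) A else fold p (z (b + 3)) (fold p (z (b + 2)) A),
      by simp, fun i => ?_⟩
    rcases ZMod.eq_add_of_four b i with rfl | rfl | rfl | rfl
    · simp only [k0, n1, n2, n3, n6, if_true, if_false]
      -- From the sector `b + 1` the sector `b + 3` is reached both ways around the vertex, by two
      -- folds each; the hypotheses say that the results coincide.
      refine (fold_fold_congr p A ?_ ?_).symm
      · simp only [map_neg, neg_mul_neg, h1]
      · linear_combination -h2
    · simp only [k1, n6, if_true, if_false]
    · simp only [k2, n4, n5, if_true, if_false, fold_fold_neg]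
    · simp only [k3, n1, n2, n3, n4, n5, if_true, if_false, fold_fold_neg]
  have e0 : b + 1 - 1 = b := by ring
  have e1 : b - 1 = b + 3 := by clear * -; revert b; decide
  have e2 : b + 3 - 1 = b + 2 := by clear * -; revert b; decide
  have h0 := hstep _ hbase
  rw [e0] at h0
  have h3 := hstep _ h0
  rw [e1] at h3
  have h4 := hstep _ h3
  rw [e2] at h4
  exact ZMod.forall_four (p := fun j => ∀ A : ℂ →ᵃⁱ[ℝ] Space, ∃ φ : ZMod 4 → ℂ →ᵃⁱ[ℝ] Space,
    φ j = A ∧ ∀ i, φ (i - 1) = fold p (-z i) (φ i)) b h0 hbase h4 h3 j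

end Placement

/-! ### Folded states from folds, and half-angle formulas. -/

namespace CreasePattern

variable {X E F : Type*} (P : CreasePattern X E F)

theorem unitDir_eq {e : E} {u : ℂ} {r : ℝ} (hr : 0 < r) (hu : ‖u‖ = 1)
    (h : P.tgt e = P.src e + r * u) : P.unitDir e = u := by
  have hr' : (r : ℂ) ≠ 0 := by exact_mod_cast hr.ne'
  rw [unitDir, h, add_sub_cancel_left, norm_mul, hu, Complex.norm_real, Real.norm_of_nonneg hr.le]
  simp [hr']

/-- A state in which the right face of every crease is the left face turned about it. -/
theorem isFoldedState_of_fold (σ : F → ℂ →ᵃⁱ[ℝ] Space) (t : E → ℝ) (u : E → ℂ)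
    (hu : ∀ e, ‖u e‖ = 1) (htgt : ∀ e, ∃ r : ℝ, 0 < r ∧ P.tgt e = P.src e + r * u e)
    (h : ∀ e, σ (P.right e) = Placement.fold (P.src e) (-(t e * u e)) (σ (P.left e))) :
    P.IsFoldedState σ fun e => 2 * Real.arctan (t e) := by
  intro e
  obtain ⟨r, hr, htgt⟩ := htgt e
  refine ⟨?_, ?_, ?_⟩
  · rw [h, Placement.fold_self]
  · have := Placement.fold_apply_line (P.src e) (u e) (-t e) r (σ (P.left e))
    rw [h, htgt, ← this]
    push_cast
    rw [neg_mul]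
  · rw [P.unitDir_eq hr (hu e) htgt, h]
    exact Placement.fold_crease _ _ (hu e) _ _

theorem two_arctan_mem (t : ℝ) : 2 * Real.arctan t ∈ Set.Ioo (-Real.pi) Real.pi := by
  constructor
  · linarith [Real.neg_pi_div_two_lt_arctan t]
  · linarith [Real.arctan_lt_pi_div_two t]

end CreasePattern

theorem one_sub_mul_I_ne_zero (a : ℝ) : (1 - a * Complex.I : ℂ) ≠ 0 := by
  intro h'
  have := congrArg Complex.re h'
  simp at this

theorem exp_mul_I_eq_tan_half {α : ℝ} (h : Real.cos (α / 2) ≠ 0) :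
    Complex.exp (α * Complex.I) =
      (1 + Real.tan (α / 2) * Complex.I) / (1 - Real.tan (α / 2) * Complex.I) := by
  have h1 : Real.cos α = 2 * Real.cos (α / 2) ^ 2 - 1 := by
    rw [← Real.cos_two_mul]; congr 1; ring
  have h2 : Real.sin α = 2 * Real.sin (α / 2) * Real.cos (α / 2) := by
    rw [← Real.sin_two_mul]; congr 1; ring
  have hsq := Real.cos_sq_add_sin_sq (α / 2)
  rw [eq_div_iff (one_sub_mul_I_ne_zero _), Complex.exp_mul_I, ← Complex.ofReal_cos,
    ← Complex.ofReal_sin, h1, h2, Real.tan_eq_sin_div_cos]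
  generalize Real.cos (α / 2) = c at *
  generalize Real.sin (α / 2) = d at *
  apply Complex.ext
  · simp [pow_two]
    field_simp
    linear_combination 2 * hsq
  · simp [pow_two]
    field_simp
    linear_combination (0 : ℝ) * hsq

theorem exp_mul_I_mul_conj (α : ℝ) :
    Complex.exp (α * Complex.I) * (starRingEnd ℂ) (Complex.exp (α * Complex.I)) = 1 := by
  rw [← Complex.exp_conj, ← Complex.exp_add]
  simp

/-! ### Folding modes and motions of the network. -/

namespace OrigamiNetwork

variable {V : Type*} {N : OrigamiNetwork V}

/-- The tangent of half a sector angle. -/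
noncomputable def tanHalf (N : OrigamiNetwork V) (v : V) (i : ZMod 4) : ℝ :=
  Real.tan (N.angle v i / 2)

theorem cos_half_pos (hflat : N.IsFlatFoldable) (v : V) (i : ZMod 4) :
    0 < Real.cos (N.angle v i / 2) :=
  Real.cos_pos_of_mem_Ioo ⟨by linarith [N.angle_pos v i, Real.pi_pos],
    by linarith [angle_lt_pi hflat v i]⟩

theorem tanHalf_pos (hflat : N.IsFlatFoldable) (v : V) (i : ZMod 4) : 0 < N.tanHalf v i :=
  Real.tan_pos_of_pos_of_lt_pi_div_two (by linarith [N.angle_pos v i])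
    (by linarith [angle_lt_pi hflat v i])

theorem tanHalf_add_two (hflat : N.IsFlatFoldable) (v : V) (i : ZMod 4) :
    N.tanHalf v (i + 2) = 1 / N.tanHalf v i := by
  have : N.angle v (i + 2) / 2 = Real.pi / 2 - N.angle v i / 2 := by
    linarith [hflat v i]
  rw [tanHalf, this, Real.tan_pi_div_two_sub, tanHalf, one_div]

/-- The unit complex number of a sector angle. -/
noncomputable def turnBy (N : OrigamiNetwork V) (v : V) (i : ZMod 4) : ℂ :=
  Complex.exp (N.angle v i * Complex.I)

theorem turnBy_eq (hflat : N.IsFlatFoldable) (v : V) (i : ZMod 4) :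
    N.turnBy v i = (1 + N.tanHalf v i * Complex.I) / (1 - N.tanHalf v i * Complex.I) :=
  exp_mul_I_eq_tan_half (cos_half_pos hflat v i).ne'

theorem turnBy_mul_turnBy (hflat : N.IsFlatFoldable) (v : V) (i : ZMod 4) :
    N.turnBy v i * N.turnBy v (i + 2) = -1 := by
  rw [turnBy, turnBy, ← Complex.exp_add, ← add_mul, ← Complex.ofReal_add, hflat]
  exact Complex.exp_pi_mul_I

theorem dir_add_one (v : V) (i : ZMod 4) : N.dir v (i + 1) = N.turnBy v i * N.dir v i :=
  N.dir_succ v i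

theorem dir_add_two (v : V) (i : ZMod 4) :
    N.dir v (i + 2) = N.turnBy v (i + 1) * N.turnBy v i * N.dir v i := by
  rw [show i + 2 = i + 1 + 1 by ring, dir_add_one, dir_add_one, mul_assoc]

theorem dir_add_three (hflat : N.IsFlatFoldable) (v : V) (i : ZMod 4) :
    N.dir v (i + 3) = -(N.turnBy v (i + 1) * N.dir v i) := by
  rw [show i + 3 = i + 2 + 1 by ring, dir_add_one, dir_add_two]
  linear_combination (N.turnBy v (i + 1) * N.dir v i) * turnBy_mul_turnBy hflat v i

/-- The corners at which the creases of a vertex folding in the mode `m` are counted so that it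
folds in mode (b). -/
def IsBase : FoldMode → ZMod 4 → Prop
  | .a, b => b = 1 ∨ b = 3
  | .b, b => b = 0 ∨ b = 2

theorem exists_isBase (m : FoldMode) : ∃ b, IsBase m b := by
  cases m
  · exact ⟨1, Or.inl rfl⟩
  · exact ⟨0, Or.inl rfl⟩

theorem IsBase.add_two {m : FoldMode} {b : ZMod 4} (h : IsBase m b) : IsBase m (b + 2) := by
  cases m <;> rcases h with rfl | rfl
  · exact Or.inr rfl
  · exact Or.inl rfl
  · exact Or.inr rfl
  · exact Or.inl rfl

/-- The multiplier of mode (b), with the creases counted from the corner `b`. -/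
noncomputable def ratioQ (N : OrigamiNetwork V) (v : V) (b : ZMod 4) : ℝ :=
  (N.tanHalf v (b + 1) - N.tanHalf v b) / (N.tanHalf v (b + 1) + N.tanHalf v b)

/-- Replacing a sector angle by its supplement inverts the tangent of its half. Counting the creases
from `1` or `3` therefore turns `modeP` into the formula for `modeQ`, and both modes can be treated
as mode (b). -/
theorem modeVector_base (hflat : N.IsFlatFoldable) (v : V) {m : FoldMode} {b : ZMod 4}
    (hb : IsBase m b) :
    modeVector (N.angle v 0) (N.angle v 1) m b = -N.ratioQ v b ∧
    modeVector (N.angle v 0) (N.angle v 1) m (b + 1) = 1 ∧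
    modeVector (N.angle v 0) (N.angle v 1) m (b + 2) = N.ratioQ v b ∧
    modeVector (N.angle v 0) (N.angle v 1) m (b + 3) = 1 := by
  have h0 := tanHalf_pos hflat v 0
  have h1 := tanHalf_pos hflat v 1
  have h2 : N.tanHalf v 2 = 1 / N.tanHalf v 0 := tanHalf_add_two hflat v 0
  have h3 : N.tanHalf v 3 = 1 / N.tanHalf v 1 := tanHalf_add_two hflat v 1
  have e1 : (1 + 1 : ZMod 4) = 2 := rfl
  have e2 : (1 + 2 : ZMod 4) = 3 := rfl
  have e3 : (1 + 3 : ZMod 4) = 0 := rfl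
  have e4 : (3 + 1 : ZMod 4) = 0 := rfl
  have e5 : (3 + 2 : ZMod 4) = 1 := rfl
  have e6 : (3 + 3 : ZMod 4) = 2 := rfl
  have e7 : (2 + 1 : ZMod 4) = 3 := rfl
  have e8 : (2 + 2 : ZMod 4) = 0 := rfl
  have e9 : (2 + 3 : ZMod 4) = 1 := rfl
  have m0 : modeVector (N.angle v 0) (N.angle v 1) .a 0 = 1 := rfl
  have m1 : modeVector (N.angle v 0) (N.angle v 1) .a 1 = -modeP (N.angle v 0) (N.angle v 1) := rfl
  have m2 : modeVector (N.angle v 0) (N.angle v 1) .a 2 = 1 := rfl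
  have m3 : modeVector (N.angle v 0) (N.angle v 1) .a 3 = modeP (N.angle v 0) (N.angle v 1) := rfl
  have n0 : modeVector (N.angle v 0) (N.angle v 1) .b 0 = -modeQ (N.angle v 0) (N.angle v 1) := rfl
  have n1 : modeVector (N.angle v 0) (N.angle v 1) .b 1 = 1 := rfl
  have n2 : modeVector (N.angle v 0) (N.angle v 1) .b 2 = modeQ (N.angle v 0) (N.angle v 1) := rfl
  have n3 : modeVector (N.angle v 0) (N.angle v 1) .b 3 = 1 := rfl
  have hp : modeP (N.angle v 0) (N.angle v 1) =
    (1 - N.tanHalf v 0 * N.tanHalf v 1) / (1 + N.tanHalf v 0 * N.tanHalf v 1) := rfl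
  have hq : modeQ (N.angle v 0) (N.angle v 1) =
    (-N.tanHalf v 0 + N.tanHalf v 1) / (N.tanHalf v 0 + N.tanHalf v 1) := rfl
  have hpos := mul_pos h0 h1
  cases m <;> rcases hb with rfl | rfl <;>
    simp only [e1, e2, e3, e4, e5, e6, e7, e8, e9, zero_add, m0, m1, m2, m3, n0, n1, n2, n3, hp, hq,
      ratioQ, h2, h3, true_and, and_true] <;>
    constructor <;> field_simp <;> ring

theorem speeds_base (hflat : N.IsFlatFoldable) {m : V → FoldMode} {s : V × ZMod 4 → ℝ}
    (hs : N.IsFoldingMode m s) (v : V) {b : ZMod 4} (hb : IsBase (m v) b) :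
    s (v, b) = -(s (v, b + 1) * N.ratioQ v b) ∧ s (v, b + 2) = s (v, b + 1) * N.ratioQ v b ∧
      s (v, b + 3) = s (v, b + 1) := by
  obtain ⟨t, ht⟩ := hs.1 v
  obtain ⟨h0, h1, h2, h3⟩ := modeVector_base hflat v hb
  rw [ht, ht, ht, ht, h0, h1, h2, h3]
  simp

/-- Both differences of unit numbers are `2i` times a sine times the same unit number, and the
quotient of the sines is `ratioQ`. The identity is the sum condition at a vertex of the network. -/
theorem ratioQ_identity (hflat : N.IsFlatFoldable) (v : V) (b : ZMod 4) :
    (N.ratioQ v b : ℂ) * (N.turnBy v (b + 1) * N.turnBy v b - 1) =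
      N.turnBy v (b + 1) - N.turnBy v b := by
  have h0 := tanHalf_pos hflat v b
  have h1 := tanHalf_pos hflat v (b + 1)
  have hd : (N.tanHalf v (b + 1) + N.tanHalf v b : ℂ) ≠ 0 := by
    exact_mod_cast (add_pos h1 h0).ne'
  have hd0 := one_sub_mul_I_ne_zero (N.tanHalf v b)
  have hd1 := one_sub_mul_I_ne_zero (N.tanHalf v (b + 1))
  rw [turnBy_eq hflat, turnBy_eq hflat, ratioQ]
  push_cast
  field_simp
  ring

/-- The four sectors at a vertex of a network can be placed with the fold angles of a folding
mode. -/
theorem exists_network_vertex_state (hflat : N.IsFlatFoldable) {m : V → FoldMode}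
    {s : V × ZMod 4 → ℝ} (hs : N.IsFoldingMode m s) (τ : ℝ) (v : V) (j : ZMod 4)
    (A : ℂ →ᵃⁱ[ℝ] Space) :
    ∃ φ : ZMod 4 → ℂ →ᵃⁱ[ℝ] Space, φ j = A ∧
      ∀ i, φ (i - 1) = Placement.fold (N.pos v) (-((s (v, i) * τ : ℝ) * N.dir v i)) (φ i) := by
  obtain ⟨b, hb⟩ := exists_isBase (m v)
  obtain ⟨h0, h2, h3⟩ := speeds_base hflat hs v hb
  refine Placement.exists_vertex_state (N.pos v) (fun i => (s (v, i) * τ : ℝ) * N.dir v i) b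
    ?_ ?_ j A
  · have hE := exp_mul_I_mul_conj (N.angle v (b + 1))
    change N.turnBy v (b + 1) * (starRingEnd ℂ) (N.turnBy v (b + 1)) = 1 at hE
    simp only [h0, h2, h3, dir_add_three hflat, dir_add_two, dir_add_one, map_mul, map_neg,
      Complex.conj_ofReal]
    push_cast
    linear_combination (s (v, b + 1) ^ 2 * τ ^ 2 * N.ratioQ v b * N.turnBy v b * N.dir v b *
      (starRingEnd ℂ) (N.dir v b)) * hE
  · simp only [h0, h2, h3, dir_add_three hflat, dir_add_two, dir_add_one]
    push_cast
    linear_combination (s (v, b + 1) * τ * N.dir v b) * ratioQ_identity hflat v b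

theorem modeMotion_isFoldingMotion (hflat : N.IsFlatFoldable) (hplanar : N.pattern.IsPlanar)
    (htree : N.graph.IsTree) {m : V → FoldMode} {s : V × ZMod 4 → ℝ} (hs : N.IsFoldingMode m s) :
    N.pattern.IsFoldingMotion (modeMotion s) := by
  refine ⟨?_, fun τ => ⟨fun e => CreasePattern.two_arctan_mem _, ?_⟩, ?_⟩
  · refine continuous_pi fun d => ?_
    unfold modeMotion
    fun_prop
  · obtain ⟨root⟩ := htree.connected.nonempty
    obtain ⟨L₀⟩ := Placement.nonempty_linearIsometry
    obtain ⟨φ₀, -, hφ₀⟩ := exists_network_vertex_state hflat hs τ root 0 L₀.toAffineIsometry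
    obtain ⟨φ, -, hφ, hrel⟩ := exists_compatible hplanar htree
      (fun v (φ : ZMod 4 → ℂ →ᵃⁱ[ℝ] Space) => ∀ i, φ (i - 1) =
        Placement.fold (N.pos v) (-((s (v, i) * τ : ℝ) * N.dir v i)) (φ i))
      (fun d φ φ' => φ d.2 = φ' ((N.mate d).2 - 1) ∧ φ (d.2 - 1) = φ' (N.mate d).2)
      root φ₀ hφ₀
      (by
        intro d hd φ hφ
        -- Only the face on the left of the crease is prescribed. The face on the right then agrees,
        -- since it arises from the left one by the same fold seen from either end.
        obtain ⟨φ', h1, h2⟩ := exists_network_vertex_state hflat hs τ (N.mate d).1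
          ((N.mate d).2 - 1) (φ d.2)
        refine ⟨φ', h2, h1.symm, ?_⟩
        have h3 := h2 (N.mate d).2
        have h4 := hφ d.2
        have hpos := N.pos_mate d.1 d.2 hd
        change N.pos (N.mate d).1 = _ at hpos
        change φ' _ = Placement.fold _ (-((s (N.mate d) * τ : ℝ) * _)) _ at h3
        change φ _ = Placement.fold _ (-((s d * τ : ℝ) * _)) _ at h4
        rw [h4, ← h1, h3, N.dir_mate hd, hpos, hs.2 d]
        have := Placement.fold_add_line (N.pos d.1) (N.dir d.1 d.2) (s d * τ) (N.len d.1 d.2)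
          (φ' (N.mate d).2)
        rw [mul_neg, neg_neg, this, Placement.fold_fold_neg])
      (by
        intro d φ φ' hd h
        rw [N.mate_mate]
        exact ⟨h.2.symm, h.1.symm⟩)
    let σ : N.Face → ℂ →ᵃⁱ[ℝ] Space := Quot.lift (fun c => φ c.1 c.2) (by
      rintro c c' ⟨hc, rfl⟩
      exact (hrel c hc).1)
    refine ⟨σ, ?_⟩
    exact N.pattern.isFoldedState_of_fold σ (fun d => s d * τ) (fun d => N.dir d.1 d.2)
      (fun d => N.norm_dir _ _) (fun d => ⟨_, N.len_pos _ _, N.pattern_tgt d⟩) (fun d => hφ d.1 d.2)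
  · funext d
    simp [modeMotion]

/-- The scale at one vertex fixes the scale at its neighbour through the speed of their common
crease; a nonzero entry allows the division. -/
theorem exists_foldingMode_of_ne_zero (hplanar : N.pattern.IsPlanar)
    (htree : N.graph.IsTree) {m : V → FoldMode}
    (hm : ∀ v i, modeVector (N.angle v 0) (N.angle v 1) (m v) i ≠ 0) :
    ∃ s, N.IsFoldingMode m s ∧ ∀ d, s d ≠ 0 := by
  obtain ⟨root⟩ := htree.connected.nonempty
  obtain ⟨t, -, ht, hrel⟩ := exists_compatible hplanar htree (fun _ (t : ℝ) => t ≠ 0)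
    (fun d t t' => t * modeVector (N.angle d.1 0) (N.angle d.1 1) (m d.1) d.2 =
      t' * modeVector (N.angle (N.mate d).1 0) (N.angle (N.mate d).1 1) (m (N.mate d).1)
        (N.mate d).2) root 1 one_ne_zero
    (by
      intro d _ t ht
      refine ⟨t * modeVector (N.angle d.1 0) (N.angle d.1 1) (m d.1) d.2 /
        modeVector (N.angle (N.mate d).1 0) (N.angle (N.mate d).1 1) (m (N.mate d).1)
        (N.mate d).2, div_ne_zero (mul_ne_zero ht (hm _ _)) (hm _ _), ?_⟩
      rw [div_mul_cancel₀ _ (hm _ _)])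
    (by
      intro d t t' _ h
      rw [N.mate_mate, h])
  refine ⟨fun d => t d.1 * modeVector (N.angle d.1 0) (N.angle d.1 1) (m d.1) d.2,
    ⟨fun v => ⟨t v, fun i => rfl⟩, fun d => ?_⟩, fun d => mul_ne_zero (ht _) (hm _ _)⟩
  by_cases hd : N.mate d = d
  · rw [hd]
  · exact (hrel d hd).symm

theorem exists_mode_ne_zero (N : OrigamiNetwork V) (v : V) (i : ZMod 4) :
    ∃ m : FoldMode, modeVector (N.angle v 0) (N.angle v 1) m i ≠ 0 := by
  have : ∀ i : ZMod 4, i = 0 ∨ i = 2 ∨ i = 1 ∨ i = 3 := by decide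
  rcases this i with rfl | rfl | rfl | rfl
  · exact ⟨.a, one_ne_zero (α := ℝ)⟩
  · exact ⟨.a, one_ne_zero (α := ℝ)⟩
  · exact ⟨.b, one_ne_zero (α := ℝ)⟩
  · exact ⟨.b, one_ne_zero (α := ℝ)⟩

/-- The modes are chosen along the way: each new vertex gets a mode whose entry at the arriving
crease is `1`. The division is then possible even if other entries vanish, and the nonzero speed is
found at the root. -/
theorem exists_foldingMode (hplanar : N.pattern.IsPlanar)
    (htree : N.graph.IsTree) : ∃ m s, N.IsFoldingMode m s ∧ ∃ d, s d ≠ 0 := by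
  obtain ⟨root⟩ := htree.connected.nonempty
  obtain ⟨t, hroot, -, hrel⟩ := exists_compatible hplanar htree
    (fun _ (_ : FoldMode × ℝ) => True)
    (fun d t t' => t.2 * modeVector (N.angle d.1 0) (N.angle d.1 1) t.1 d.2 =
      t'.2 * modeVector (N.angle (N.mate d).1 0) (N.angle (N.mate d).1 1) t'.1
        (N.mate d).2) root (.a, 1) trivial
    (by
      intro d _ t _
      obtain ⟨m', hm'⟩ := exists_mode_ne_zero N (N.mate d).1 (N.mate d).2
      refine ⟨(m', t.2 * modeVector (N.angle d.1 0) (N.angle d.1 1) t.1 d.2 /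
        modeVector (N.angle (N.mate d).1 0) (N.angle (N.mate d).1 1) m' (N.mate d).2), trivial, ?_⟩
      rw [div_mul_cancel₀ _ hm'])
    (by
      intro d t t' _ h
      rw [N.mate_mate, h])
  refine ⟨fun v => (t v).1,
    fun d => (t d.1).2 * modeVector (N.angle d.1 0) (N.angle d.1 1) (t d.1).1 d.2,
    ⟨fun v => ⟨(t v).2, fun i => rfl⟩, fun d => ?_⟩, (root, 0), ?_⟩
  · by_cases hd : N.mate d = d
    · rw [hd]
    · exact (hrel d hd).symm
  · simp [hroot, modeVector]

end OrigamiNetwork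

/-! ### Folded states of a double-line pattern. -/

namespace OrigamiNetwork

variable {V : Type*} {N : OrigamiNetwork V}

section Lines

variable {corner : V × ZMod 4 → ℂ}
  (hline : ∀ d, N.mate d ≠ d → ∃ r : ℝ, 0 < r ∧
    corner ((N.mate d).1, (N.mate d).2 - 1) = corner d + r * N.dir d.1 d.2)
  (hbd : ∀ d, N.mate d = d → 0 < N.boundaryLen d.1 d.2 (corner d) ∧
    0 < N.boundaryLen d.1 d.2 (corner (d.1, d.2 - 1)))

include hline in
theorem corner_mate_eq {d : V × ZMod 4} (hd : N.mate d ≠ d) : ∃ r : ℝ, 0 < r ∧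
    corner (N.mate d) = corner (d.1, d.2 - 1) + r * N.dir d.1 d.2 := by
  obtain ⟨r, hr, h⟩ := hline (N.mate d) (N.mate_mate_ne hd)
  rw [N.mate_mate, N.dir_mate hd] at h
  exact ⟨r, hr, by rw [h]; ring⟩

include hline hbd in
theorem tgt_leftLine (d : V × ZMod 4) : ∃ r : ℝ, 0 < r ∧
    (N.doubleLine corner).tgt (.leftLine d) = corner d + r * N.dir d.1 d.2 := by
  by_cases hd : N.mate d = d
  · exact ⟨_, (hbd d hd).1, by simp [CreasePattern.tgt, doubleLine, hd]⟩
  · obtain ⟨r, hr, h⟩ := hline d hd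
    exact ⟨r, hr, by simp [CreasePattern.tgt, doubleLine, hd, h]⟩

include hline hbd in
theorem tgt_rightLine (d : V × ZMod 4) : ∃ r : ℝ, 0 < r ∧
    (N.doubleLine corner).tgt (.rightLine d) = corner (d.1, d.2 - 1) + r * N.dir d.1 d.2 := by
  by_cases hd : N.mate d = d
  · exact ⟨_, (hbd d hd).2, by simp [CreasePattern.tgt, doubleLine, hd]⟩
  · obtain ⟨r, hr, h⟩ := corner_mate_eq hline hd
    exact ⟨r, hr, by simp [CreasePattern.tgt, doubleLine, hd, h]⟩

end Lines

/-- The folding speeds of the creases of a double-line pattern. -/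
def dlSpeed (S l r : V × ZMod 4 → ℝ) : DLCrease V → ℝ
  | .side d => S d
  | .leftLine d => l d
  | .rightLine d => r d

/-- The speeds of the creases at the corners of the central polygons are compatible. -/
structure IsDLSpeed (N : OrigamiNetwork V) (θ : V → ℝ) (S l r : V × ZMod 4 → ℝ) : Prop where
  mul : ∀ v i, S (v, i) * l (v, i) = -(S (v, i + 1) * r (v, i + 1))
  add : ∀ v i, (-(S (v, i) * Complex.exp (θ v * Complex.I)) + l (v, i) : ℂ) =
    -(S (v, i + 1) * Complex.exp (θ v * Complex.I) * N.turnBy v i) - r (v, i + 1) * N.turnBy v i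
  mate : ∀ d, N.mate d ≠ d → l d = r (N.mate d)

open Placement in
/-- The faces around the central polygon of a vertex can be placed. -/
theorem exists_dl_vertex_state {θ : V → ℝ} {S l r : V × ZMod 4 → ℝ} (hS : N.IsDLSpeed θ S l r)
    {corner : V × ZMod 4 → ℂ}
    (hside : ∀ v i, ∃ x : ℝ, 0 < x ∧ corner (v, i) =
      corner (v, i - 1) + x * (Complex.exp (θ v * Complex.I) * N.dir v i))
    (T : ℝ) (v : V) (j : ZMod 4) (B₀ : ℂ →ᵃⁱ[ℝ] Space) :
    ∃ (C : ℂ →ᵃⁱ[ℝ] Space) (B A : ZMod 4 → ℂ →ᵃⁱ[ℝ] Space), B j = B₀ ∧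
      (∀ i, B i = fold (corner (v, i - 1))
        (-((S (v, i) * T : ℝ) * (Complex.exp (θ v * Complex.I) * N.dir v i))) C) ∧
      (∀ i, B i = fold (corner (v, i)) (-((l (v, i) * T : ℝ) * N.dir v i)) (A i)) ∧
      ∀ i, A (i - 1) = fold (corner (v, i - 1)) (-((r (v, i) * T : ℝ) * N.dir v i)) (B i) := by
  let C := fold (corner (v, j - 1))
    ((S (v, j) * T : ℝ) * (Complex.exp (θ v * Complex.I) * N.dir v j)) B₀
  let B := fun i => fold (corner (v, i - 1))
    (-((S (v, i) * T : ℝ) * (Complex.exp (θ v * Complex.I) * N.dir v i))) C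
  let A := fun i => fold (corner (v, i)) ((l (v, i) * T : ℝ) * N.dir v i) (B i)
  refine ⟨C, B, A, fold_fold_neg _ _ _, fun i => rfl, fun i => (fold_fold_neg _ _ _).symm, ?_⟩
  -- At the corner `(v, i)` the sector is reached from the center across either of two adjacent
  -- strips. Each side makes the same angle with its crease, so the factor `exp (θ v * I)` is common
  -- to both products and only `hS.mul` remains.
  have key : ∀ i, A i = fold (corner (v, i)) (-((r (v, i + 1) * T : ℝ) * N.dir v (i + 1)))
      (B (i + 1)) := by
    intro i
    obtain ⟨x, -, hx⟩ := hside v i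
    have hB : B i = fold (corner (v, i))
        (-((S (v, i) * T : ℝ) * (Complex.exp (θ v * Complex.I) * N.dir v i))) C := by
      have := fold_add_line (corner (v, i - 1)) (Complex.exp (θ v * Complex.I) * N.dir v i)
        (-(S (v, i) * T)) x C
      rw [hx]
      push_cast at this ⊢
      rw [neg_mul] at this
      rw [this]
      simp only [B]
      push_cast
      rfl
    have hu : ∀ i, N.dir v i * (starRingEnd ℂ) (N.dir v i) = 1 := by
      intro i
      rw [Complex.mul_conj, ← Complex.sq_norm, N.norm_dir]; simp
    have hmul : (S (v, i) * l (v, i) : ℂ) = -(S (v, i + 1) * r (v, i + 1)) := by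
      exact_mod_cast hS.mul v i
    simp only [A]
    rw [hB]
    simp only [B, add_sub_cancel_right]
    apply fold_fold_congr
    · simp only [map_mul, map_neg, Complex.conj_ofReal]
      push_cast
      linear_combination (-S (v, i) * l (v, i) * T ^ 2 * Complex.exp (θ v * Complex.I)) * hu i -
        (S (v, i + 1) * r (v, i + 1) * T ^ 2 * Complex.exp (θ v * Complex.I)) * hu (i + 1) -
        (T ^ 2 * Complex.exp (θ v * Complex.I)) * hmul
    · rw [dir_add_one]
      push_cast
      linear_combination (T * N.dir v i) * hS.add v i
  intro i
  have := key (i - 1)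
  rwa [sub_add_cancel] at this

open Placement in
/-- A double-line pattern on a tree has the folded states given by compatible speeds. -/
theorem exists_dl_folded_state (hplanar : N.pattern.IsPlanar)
    (htree : N.graph.IsTree) {θ : V → ℝ} {S l r : V × ZMod 4 → ℝ} (hS : N.IsDLSpeed θ S l r)
    {corner : V × ZMod 4 → ℂ}
    (hside : ∀ v i, ∃ x : ℝ, 0 < x ∧ corner (v, i) =
      corner (v, i - 1) + x * (Complex.exp (θ v * Complex.I) * N.dir v i))
    (hline : ∀ d, N.mate d ≠ d → ∃ r : ℝ, 0 < r ∧
      corner ((N.mate d).1, (N.mate d).2 - 1) = corner d + r * N.dir d.1 d.2)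
    (hbd : ∀ d, N.mate d = d → 0 < N.boundaryLen d.1 d.2 (corner d) ∧
      0 < N.boundaryLen d.1 d.2 (corner (d.1, d.2 - 1)))
    (T : ℝ) :
    ∃ σ, (N.doubleLine corner).IsFoldedState σ
      fun e => 2 * Real.arctan (dlSpeed S l r e * T) := by
  obtain ⟨root⟩ := htree.connected.nonempty
  obtain ⟨L₀⟩ := nonempty_linearIsometry
  obtain ⟨C₀, B₀, A₀, -, h₀⟩ := exists_dl_vertex_state hS hside T root 0 L₀.toAffineIsometry
  obtain ⟨f, -, hf, hrel⟩ := exists_compatible hplanar htree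
    (fun v (f : (ℂ →ᵃⁱ[ℝ] Space) × (ZMod 4 → ℂ →ᵃⁱ[ℝ] Space) × (ZMod 4 → ℂ →ᵃⁱ[ℝ] Space)) =>
      (∀ i, f.2.1 i = fold (corner (v, i - 1))
        (-((S (v, i) * T : ℝ) * (Complex.exp (θ v * Complex.I) * N.dir v i))) f.1) ∧
      (∀ i, f.2.1 i = fold (corner (v, i)) (-((l (v, i) * T : ℝ) * N.dir v i)) (f.2.2 i)) ∧
      ∀ i, f.2.2 (i - 1) =
        fold (corner (v, i - 1)) (-((r (v, i) * T : ℝ) * N.dir v i)) (f.2.1 i))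
    (fun d f f' => f.2.1 d.2 = f'.2.1 (N.mate d).2 ∧ f.2.2 d.2 = f'.2.2 ((N.mate d).2 - 1) ∧
      f.2.2 (d.2 - 1) = f'.2.2 (N.mate d).2)
    root (C₀, B₀, A₀) h₀
    (by
      rintro d hd ⟨C, B, A⟩ ⟨-, h2, h3⟩
      -- The strip is carried over to the neighbour. The two sectors beside it follow, since the
      -- speeds of each line agree at its two ends.
      obtain ⟨C', B', A', e, h1', h2', h3'⟩ := exists_dl_vertex_state hS hside T
        (N.mate d).1 (N.mate d).2 (B d.2)
      refine ⟨(C', B', A'), ⟨h1', h2', h3'⟩, e.symm, ?_, ?_⟩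
      · obtain ⟨ρ, -, hρ⟩ := hline d hd
        have e1 := h3' (N.mate d).2
        have e2 := h2 d.2
        simp only at e2 ⊢
        rw [e, hρ, N.dir_mate hd, ← hS.mate d hd, mul_neg, neg_neg, fold_add_line, e2,
          fold_neg_fold] at e1
        exact e1.symm
      · obtain ⟨ρ, -, hρ⟩ := corner_mate_eq hline hd
        have e1 := h2' (N.mate d).2
        have e2 := h3 d.2
        have e3 := hS.mate (N.mate d) (N.mate_mate_ne hd)
        rw [N.mate_mate] at e3
        change B' (N.mate d).2 = fold (corner (N.mate d)) (-((l (N.mate d) * T : ℝ) * _)) _ at e1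
        simp only at e2 ⊢
        change A _ = fold _ (-((r d * T : ℝ) * _)) _ at e2
        rw [e, hρ, N.dir_mate hd, e3, mul_neg, neg_neg, fold_add_line] at e1
        rw [e2, e1, fold_fold_neg])
    (by
      rintro d f f' hd ⟨h1, h2, h3⟩
      rw [N.mate_mate]
      exact ⟨h1.symm, h3.symm, h2.symm⟩)
  let σ : DLFace N → ℂ →ᵃⁱ[ℝ] Space
    | .sector c => Quot.lift (fun c => (f c.1).2.2 c.2) (by
        rintro c c' ⟨hc, rfl⟩
        exact (hrel c hc).2.1) c
    | .strip c => Quot.lift (fun d => (f d.1).2.1 d.2) (by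
        rintro d d' rfl
        by_cases hd : N.mate d = d
        · rw [hd]
        · exact (hrel d hd).1) c
    | .center v => (f v).1
  refine ⟨σ, (N.doubleLine corner).isFoldedState_of_fold σ (fun e => dlSpeed S l r e * T)
    (fun e => match e with
      | .side d => Complex.exp (θ d.1 * Complex.I) * N.dir d.1 d.2
      | .leftLine d => N.dir d.1 d.2
      | .rightLine d => N.dir d.1 d.2) ?_ ?_ ?_⟩
  · rintro (d | d | d)
    · simp [Complex.norm_exp_ofReal_mul_I, N.norm_dir]
    · exact N.norm_dir _ _
    · exact N.norm_dir _ _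
  · rintro (d | d | d)
    · exact hside d.1 d.2
    · exact tgt_leftLine hline hbd d
    · exact tgt_rightLine hline hbd d
  · rintro (d | d | d)
    · exact (hf d.1).1 d.2
    · exact (hf d.1).2.1 d.2
    · exact (hf d.1).2.2 d.2

end OrigamiNetwork

/-! ### Disjointness of the sectors at a vertex and of the directions at a corner. -/

/-- The line through the common ray separates the two sectors: after multiplication by `conj E` the
imaginary parts have opposite signs. -/
theorem sector_adjacent {E E' : ℂ} (hE : E * (starRingEnd ℂ) E = 1) (h : 0 < E.im) (h' : 0 < E'.im)
    {A B A' B' : ℝ} (hA : 0 < A) (hB' : 0 ≤ B') :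
    (A + B * E : ℂ) ≠ A' * E + B' * (E' * E) := by
  intro heq
  have h1 : (A * (starRingEnd ℂ) E + B : ℂ) = A' + B' * E' := by
    linear_combination (starRingEnd ℂ) E * heq + (-B + A' + B' * E') * hE
  have h2 := congrArg Complex.im h1
  simp at h2
  nlinarith [mul_pos hA h, mul_nonneg hB' h'.le]

/-- The line along `E'` weakly separates the two sectors when the two angles add up to at most `π`.
Equality of the imaginary parts leaves only the two bounding rays, and these could coincide only as
opposite directions. -/
theorem sector_opposite {E E' : ℂ} (hE : E * (starRingEnd ℂ) E = 1)
    (hE' : E' * (starRingEnd ℂ) E' = 1) (h : 0 < E.im) (h' : 0 < E'.im) (hEE' : 0 ≤ (E' * E).im)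
    {A B A' B' : ℝ} (hA : 0 < A) (hB : 0 ≤ B) (hA' : 0 < A') (hB' : 0 ≤ B') :
    (A + B * E : ℂ) ≠ A' * (E' * E) - B' * E' := by
  intro heq
  have h1 : (A * (starRingEnd ℂ) (E' * E) + B * (starRingEnd ℂ) E' : ℂ) =
      A' - B' * (starRingEnd ℂ) E := by
    rw [map_mul]
    linear_combination (starRingEnd ℂ) E * (starRingEnd ℂ) E' * heq -
      (B * (starRingEnd ℂ) E' - A') * hE + (A' * (E * (starRingEnd ℂ) E) -
        B' * (starRingEnd ℂ) E) * hE'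
  have h2 := congrArg Complex.im h1
  simp only [Complex.add_im, Complex.sub_im, Complex.im_ofReal_mul, Complex.conj_im,
    Complex.ofReal_im] at h2
  have p1 := mul_nonneg hA.le hEE'
  have p2 := mul_nonneg hB h'.le
  have p3 := mul_nonneg hB' h.le
  have q1 : (E' * E).im = 0 := by
    have : A * (E' * E).im = 0 := by linarith
    exact (mul_eq_zero.1 this).resolve_left hA.ne'
  have q2 : B = 0 := by
    have : B * E'.im = 0 := by linarith
    exact (mul_eq_zero.1 this).resolve_right h'.ne'
  have q3 : B' = 0 := by
    have : B' * E.im = 0 := by linarith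
    exact (mul_eq_zero.1 this).resolve_right h.ne'
  have h3 := congrArg Complex.re heq
  have hn := congrArg Complex.re hE
  simp [q2, q3] at h3 hn q1
  have h4 : E.im * (E'.re * E.re - E'.im * E.im) = -E'.im := by
    linear_combination -E'.im * hn + E.re * q1
  have h5 : E.im * A = -(A' * E'.im) := by rw [h3]; linear_combination A' * h4
  nlinarith [mul_pos h hA, mul_pos hA' h']

/-- The four directions at a corner of a central polygon, relative to the first one. -/
def starUnit (E W : ℂ) : Fin 4 → ℂ := ![1, E, W * E, -W]

@[simp] theorem starUnit_zero (E W : ℂ) : starUnit E W 0 = 1 := rfl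
@[simp] theorem starUnit_one (E W : ℂ) : starUnit E W 1 = E := rfl
@[simp] theorem starUnit_two (E W : ℂ) : starUnit E W 2 = W * E := rfl
@[simp] theorem starUnit_three (E W : ℂ) : starUnit E W 3 = -W := rfl

theorem starUnit_injective {E W : ℂ} (hE : E * (starRingEnd ℂ) E = 1) (h : 0 < E.im)
    (h' : 0 < W.im) (hW : W * (starRingEnd ℂ) W = 1) : Function.Injective (starUnit E W) := by
  have hE0 : E ≠ 0 := by rintro rfl; simp at h
  have hW0 : W ≠ 0 := by rintro rfl; simp at h'
  have n01 : (1 : ℂ) ≠ E := by rintro rfl; simp at h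
  have n02 : (1 : ℂ) ≠ W * E := by
    intro h1
    have h2 : W = (starRingEnd ℂ) E := by
      linear_combination W * (-hE) - (starRingEnd ℂ) E * h1
    have := congrArg Complex.im h2
    simp at this
    linarith
  have n03 : (1 : ℂ) ≠ -W := by
    intro h1
    have := congrArg Complex.im h1
    simp at this
    linarith
  have n12 : E ≠ W * E := by
    intro h1
    have h2 : W = 1 := mul_right_cancel₀ hE0 (by rw [← h1, one_mul])
    rw [h2] at h'
    simp at h'
  have n13 : E ≠ -W := by
    intro h1
    have := congrArg Complex.im h1
    simp at this
    linarith
  have n23 : W * E ≠ -W := by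
    intro h1
    have h2 : E = -1 := mul_left_cancel₀ hW0 (by rw [h1]; ring)
    rw [h2] at h
    simp at h
  intro k k' hk
  fin_cases k <;> fin_cases k' <;> simp [starUnit] at hk ⊢ <;>
    first | exact absurd hk ‹_› | exact absurd hk.symm ‹_›

theorem norm_starUnit {E W : ℂ} (hE : ‖E‖ = 1) (hW : ‖W‖ = 1) (k : Fin 4) :
    ‖starUnit E W k‖ = 1 := by
  fin_cases k <;> simp [starUnit, hE, hW]

namespace OrigamiNetwork

variable {V : Type*} {N : OrigamiNetwork V}

theorem turnBy_mul_conj (v : V) (i : ZMod 4) :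
    N.turnBy v i * (starRingEnd ℂ) (N.turnBy v i) = 1 := exp_mul_I_mul_conj _

theorem norm_turnBy (v : V) (i : ZMod 4) : ‖N.turnBy v i‖ = 1 :=
  Complex.norm_exp_ofReal_mul_I _

theorem turnBy_im (v : V) (i : ZMod 4) : (N.turnBy v i).im = Real.sin (N.angle v i) :=
  Complex.exp_ofReal_mul_I_im _

theorem sin_angle_pos (hflat : N.IsFlatFoldable) (v : V) (i : ZMod 4) :
    0 < Real.sin (N.angle v i) :=
  Real.sin_pos_of_pos_of_lt_pi (N.angle_pos v i) (angle_lt_pi hflat v i)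

theorem turnBy_im_pos (hflat : N.IsFlatFoldable) (v : V) (i : ZMod 4) : 0 < (N.turnBy v i).im := by
  rw [turnBy_im]; exact sin_angle_pos hflat v i

theorem turnBy_add_two (hflat : N.IsFlatFoldable) (v : V) (i : ZMod 4) :
    N.turnBy v (i + 2) = -(starRingEnd ℂ) (N.turnBy v i) := by
  linear_combination (starRingEnd ℂ) (N.turnBy v i) * turnBy_mul_turnBy hflat v i -
    N.turnBy v (i + 2) * turnBy_mul_conj v i

/-- The sectors at a vertex, each with the first of its two bounding creases. -/
def InSector (N : OrigamiNetwork V) (v : V) (i : ZMod 4) (z : ℂ) : Prop :=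
  ∃ A B : ℝ, 0 < A ∧ 0 ≤ B ∧ z = A * N.dir v i + B * N.dir v (i + 1)

theorem sector_ne_add_one (hflat : N.IsFlatFoldable) {v : V} {i : ZMod 4} {z : ℂ}
    (h : N.InSector v i z) (h' : N.InSector v (i + 1) z) : False := by
  obtain ⟨A, B, hA, hB, rfl⟩ := h
  obtain ⟨A', B', hA', hB', h⟩ := h'
  rw [show i + 1 + 1 = i + 2 by ring, dir_add_two, dir_add_one] at h
  refine sector_adjacent (turnBy_mul_conj v i) (turnBy_im_pos hflat v i)
    (turnBy_im_pos hflat v (i + 1)) hA hB' (B := B) (A' := A')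
    (mul_right_cancel₀ (N.dir_ne_zero v i) ?_)
  linear_combination h

theorem sector_ne_add_two (hflat : N.IsFlatFoldable) {v : V} {i : ZMod 4} {z : ℂ}
    (h : N.InSector v i z) (h' : N.InSector v (i + 2) z)
    (him : 0 ≤ (N.turnBy v (i + 1) * N.turnBy v i).im) : False := by
  obtain ⟨A, B, hA, hB, rfl⟩ := h
  obtain ⟨A', B', hA', hB', h⟩ := h'
  rw [show i + 2 + 1 = i + 3 by ring, dir_add_two, dir_add_one, dir_add_three hflat] at h
  refine sector_opposite (turnBy_mul_conj v i) (turnBy_mul_conj v (i + 1))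
    (turnBy_im_pos hflat v i) (turnBy_im_pos hflat v (i + 1)) him hA hB hA' hB'
    (mul_right_cancel₀ (N.dir_ne_zero v i) ?_)
  linear_combination h

theorem sector_unique (hflat : N.IsFlatFoldable) {v : V} {i j : ZMod 4} {z : ℂ}
    (h : N.InSector v i z) (h' : N.InSector v j z) : i = j := by
  rcases ZMod.eq_add_of_four i j with rfl | rfl | rfl | rfl
  · rfl
  · exact (sector_ne_add_one hflat h h').elim
  -- If the two sector angles from `i` on add up to more than `π`, their supplements from `i + 2` on
  -- add up to less, and the two sectors exchange roles.
  · rcases le_total 0 (N.turnBy v (i + 1) * N.turnBy v i).im with him | him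
    · exact (sector_ne_add_two hflat h h' him).elim
    · have e : i = i + 2 + 2 := by clear * -; revert i; decide
      rw [e] at h
      refine (sector_ne_add_two hflat h' h ?_).elim
      rw [show i + 2 + 1 = i + 1 + 2 by ring, turnBy_add_two hflat, turnBy_add_two hflat,
        neg_mul_neg, ← map_mul, Complex.conj_im]
      linarith
  · have e : i = i + 3 + 1 := by clear * -; revert i; decide
    rw [e] at h
    exact (sector_ne_add_one hflat h' h).elim

end OrigamiNetwork

/-! ### Central polygons and the star of creases at each corner. -/

namespace OrigamiNetwork

variable {V : Type*} {N : OrigamiNetwork V}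

/-- The interiors of the sectors at a vertex. -/
def InOpenSector (N : OrigamiNetwork V) (v : V) (i : ZMod 4) (z : ℂ) : Prop :=
  ∃ A B : ℝ, 0 < A ∧ 0 < B ∧ z = A * N.dir v i + B * N.dir v (i + 1)

theorem InOpenSector.inSector {v : V} {i : ZMod 4} {z : ℂ} (h : N.InOpenSector v i z) :
    N.InSector v i z := by
  obtain ⟨A, B, hA, hB, h⟩ := h
  exact ⟨A, B, hA, hB.le, h⟩

theorem InOpenSector.add {v : V} {i : ZMod 4} {z : ℂ} (h : N.InOpenSector v i z) {s a b : ℝ}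
    (hs : 0 < s) (ha : 0 ≤ a) (hb : 0 ≤ b) :
    N.InOpenSector v i (s * z + a * N.dir v i + b * N.dir v (i + 1)) := by
  obtain ⟨A, B, hA, hB, rfl⟩ := h
  exact ⟨s * A + a, s * B + b, by positivity, by positivity, by push_cast; ring⟩

theorem InOpenSector.ne_mul_dir (hflat : N.IsFlatFoldable) {v : V} {i : ZMod 4} {z : ℂ}
    (h : N.InOpenSector v i z) (r : ℝ) : z ≠ r * N.dir v i := by
  obtain ⟨A, B, hA, hB, rfl⟩ := h
  intro heq
  rw [dir_add_one] at heq
  have h1 : (A + B * N.turnBy v i : ℂ) = r :=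
    mul_right_cancel₀ (N.dir_ne_zero v i) (by linear_combination heq)
  have h2 := congrArg Complex.im h1
  simp at h2
  have := turnBy_im_pos hflat v i
  rcases h2 with h2 | h2 <;> linarith

/-- The data of central polygons at the vertices: the side across `eᵢ` at the vertex `v` crosses it
at the distance `r (v, i)` and extends by `x (v, i)` to its left and by `y (v, i)` to its right. The
sides of consecutive creases meet at a corner, and the widths of the strips match. -/
structure IsPolygonData (N : OrigamiNetwork V) (θ : V → ℝ) (r x y : V × ZMod 4 → ℝ) : Prop where
  angle_mem : ∀ v, θ v ∈ Set.Ioo 0 Real.pi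
  r_pos : ∀ d, 0 < r d
  x_pos : ∀ d, 0 < x d
  y_pos : ∀ d, 0 < y d
  meet : ∀ v i, (r (v, i) + x (v, i) * Complex.exp (θ v * Complex.I) : ℂ) =
    (r (v, i + 1) - y (v, i + 1) * Complex.exp (θ v * Complex.I)) * N.turnBy v i
  width : ∀ d, N.mate d ≠ d →
    x d * Real.sin (θ d.1) = y (N.mate d) * Real.sin (θ (N.mate d).1)

/-- The corner of a central polygon relative to its vertex. -/
noncomputable def offset (N : OrigamiNetwork V) (θ : V → ℝ) (r x : V × ZMod 4 → ℝ)
    (d : V × ZMod 4) : ℂ :=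
  r d * N.dir d.1 d.2 + x d * (Complex.exp (θ d.1 * Complex.I) * N.dir d.1 d.2)

/-- The corners of the central polygons, scaled by `ε`. -/
noncomputable def scaledCorner (N : OrigamiNetwork V) (θ : V → ℝ) (r x : V × ZMod 4 → ℝ) (ε : ℝ)
    (d : V × ZMod 4) : ℂ :=
  N.pos d.1 + ε * N.offset θ r x d

namespace IsPolygonData

variable {θ : V → ℝ} {r x y : V × ZMod 4 → ℝ} (D : N.IsPolygonData θ r x y)

include D

theorem sin_pos (v : V) : 0 < Real.sin (θ v) :=
  Real.sin_pos_of_pos_of_lt_pi (D.angle_mem v).1 (D.angle_mem v).2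

theorem offset_sub_one (v : V) (i : ZMod 4) :
    N.offset θ r x (v, i - 1) =
      r (v, i) * N.dir v i - y (v, i) * (Complex.exp (θ v * Complex.I) * N.dir v i) := by
  have h := D.meet v (i - 1)
  have h2 := N.dir_add_one v (i - 1)
  rw [sub_add_cancel] at h h2
  rw [offset, h2]
  linear_combination N.dir v (i - 1) * h

theorem offset_inOpenSector (hflat : N.IsFlatFoldable) (v : V) (i : ZMod 4) :
    N.InOpenSector v i (N.offset θ r x (v, i)) := by
  have hs := sin_angle_pos hflat v i
  have hθ := D.sin_pos v
  -- The products `x * sin θ` and `y * sin θ` are the distances of the corner from the two bounding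
  -- creases; division by the sine of the sector angle gives its oblique coordinates.
  refine ⟨y (v, i + 1) * Real.sin (θ v) / Real.sin (N.angle v i),
    x (v, i) * Real.sin (θ v) / Real.sin (N.angle v i),
    div_pos (mul_pos (D.y_pos _) hθ) hs, div_pos (mul_pos (D.x_pos _) hθ) hs, ?_⟩
  have hm := D.meet v i
  rw [dir_add_one, offset]
  have key : (r (v, i) + x (v, i) * Complex.exp (θ v * Complex.I) : ℂ) * Real.sin (N.angle v i) =
      y (v, i + 1) * Real.sin (θ v) + x (v, i) * Real.sin (θ v) * N.turnBy v i := by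
    have h1 := congrArg Complex.re hm
    have h2 := congrArg Complex.im hm
    have h3 := Real.cos_sq_add_sin_sq (N.angle v i)
    simp only [turnBy, Complex.add_re, Complex.add_im, Complex.sub_re, Complex.sub_im,
      Complex.mul_re, Complex.mul_im, Complex.ofReal_re, Complex.ofReal_im,
      Complex.exp_ofReal_mul_I_re, Complex.exp_ofReal_mul_I_im] at h1 h2
    apply Complex.ext
    · simp only [turnBy, Complex.add_re, Complex.mul_re, Complex.mul_im, Complex.add_im,
        Complex.ofReal_re, Complex.ofReal_im,
        Complex.exp_ofReal_mul_I_re, Complex.exp_ofReal_mul_I_im]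
      linear_combination Real.sin (N.angle v i) * h1 - Real.cos (N.angle v i) * h2 +
        (y (v, i + 1) * Real.sin (θ v)) * h3
    · simp only [turnBy, Complex.add_re, Complex.mul_re, Complex.mul_im, Complex.add_im,
        Complex.ofReal_re, Complex.ofReal_im,
        Complex.exp_ofReal_mul_I_re, Complex.exp_ofReal_mul_I_im]
      ring
  have hs' : (Real.sin (N.angle v i) : ℂ) ≠ 0 := by exact_mod_cast hs.ne'
  push_cast at key hs' ⊢
  field_simp
  linear_combination N.dir v i * key

/-- The part of a side to the left of its crease. -/
theorem left_inOpenSector (hflat : N.IsFlatFoldable) (v : V) (i : ZMod 4) {τ : ℝ} (h0 : 0 < τ)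
    (h1 : τ ≤ x (v, i)) : N.InOpenSector v i
      (r (v, i) * N.dir v i + τ * (Complex.exp (θ v * Complex.I) * N.dir v i)) := by
  have hx := D.x_pos (v, i)
  have hx' : (x (v, i) : ℂ) ≠ 0 := by exact_mod_cast hx.ne'
  have := (D.offset_inOpenSector hflat v i).add (s := τ / x (v, i))
    (a := (1 - τ / x (v, i)) * r (v, i)) (b := 0) (by positivity)
    (mul_nonneg (sub_nonneg.2 ((div_le_one hx).2 h1)) (D.r_pos _).le) le_rfl
  convert this using 1
  rw [offset]
  push_cast
  field_simp
  ring

/-- The part of a side to the right of its crease. -/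
theorem right_inOpenSector (hflat : N.IsFlatFoldable) (v : V) (i : ZMod 4) {τ : ℝ} (h0 : 0 < τ)
    (h1 : τ ≤ y (v, i)) : N.InOpenSector v (i - 1)
      (r (v, i) * N.dir v i - τ * (Complex.exp (θ v * Complex.I) * N.dir v i)) := by
  have hx := D.y_pos (v, i)
  have hx' : (y (v, i) : ℂ) ≠ 0 := by exact_mod_cast hx.ne'
  have := (D.offset_inOpenSector hflat v (i - 1)).add (s := τ / y (v, i))
    (b := (1 - τ / y (v, i)) * r (v, i)) (a := 0) (by positivity) le_rfl
    (mul_nonneg (sub_nonneg.2 ((div_le_one hx).2 h1)) (D.r_pos _).le)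
  convert this using 1
  rw [D.offset_sub_one, sub_add_cancel]
  push_cast
  field_simp
  ring

theorem scaledCorner_side (ε : ℝ) (v : V) (i : ZMod 4) :
    N.scaledCorner θ r x ε (v, i) = N.scaledCorner θ r x ε (v, i - 1) +
      (ε * (x (v, i) + y (v, i)) : ℝ) * (Complex.exp (θ v * Complex.I) * N.dir v i) := by
  rw [scaledCorner, scaledCorner, D.offset_sub_one, offset]
  push_cast
  ring

/-- Equal widths cancel the components perpendicular to the crease. The remaining multiple `q` may
be negative; the length of the crease outweighs it once the polygons are small. -/
theorem offset_mate {d : V × ZMod 4} (hd : N.mate d ≠ d) : ∃ q : ℝ,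
    N.offset θ r x ((N.mate d).1, (N.mate d).2 - 1) = N.offset θ r x d + q * N.dir d.1 d.2 := by
  have hw := D.width d hd
  refine ⟨y (N.mate d) * Real.cos (θ (N.mate d).1) - r (N.mate d) - r d -
    x d * Real.cos (θ d.1), ?_⟩
  have hw' : (x d * Complex.sin (θ d.1) : ℂ) = y (N.mate d) * Complex.sin (θ (N.mate d).1) := by
    exact_mod_cast congrArg (fun t : ℝ => (t : ℂ)) hw
  rw [D.offset_sub_one, N.dir_mate hd, offset, Complex.exp_mul_I, Complex.exp_mul_I]
  push_cast
  change _ - (y (N.mate d) : ℂ) * _ = _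
  change (r (N.mate d) : ℂ) * _ - _ = _
  linear_combination (-Complex.I * N.dir d.1 d.2) * hw'

end IsPolygonData

/-- `e` is the crease of the double-line pattern that leaves the corner `(v, i)` in the direction
number `k`. -/
def IsStarCrease (N : OrigamiNetwork V) (v : V) (i : ZMod 4) : Fin 4 → DLCrease V → Prop :=
  ![fun e => e = .leftLine (v, i) ∨
      N.mate (v, i) ≠ (v, i) ∧ e = .rightLine (N.mate (v, i)),
    fun e => e = .rightLine (v, i + 1) ∨
      N.mate (v, i + 1) ≠ (v, i + 1) ∧ e = .leftLine (N.mate (v, i + 1)),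
    fun e => e = .side (v, i + 1),
    fun e => e = .side (v, i)]

theorem isReverse_left_right (corner : V × ZMod 4 → ℂ) {d : V × ZMod 4} (hd : N.mate d ≠ d) :
    (N.doubleLine corner).IsReverse (.leftLine d) (.rightLine (N.mate d)) := by
  have := N.mate_mate_ne hd
  rw [N.mate_mate] at this
  constructor <;> simp [doubleLine, hd, N.mate_mate, this]

theorem isReverse_right_left (corner : V × ZMod 4 → ℂ) {d : V × ZMod 4} (hd : N.mate d ≠ d) :
    (N.doubleLine corner).IsReverse (.rightLine d) (.leftLine (N.mate d)) := by
  have := N.mate_mate_ne hd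
  rw [N.mate_mate] at this
  constructor <;> simp [doubleLine, hd, N.mate_mate, this]

theorem IsStarCrease.eq_or_reverse (corner : V × ZMod 4 → ℂ) {v : V} {i : ZMod 4} {k : Fin 4}
    {e e' : DLCrease V} (h : N.IsStarCrease v i k e) (h' : N.IsStarCrease v i k e') :
    e = e' ∨ (N.doubleLine corner).IsReverse e e' := by
  have hsymm : ∀ e e', (N.doubleLine corner).IsReverse e e' →
      (N.doubleLine corner).IsReverse e' e := fun _ _ h => ⟨h.2, h.1⟩
  fin_cases k
  · rcases h with rfl | ⟨hd, rfl⟩ <;> rcases h' with rfl | ⟨hd', rfl⟩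
    · exact Or.inl rfl
    · exact Or.inr (isReverse_left_right corner hd')
    · exact Or.inr (hsymm _ _ (isReverse_left_right corner hd))
    · exact Or.inl rfl
  · rcases h with rfl | ⟨hd, rfl⟩ <;> rcases h' with rfl | ⟨hd', rfl⟩
    · exact Or.inl rfl
    · exact Or.inr (isReverse_right_left corner hd')
    · exact Or.inr (hsymm _ _ (isReverse_right_left corner hd))
    · exact Or.inl rfl
  · exact Or.inl (h.trans h'.symm)
  · exact Or.inl (h.trans h'.symm)

theorem IsStarCrease.incident (corner : V × ZMod 4 → ℂ) {v : V} {i : ZMod 4} {k : Fin 4}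
    {e : DLCrease V} (h : N.IsStarCrease v i k e) : (N.doubleLine corner).Incident (v, i) e := by
  fin_cases k
  · rcases h with rfl | ⟨hd, rfl⟩
    · exact Or.inl rfl
    · have := N.mate_mate_ne hd
      rw [N.mate_mate] at this
      exact Or.inr (by simp [doubleLine, N.mate_mate, this])
  · rcases h with rfl | ⟨hd, rfl⟩
    · exact Or.inl (by simp [doubleLine])
    · have := N.mate_mate_ne hd
      rw [N.mate_mate] at this
      exact Or.inr (by simp [doubleLine, N.mate_mate, this])
  · cases h
    exact Or.inl (by simp [doubleLine])
  · cases h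
    exact Or.inr (by simp [doubleLine])

/-- The crease of the double-line pattern belongs to the vertex `v` or to a crease at `v`. -/
def Touches (N : OrigamiNetwork V) (v : V) : DLCrease V → Prop
  | .side d => d.1 = v
  | .leftLine d => d.1 = v ∨ (N.mate d).1 = v
  | .rightLine d => d.1 = v ∨ (N.mate d).1 = v

/-- Near a vertex, every point of a crease that belongs to it is the point where a side crosses
a crease of the network or lies in the star of a corner. -/
theorem IsPolygonData.exists_star (hflat : N.IsFlatFoldable) {θ : V → ℝ} {r x y : V × ZMod 4 → ℝ}
    (D : N.IsPolygonData θ r x y) {ε : ℝ} (hε : 0 < ε)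
    (hline : ∀ d, N.mate d ≠ d → ∃ q : ℝ, 0 < q ∧
      N.scaledCorner θ r x ε ((N.mate d).1, (N.mate d).2 - 1) =
        N.scaledCorner θ r x ε d + q * N.dir d.1 d.2)
    (hbd : ∀ d, N.mate d = d → 0 < N.boundaryLen d.1 d.2 (N.scaledCorner θ r x ε d) ∧
      0 < N.boundaryLen d.1 d.2 (N.scaledCorner θ r x ε (d.1, d.2 - 1)))
    {v : V} {e : DLCrease V} (he : N.Touches v e) {z : ℂ}
    (hz : z ∈ segment ℝ ((N.doubleLine (N.scaledCorner θ r x ε)).src e)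
      ((N.doubleLine (N.scaledCorner θ r x ε)).tgt e)) :
    (∃ i, e = .side (v, i) ∧ z = N.pos v + (ε * r (v, i) : ℝ) * N.dir v i) ∨
    ∃ i k, ∃ t : ℝ, 0 ≤ t ∧ N.IsStarCrease v i k e ∧ N.InOpenSector v i (z - N.pos v) ∧
      z = N.scaledCorner θ r x ε (v, i) +
        t * (starUnit (N.turnBy v i) (Complex.exp (θ v * Complex.I)) k * N.dir v i) := by
  -- A line starting at a corner runs along a bounding crease of the sector of that corner, so it
  -- never leaves the open sector.
  have hcone : ∀ i (a b : ℝ), 0 ≤ a → 0 ≤ b → N.InOpenSector v i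
      (N.scaledCorner θ r x ε (v, i) + a * N.dir v i + b * N.dir v (i + 1) - N.pos v) := by
    intro i a b ha hb
    convert (D.offset_inOpenSector hflat v i).add hε ha hb using 1
    rw [scaledCorner]; ring
  have hseg : ∀ {c c' u : ℂ} {q : ℝ}, 0 < q → c' = c + q * u → z ∈ segment ℝ c c' →
      ∃ t : ℝ, 0 ≤ t ∧ t ≤ q ∧ z = c + t * u := by
    rintro c c' u q hq rfl hz
    rw [segment_eq_image'] at hz
    obtain ⟨s, hs, rfl⟩ := hz
    refine ⟨s * q, mul_nonneg hs.1 hq.le, mul_le_of_le_one_left hq.le hs.2, ?_⟩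
    simp only [add_sub_cancel_left, Complex.real_smul]
    push_cast; ring
  -- lines, seen from the corner at which they leave `v`
  have hleft : ∀ i e, N.IsStarCrease v i 0 e → (∃ q : ℝ, 0 < q ∧
      z ∈ segment ℝ (N.scaledCorner θ r x ε (v, i))
        (N.scaledCorner θ r x ε (v, i) + q * N.dir v i)) →
      ∃ i k, ∃ t : ℝ, 0 ≤ t ∧ N.IsStarCrease v i k e ∧ N.InOpenSector v i (z - N.pos v) ∧
      z = N.scaledCorner θ r x ε (v, i) +
        t * (starUnit (N.turnBy v i) (Complex.exp (θ v * Complex.I)) k * N.dir v i) := by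
    rintro i e he ⟨q, hq, hz⟩
    obtain ⟨t, ht, -, rfl⟩ := hseg hq rfl hz
    refine ⟨i, 0, t, ht, he, ?_, by simp⟩
    have := hcone i t 0 ht le_rfl
    simpa using this
  have hright : ∀ i e, N.IsStarCrease v i 1 e → (∃ q : ℝ, 0 < q ∧
      z ∈ segment ℝ (N.scaledCorner θ r x ε (v, i))
        (N.scaledCorner θ r x ε (v, i) + q * N.dir v (i + 1))) →
      ∃ i k, ∃ t : ℝ, 0 ≤ t ∧ N.IsStarCrease v i k e ∧ N.InOpenSector v i (z - N.pos v) ∧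
      z = N.scaledCorner θ r x ε (v, i) +
        t * (starUnit (N.turnBy v i) (Complex.exp (θ v * Complex.I)) k * N.dir v i) := by
    rintro i e he ⟨q, hq, hz⟩
    obtain ⟨t, ht, -, rfl⟩ := hseg hq rfl hz
    refine ⟨i, 1, t, ht, he, ?_, by rw [dir_add_one]; simp⟩
    have := hcone i 0 t le_rfl ht
    simpa using this
  rcases e with d | d | d
  · obtain rfl : d.1 = v := he
    obtain ⟨v, i⟩ := d
    have hq : 0 < ε * (x (v, i) + y (v, i)) := mul_pos hε (add_pos (D.x_pos _) (D.y_pos _))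
    obtain ⟨t, ht, ht', rfl⟩ := hseg hq (D.scaledCorner_side ε v i) hz
    set W := Complex.exp (θ v * Complex.I)
    have hε' : (ε : ℂ) ≠ 0 := by exact_mod_cast hε.ne'
    have hpt : N.scaledCorner θ r x ε (v, i - 1) + t * (W * N.dir v i) - N.pos v =
        ε * (r (v, i) * N.dir v i + (t / ε - y (v, i) : ℝ) * (W * N.dir v i)) := by
      rw [scaledCorner, D.offset_sub_one]
      push_cast
      field_simp
      ring
    -- The sign tells whether the point of the side lies to the right of its crease, on it, or to
    -- the left. Each half is measured from the corner at its own end.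
    rcases lt_trichotomy (t / ε - y (v, i)) 0 with hτ | hτ | hτ
    · refine Or.inr ⟨i - 1, 2, t, ht, ?_, ?_, ?_⟩
      · change _ = _
        rw [sub_add_cancel]
      · have h2 : y (v, i) - t / ε ≤ y (v, i) := by
          have : 0 ≤ t / ε := by positivity
          linarith
        have := (D.right_inOpenSector hflat v i (τ := y (v, i) - t / ε) (by linarith) h2).add hε
          le_rfl le_rfl
        rw [hpt]
        convert this using 1
        push_cast
        ring
      · have := N.dir_add_one v (i - 1)
        rw [sub_add_cancel] at this
        rw [this, starUnit_two]
        ring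
    · refine Or.inl ⟨i, rfl, ?_⟩
      rw [← sub_eq_iff_eq_add', hpt, hτ]
      push_cast
      ring
    · refine Or.inr ⟨i, 3, ε * (x (v, i) + y (v, i)) - t, sub_nonneg.2 ht', rfl, ?_, ?_⟩
      · have h2 : t / ε - y (v, i) ≤ x (v, i) := by
          rw [sub_le_iff_le_add, div_le_iff₀ hε]
          linarith
        have := (D.left_inOpenSector hflat v i hτ h2).add hε le_rfl le_rfl
        rw [hpt]
        convert this using 1
        push_cast
        ring
      · rw [D.scaledCorner_side ε v i]
        rw [starUnit_three]
        push_cast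
        ring
  · right
    rcases he with rfl | he
    · obtain ⟨q, hq, h⟩ := tgt_leftLine hline hbd d
      rw [h] at hz
      exact hleft d.2 _ (Or.inl rfl) ⟨q, hq, hz⟩
    · by_cases hd : N.mate d = d
      · obtain ⟨q, hq, h⟩ := tgt_leftLine hline hbd d
        rw [hd] at he
        subst he
        rw [h] at hz
        exact hleft d.2 _ (Or.inl rfl) ⟨q, hq, hz⟩
      · obtain ⟨q, hq, h⟩ := hline d hd
        rw [segment_symm] at hz
        have hd' := N.mate_mate_ne hd
        subst he
        refine hright ((N.mate d).2 - 1) _ (Or.inr ?_) ⟨q, hq, ?_⟩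
        · rw [sub_add_cancel]
          exact ⟨hd', by change _ = DLCrease.leftLine (N.mate (N.mate d)); rw [N.mate_mate]⟩
        · rw [sub_add_cancel, N.dir_mate hd, h]
          simp only [CreasePattern.tgt, CreasePattern.src, doubleLine, hd, if_false,
            Sum.elim_inl, h] at hz
          convert hz using 2
          ring
  · right
    rcases he with rfl | he
    · obtain ⟨q, hq, h⟩ := tgt_rightLine hline hbd d
      rw [h] at hz
      refine hright (d.2 - 1) _ (Or.inl ?_) ⟨q, hq, ?_⟩
      · rw [sub_add_cancel]
      · rw [sub_add_cancel]; exact hz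
    · by_cases hd : N.mate d = d
      · obtain ⟨q, hq, h⟩ := tgt_rightLine hline hbd d
        rw [hd] at he
        subst he
        rw [h] at hz
        refine hright (d.2 - 1) _ (Or.inl ?_) ⟨q, hq, ?_⟩
        · rw [sub_add_cancel]
        · rw [sub_add_cancel]; exact hz
      · obtain ⟨q, hq, h⟩ := corner_mate_eq hline hd
        rw [segment_symm] at hz
        have hd' := N.mate_mate_ne hd
        subst he
        refine hleft (N.mate d).2 _ (Or.inr ?_) ⟨q, hq, ?_⟩
        · exact ⟨hd', by change _ = DLCrease.rightLine (N.mate (N.mate d)); rw [N.mate_mate]⟩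
        · rw [N.dir_mate hd]
          change z ∈ segment ℝ (N.scaledCorner θ r x ε (N.mate d))
            (N.scaledCorner θ r x ε (N.mate d) + q * -N.dir d.1 d.2)
          simp only [CreasePattern.tgt, CreasePattern.src, doubleLine, hd, if_false,
            Sum.elim_inl, h] at hz
          rw [h]
          convert hz using 2
          ring

end OrigamiNetwork

/-! ### Planarity of the double-line pattern for small polygons. -/

open Filter Topology in
theorem eventually_pos_add_mul {a : ℝ} (ha : 0 < a) (b : ℝ) :
    ∀ᶠ ε : ℝ in 𝓝[>] 0, 0 < a + ε * b := by
  have h : Tendsto (fun ε : ℝ => a + ε * b) (𝓝 0) (𝓝 (a + 0 * b)) :=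
    (by fun_prop : Continuous fun ε : ℝ => a + ε * b).tendsto 0
  rw [zero_mul, add_zero] at h
  exact (h.eventually (lt_mem_nhds ha)).filter_mono nhdsWithin_le_nhds

theorem exists_mem_segment_dist_le {a b a' b' z : ℂ} {κ : ℝ} (ha : dist a a' ≤ κ)
    (hb : dist b b' ≤ κ) (hz : z ∈ segment ℝ a b) : ∃ u ∈ segment ℝ a' b', dist z u ≤ κ := by
  obtain ⟨s, t, hs, ht, hst, rfl⟩ := hz
  refine ⟨s • a' + t • b', ⟨s, t, hs, ht, hst, rfl⟩, ?_⟩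
  calc dist (s • a + t • b) (s • a' + t • b')
      ≤ dist (s • a) (s • a') + dist (t • b) (t • b') := dist_add_add_le _ _ _ _
    _ = s * dist a a' + t * dist b b' := by
        rw [dist_smul₀, dist_smul₀, Real.norm_of_nonneg hs, Real.norm_of_nonneg ht]
    _ ≤ s * κ + t * κ := by gcongr
    _ = κ := by rw [← add_mul, hst, one_mul]

theorem exists_dist_pos_of_disjoint {s t : Set ℂ} (hs : IsCompact s) (ht : IsCompact t)
    (h : Disjoint s t) : ∃ δ : ℝ, 0 < δ ∧ ∀ x ∈ s, ∀ y ∈ t, δ ≤ dist x y := by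
  rcases (s ×ˢ t).eq_empty_or_nonempty with he | hne
  · refine ⟨1, one_pos, fun x hx y hy => ?_⟩
    exact absurd (Set.mk_mem_prod hx hy) (by rw [he]; simp)
  · obtain ⟨p, hp, hmin⟩ := (hs.prod ht).exists_isMinOn hne
      (f := fun p : ℂ × ℂ => dist p.1 p.2) (by fun_prop)
    refine ⟨dist p.1 p.2, dist_pos.2 fun heq => ?_, fun x hx y hy =>
      hmin (Set.mk_mem_prod hx hy)⟩
    exact Set.disjoint_left.1 h hp.1 (heq ▸ hp.2)

instance {V : Type*} [Finite V] : Finite (DLCrease V) :=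
  Finite.of_surjective
    (fun p : (V × ZMod 4) ⊕ (V × ZMod 4) ⊕ (V × ZMod 4) => match p with
      | .inl d => DLCrease.side d
      | .inr (.inl d) => .leftLine d
      | .inr (.inr d) => .rightLine d)
    (by
      rintro (d | d | d)
      exacts [⟨.inl d, rfl⟩, ⟨.inr (.inl d), rfl⟩, ⟨.inr (.inr d), rfl⟩])

namespace OrigamiNetwork

variable {V : Type*} {N : OrigamiNetwork V}

theorem incident_of_mem_segments (hplanar : N.pattern.IsPlanar) {d d' : V × ZMod 4} {z : ℂ}
    (h : z ∈ segment ℝ (N.pattern.src d) (N.pattern.tgt d))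
    (h' : z ∈ segment ℝ (N.pattern.src d') (N.pattern.tgt d')) :
    (∃ x, z = N.pos x ∧ N.pattern.Incident x d ∧ N.pattern.Incident x d') ∨
      N.pattern.Incident d.1 d' := by
  by_cases hd : d = d'
  · subst hd
    exact Or.inr (Or.inl rfl)
  by_cases hr : N.pattern.IsReverse d d'
  · exact Or.inr (Or.inr hr.2)
  · exact Or.inl (hplanar.noncrossing d d' hd hr z ⟨h, h'⟩)

theorem touches_of_incident {v : V} {d : V × ZMod 4} (h : N.pattern.Incident v d) :
    d.1 = v ∨ (N.mate d).1 = v := by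
  rcases h with h | h
  · exact Or.inl h
  · by_cases hd : N.mate d = d
    · simp [pattern, hd] at h
    · simp only [pattern, hd, if_false] at h
      exact Or.inr (Sum.inl_injective h)

/-- The vertex at which the core of a crease of the double-line pattern starts. -/
def coreSrc (N : OrigamiNetwork V) : DLCrease V → ℂ
  | .side d => N.pos d.1
  | .leftLine d => N.pos d.1
  | .rightLine d => N.pos d.1

/-- The end of the core of a crease of the double-line pattern: the vertex of a side, the crease of
a line parallel to it. -/
noncomputable def coreTgt (N : OrigamiNetwork V) : DLCrease V → ℂ
  | .side d => N.pos d.1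
  | .leftLine d => N.pattern.tgt d
  | .rightLine d => N.pattern.tgt d

/-- Cores are creases or vertices of the planar network, so they meet only if they share a vertex.
For pairs without a common vertex, compactness then gives a positive distance. -/
theorem touches_of_mem_cores (hplanar : N.pattern.IsPlanar) {e e' : DLCrease V} {z : ℂ}
    (h : z ∈ segment ℝ (N.coreSrc e) (N.coreTgt e))
    (h' : z ∈ segment ℝ (N.coreSrc e') (N.coreTgt e')) :
    ∃ v, N.Touches v e ∧ N.Touches v e' := by
  have hline : ∀ d d', z ∈ segment ℝ (N.pos d.1) (N.pattern.tgt d) →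
      z ∈ segment ℝ (N.pos d'.1) (N.pattern.tgt d') →
      ∃ v, (d.1 = v ∨ (N.mate d).1 = v) ∧ (d'.1 = v ∨ (N.mate d').1 = v) := by
    intro d d' h h'
    rcases incident_of_mem_segments hplanar h h' with ⟨x, -, h1, h2⟩ | h1
    · exact ⟨x, touches_of_incident h1, touches_of_incident h2⟩
    · exact ⟨d.1, Or.inl rfl, touches_of_incident h1⟩
  have hpt : ∀ d d' : V × ZMod 4, z ∈ segment ℝ (N.pos d.1) (N.pos d.1) →
      z ∈ segment ℝ (N.pos d'.1) (N.pattern.tgt d') →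
      ∃ v, d.1 = v ∧ (d'.1 = v ∨ (N.mate d').1 = v) := by
    intro d d' h h'
    rw [segment_same, Set.mem_singleton_iff] at h
    subst h
    have h2 : N.pos d.1 ∈ segment ℝ (N.pattern.src d) (N.pattern.tgt d) :=
      left_mem_segment ℝ _ _
    rcases incident_of_mem_segments hplanar h2 h' with ⟨x, hx, -, h3⟩ | h1
    · rw [hplanar.pos_injective hx]
      exact ⟨x, rfl, touches_of_incident h3⟩
    · exact ⟨d.1, rfl, touches_of_incident h1⟩
  rcases e with d | d | d <;> rcases e' with d' | d' | d'
  · simp only [coreSrc, coreTgt, segment_same, Set.mem_singleton_iff] at h h'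
    exact ⟨d.1, rfl, (hplanar.pos_injective (h.symm.trans h')).symm⟩
  · exact hpt d d' h h'
  · exact hpt d d' h h'
  · obtain ⟨v, h1, h2⟩ := hpt d' d h' h
    exact ⟨v, h2, h1⟩
  · exact hline d d' h h'
  · exact hline d d' h h'
  · obtain ⟨v, h1, h2⟩ := hpt d' d h' h
    exact ⟨v, h2, h1⟩
  · exact hline d d' h h'
  · exact hline d d' h h'

theorem exists_core_dist [Finite V] (hplanar : N.pattern.IsPlanar) :
    ∃ δ : ℝ, 0 < δ ∧ ∀ e e', (¬ ∃ v, N.Touches v e ∧ N.Touches v e') →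
      ∀ u ∈ segment ℝ (N.coreSrc e) (N.coreTgt e),
      ∀ u' ∈ segment ℝ (N.coreSrc e') (N.coreTgt e'), δ ≤ dist u u' := by
  have h : ∀ p : DLCrease V × DLCrease V, ∃ δ : ℝ, 0 < δ ∧
      ((¬ ∃ v, N.Touches v p.1 ∧ N.Touches v p.2) →
      ∀ u ∈ segment ℝ (N.coreSrc p.1) (N.coreTgt p.1),
      ∀ u' ∈ segment ℝ (N.coreSrc p.2) (N.coreTgt p.2), δ ≤ dist u u') := by
    rintro ⟨e, e'⟩
    have hcompact : ∀ a b : ℂ, IsCompact (segment ℝ a b) := by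
      intro a b
      rw [segment_eq_image_lineMap]
      exact isCompact_Icc.image AffineMap.lineMap_continuous
    by_cases ht : ∃ v, N.Touches v e ∧ N.Touches v e'
    · exact ⟨1, one_pos, fun h => absurd ht h⟩
    · obtain ⟨δ, hδ, h⟩ := exists_dist_pos_of_disjoint (hcompact (N.coreSrc e) (N.coreTgt e))
        (hcompact (N.coreSrc e') (N.coreTgt e'))
        (Set.disjoint_left.2 fun z h h' => ht (touches_of_mem_cores hplanar h h'))
      exact ⟨δ, hδ, fun _ => h⟩
  choose δ hδ h using h
  cases isEmpty_or_nonempty (DLCrease V × DLCrease V) with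
  | inl hE => exact ⟨1, one_pos, fun e e' => (hE.false (e, e')).elim⟩
  | inr hE =>
    obtain ⟨p, hp⟩ := Finite.exists_min δ
    exact ⟨δ p, hδ p, fun e e' ht u hu u' hu' => (hp (e, e')).trans (h (e, e') ht u hu u' hu')⟩

namespace IsPolygonData

variable {θ : V → ℝ} {r x y : V × ZMod 4 → ℝ} (D : N.IsPolygonData θ r x y)

theorem boundaryLen_scaledCorner (ε : ℝ) (v : V) (i j : ZMod 4) :
    N.boundaryLen v i (N.scaledCorner θ r x ε (v, j)) =
      N.len v i + ε * -(N.offset θ r x (v, j) * (starRingEnd ℂ) (N.dir v i)).re := by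
  have hu : N.dir v i * (starRingEnd ℂ) (N.dir v i) = 1 := by
    rw [Complex.mul_conj, ← Complex.sq_norm, N.norm_dir]; simp
  have : (N.tip v i - N.scaledCorner θ r x ε (v, j)) * (starRingEnd ℂ) (N.dir v i) =
      N.len v i - ε * (N.offset θ r x (v, j) * (starRingEnd ℂ) (N.dir v i)) := by
    rw [tip, scaledCorner]
    linear_combination (N.len v i : ℂ) * hu
  rw [boundaryLen, this, Complex.sub_re, Complex.re_ofReal_mul, Complex.ofReal_re]
  ring

theorem exists_core_near [Finite V] :
    ∃ K : ℝ, 0 < K ∧ ∀ ε : ℝ, 0 < ε → ∀ e,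
      ∀ z ∈ segment ℝ ((N.doubleLine (N.scaledCorner θ r x ε)).src e)
        ((N.doubleLine (N.scaledCorner θ r x ε)).tgt e),
      ∃ u ∈ segment ℝ (N.coreSrc e) (N.coreTgt e), dist z u ≤ ε * K := by
  obtain ⟨M, hM⟩ := (Set.finite_range fun d => ‖N.offset θ r x d‖).bddAbove
  have hM' : ∀ d, ‖N.offset θ r x d‖ ≤ |M| := fun d =>
    (hM ⟨d, rfl⟩).trans (le_abs_self _)
  have hM0 : |M| ≤ 2 * |M| + 1 := by linarith [abs_nonneg M]
  -- A corner moves by at most `ε * |M|`. A boundary end moves by the corner's offset minus its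
  -- projection to the crease, hence by at most twice as much; the `1` keeps the constant positive.
  refine ⟨2 * |M| + 1, by positivity, fun ε hε e z hz => ?_⟩
  have hcorner : ∀ d, dist (N.scaledCorner θ r x ε d) (N.pos d.1) ≤ ε * (2 * |M| + 1) := by
    intro d
    rw [scaledCorner, dist_eq_norm, add_sub_cancel_left, norm_mul, Complex.norm_real,
      Real.norm_of_nonneg hε.le]
    gcongr
    exact (hM' d).trans hM0
  have hbd : ∀ v i j, dist (N.scaledCorner θ r x ε (v, j) +
      N.boundaryLen v i (N.scaledCorner θ r x ε (v, j)) * N.dir v i)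
      (N.pattern.tgt (v, i)) ≤ ε * (2 * |M| + 1) := by
    intro v i j
    rw [boundaryLen_scaledCorner, pattern_tgt, dist_eq_norm]
    have : N.scaledCorner θ r x ε (v, j) + ((N.len v i + ε * -(N.offset θ r x (v, j) *
        (starRingEnd ℂ) (N.dir v i)).re : ℝ) : ℂ) * N.dir v i -
        (N.pos v + N.len v i * N.dir v i) =
        ε * (N.offset θ r x (v, j) -
          (N.offset θ r x (v, j) * (starRingEnd ℂ) (N.dir v i)).re * N.dir v i) := by
      rw [scaledCorner]
      push_cast
      ring
    rw [this, norm_mul, Complex.norm_real, Real.norm_of_nonneg hε.le]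
    gcongr
    refine (norm_sub_le _ _).trans ?_
    have h1 := Complex.abs_re_le_norm (N.offset θ r x (v, j) * (starRingEnd ℂ) (N.dir v i))
    rw [norm_mul, RCLike.norm_conj, N.norm_dir, mul_one] at h1
    rw [norm_mul, N.norm_dir, mul_one, Complex.norm_real, Real.norm_eq_abs]
    linarith [hM' (v, j)]
  refine exists_mem_segment_dist_le ?_ ?_ hz
  · rcases e with d | d | d
    · exact hcorner (d.1, d.2 - 1)
    · exact hcorner d
    · exact hcorner (d.1, d.2 - 1)
  · rcases e with d | d | d
    · exact hcorner d
    · by_cases hd : N.mate d = d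
      · simp only [CreasePattern.tgt, doubleLine, hd, if_true, Sum.elim_inr, id]
        exact hbd d.1 d.2 d.2
      · have h2 := hcorner ((N.mate d).1, (N.mate d).2 - 1)
        have h3 : N.pattern.tgt d = N.pos (N.mate d).1 := by
          simp [CreasePattern.tgt, pattern, hd]
        simp only [CreasePattern.tgt, doubleLine, hd, if_false, Sum.elim_inl, coreTgt]
        rw [← h3] at h2
        exact h2
    · by_cases hd : N.mate d = d
      · simp only [CreasePattern.tgt, doubleLine, hd, if_true, Sum.elim_inr, id]
        exact hbd d.1 d.2 (d.2 - 1)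
      · have h2 := hcorner (N.mate d)
        have h3 : N.pattern.tgt d = N.pos (N.mate d).1 := by
          simp [CreasePattern.tgt, pattern, hd]
        simp only [CreasePattern.tgt, doubleLine, hd, if_false, Sum.elim_inl, coreTgt]
        rw [← h3] at h2
        exact h2

include D in
/-- Two creases that belong to a common vertex meet only in a common corner. -/
theorem star_noncrossing (hflat : N.IsFlatFoldable) {ε : ℝ} (hε : 0 < ε)
    (hline : ∀ d, N.mate d ≠ d → ∃ q : ℝ, 0 < q ∧
      N.scaledCorner θ r x ε ((N.mate d).1, (N.mate d).2 - 1) =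
        N.scaledCorner θ r x ε d + q * N.dir d.1 d.2)
    (hbd : ∀ d, N.mate d = d → 0 < N.boundaryLen d.1 d.2 (N.scaledCorner θ r x ε d) ∧
      0 < N.boundaryLen d.1 d.2 (N.scaledCorner θ r x ε (d.1, d.2 - 1)))
    {v : V} {e e' : DLCrease V} (he : N.Touches v e) (he' : N.Touches v e') (hne : e ≠ e')
    (hrev : ¬ (N.doubleLine (N.scaledCorner θ r x ε)).IsReverse e e') {z : ℂ}
    (hz : z ∈ segment ℝ ((N.doubleLine (N.scaledCorner θ r x ε)).src e)
      ((N.doubleLine (N.scaledCorner θ r x ε)).tgt e))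
    (hz' : z ∈ segment ℝ ((N.doubleLine (N.scaledCorner θ r x ε)).src e')
      ((N.doubleLine (N.scaledCorner θ r x ε)).tgt e')) :
    ∃ c, z = (N.doubleLine (N.scaledCorner θ r x ε)).pos c ∧
      (N.doubleLine (N.scaledCorner θ r x ε)).Incident c e ∧
      (N.doubleLine (N.scaledCorner θ r x ε)).Incident c e' := by
  have hray : ∀ i, N.InSector v i
      (N.pos v + (ε * r (v, i) : ℝ) * N.dir v i - N.pos v) := fun i =>
    ⟨ε * r (v, i), 0, mul_pos hε (D.r_pos _), le_rfl, by push_cast; ring⟩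
  -- The crossing point of a side with its crease lies on a bounding ray, and no open sector
  -- contains such a point.
  have hmixed : ∀ i j, N.InOpenSector v j (z - N.pos v) →
      z ≠ N.pos v + (ε * r (v, i) : ℝ) * N.dir v i := by
    rintro i j hj rfl
    obtain rfl := sector_unique hflat (hray i) hj.inSector
    exact hj.ne_mul_dir hflat (ε * r (v, i)) (by ring)
  rcases D.exists_star hflat hε hline hbd he hz with
    ⟨i, rfl, h1⟩ | ⟨i, k, t, ht, hk, hsec, h1⟩ <;>
  rcases D.exists_star hflat hε hline hbd he' hz' with
    ⟨i', rfl, h1'⟩ | ⟨i', k', t', ht', hk', hsec', h1'⟩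
  · refine absurd ?_ hne
    have h2 := hray i
    rw [← h1, h1'] at h2
    rw [sector_unique hflat h2 (hray i')]
  · exact absurd h1 (hmixed i i' hsec')
  · exact absurd h1' (hmixed i' i hsec)
  -- A common point determines its sector, hence the corner. Away from the corner, distance and
  -- direction determine the crease up to orientation.
  · obtain rfl := sector_unique hflat hsec.inSector hsec'.inSector
    rcases ht.eq_or_lt with h0 | hpos
    · refine ⟨(v, i), ?_, hk.incident _, hk'.incident _⟩
      rw [h1, ← h0]
      simp [doubleLine]
    · exfalso
      have hW : ‖Complex.exp (θ v * Complex.I)‖ = 1 := Complex.norm_exp_ofReal_mul_I _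
      have heq : (t : ℂ) * starUnit (N.turnBy v i) (Complex.exp (θ v * Complex.I)) k =
          t' * starUnit (N.turnBy v i) (Complex.exp (θ v * Complex.I)) k' :=
        mul_right_cancel₀ (N.dir_ne_zero v i) (by linear_combination h1' - h1)
      have ht2 : t = t' := by
        have := congrArg norm heq
        simpa [norm_starUnit (norm_turnBy v i) hW, abs_of_nonneg ht, abs_of_nonneg ht'] using this
      rw [← ht2] at heq
      have hkk : k = k' := by
        refine starUnit_injective (turnBy_mul_conj v i) (turnBy_im_pos hflat v i) ?_
          (exp_mul_I_mul_conj (θ v)) (mul_left_cancel₀ ?_ heq)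
        · rw [Complex.exp_ofReal_mul_I_im]
          exact D.sin_pos v
        · exact_mod_cast hpos.ne'
      subst hkk
      rcases hk.eq_or_reverse (N.scaledCorner θ r x ε) hk' with h | h
      · exact hne h
      · exact hrev h

-- For small `ε` every crease is close to its core. Creases whose cores are separated stay disjoint,
-- and creases with a common vertex are handled by `star_noncrossing`.
include D in
open Filter Topology in
theorem exists_isDoubleLine [Finite V] (hflat : N.IsFlatFoldable) (hplanar : N.pattern.IsPlanar) :
    ∃ corner, N.IsDoubleLine θ corner := by
  obtain ⟨δ, hδ, hsep⟩ := exists_core_dist hplanar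
  obtain ⟨K, hK, hnear⟩ := exists_core_near (N := N) (θ := θ) (r := r) (x := x)
  have hline : ∀ᶠ ε : ℝ in 𝓝[>] 0, ∀ d, N.mate d ≠ d → ∃ q : ℝ, 0 < q ∧
      N.scaledCorner θ r x ε ((N.mate d).1, (N.mate d).2 - 1) =
        N.scaledCorner θ r x ε d + q * N.dir d.1 d.2 := by
    refine eventually_all.2 fun d => ?_
    by_cases hd : N.mate d = d
    · exact Eventually.of_forall fun _ h => absurd hd h
    · obtain ⟨q, hq⟩ := D.offset_mate hd
      filter_upwards [eventually_pos_add_mul (N.len_pos d.1 d.2) q] with ε hε _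
      refine ⟨_, hε, ?_⟩
      have := N.pos_mate d.1 d.2 hd
      change N.pos (N.mate d).1 = _ at this
      rw [scaledCorner, scaledCorner, hq, this]
      push_cast
      ring
  have hbd : ∀ᶠ ε : ℝ in 𝓝[>] 0, ∀ d, N.mate d = d →
      0 < N.boundaryLen d.1 d.2 (N.scaledCorner θ r x ε d) ∧
      0 < N.boundaryLen d.1 d.2 (N.scaledCorner θ r x ε (d.1, d.2 - 1)) := by
    refine eventually_all.2 fun d => ?_
    filter_upwards [
      eventually_pos_add_mul (N.len_pos d.1 d.2)
        (-(N.offset θ r x (d.1, d.2) * (starRingEnd ℂ) (N.dir d.1 d.2)).re),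
      eventually_pos_add_mul (N.len_pos d.1 d.2)
        (-(N.offset θ r x (d.1, d.2 - 1) * (starRingEnd ℂ) (N.dir d.1 d.2)).re)] with ε h1 h2 _
    rw [← boundaryLen_scaledCorner] at h1 h2
    exact ⟨h1, h2⟩
  have hsmall : ∀ᶠ ε : ℝ in 𝓝[>] 0, 0 < δ + ε * -(2 * K) := eventually_pos_add_mul hδ _
  obtain ⟨ε, hline, hbd, hsmall, hε⟩ :=
    (hline.and (hbd.and (hsmall.and self_mem_nhdsWithin))).exists
  have hε : 0 < ε := hε
  have hfar : ∀ e e' z, z ∈ segment ℝ ((N.doubleLine (N.scaledCorner θ r x ε)).src e)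
        ((N.doubleLine (N.scaledCorner θ r x ε)).tgt e) →
      z ∈ segment ℝ ((N.doubleLine (N.scaledCorner θ r x ε)).src e')
        ((N.doubleLine (N.scaledCorner θ r x ε)).tgt e') →
      ∃ v, N.Touches v e ∧ N.Touches v e' := by
    intro e e' z h h'
    by_contra ht
    obtain ⟨u, hu, hzu⟩ := hnear ε hε e z h
    obtain ⟨u', hu', hzu'⟩ := hnear ε hε e' z h'
    have h1 := hsep e e' ht u hu u' hu'
    have h2 := dist_triangle_left u u' z
    linarith
  refine ⟨N.scaledCorner θ r x ε, D.angle_mem, fun v i => ?_, fun v i => hline (v, i),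
    fun v i => hbd (v, i), ?_, ?_, ?_⟩
  · refine ⟨ε * r (v, i), ε * x (v, i), ε * y (v, i), mul_pos hε (D.r_pos _),
      mul_pos hε (D.x_pos _), mul_pos hε (D.y_pos _), ?_, ?_⟩
    · rw [scaledCorner, offset]
      push_cast
      ring
    · rw [scaledCorner, D.offset_sub_one]
      push_cast
      ring
  · rintro ⟨v, i⟩ ⟨w, j⟩ h
    change N.scaledCorner θ r x ε (v, i) = N.scaledCorner θ r x ε (w, j) at h
    obtain ⟨u, h1, h2⟩ := hfar (.side (v, i)) (.side (w, j)) (N.scaledCorner θ r x ε (v, i))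
      (right_mem_segment ℝ _ _) (by rw [h]; exact right_mem_segment ℝ _ _)
    obtain rfl : v = u := h1
    obtain rfl : w = v := h2
    have h3 := D.offset_inOpenSector hflat w i
    have h4 := D.offset_inOpenSector hflat w j
    have hε' : (ε : ℂ) ≠ 0 := by exact_mod_cast hε.ne'
    have h5 : N.offset θ r x (w, i) = N.offset θ r x (w, j) :=
      mul_left_cancel₀ hε' (add_left_cancel h)
    rw [h5] at h3
    rw [sector_unique hflat h3.inSector h4.inSector]
  · have hne : ∀ (c c' u : ℂ) (q : ℝ), 0 < q → ‖u‖ = 1 → c' = c + q * u → c ≠ c' := by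
      rintro c c' u q hq hu rfl h
      have h2 : (q : ℂ) * u = 0 := by linear_combination -h
      rcases mul_eq_zero.1 h2 with h3 | h3
      · exact hq.ne' (by exact_mod_cast h3)
      · rw [h3, norm_zero] at hu
        exact zero_ne_one hu
    rintro (d | d | d)
    · exact hne _ _ _ _ (mul_pos hε (add_pos (D.x_pos d) (D.y_pos d)))
        (by simp [Complex.norm_exp_ofReal_mul_I, N.norm_dir]) (D.scaledCorner_side ε d.1 d.2)
    · obtain ⟨q, hq, h⟩ := tgt_leftLine hline hbd d
      exact hne _ _ _ _ hq (N.norm_dir _ _) h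
    · obtain ⟨q, hq, h⟩ := tgt_rightLine hline hbd d
      exact hne _ _ _ _ hq (N.norm_dir _ _) h
  · rintro e e' hne hrev z ⟨hz, hz'⟩
    obtain ⟨v, he, he'⟩ := hfar e e' z hz hz'
    exact D.star_noncrossing hflat hε hline hbd he he' hne hrev hz hz'

end IsPolygonData

end OrigamiNetwork

/-! ### Central polygons with matching strips at the special angles. -/

theorem exists_pos_between {S D U : ℝ} (hS : 0 < S) (h : D * U < S * S) :
    ∃ ρ : ℝ, 0 < ρ ∧ D < ρ * S ∧ ρ * U < S := by
  rcases le_or_gt U 0 with hU | hU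
  · refine ⟨max (D / S) 0 + 1, by positivity, ?_, ?_⟩
    · rw [← div_lt_iff₀ hS]
      linarith [le_max_left (D / S) 0]
    · have : 0 < max (D / S) 0 + 1 := by positivity
      nlinarith
  · obtain ⟨ρ, h1, h2⟩ := exists_between (show max (D / S) 0 < S / U by
      rw [max_lt_iff]
      exact ⟨by rw [div_lt_div_iff₀ hS hU]; exact h, by positivity⟩)
    refine ⟨ρ, (le_max_right _ _).trans_lt h1, ?_, ?_⟩
    · rw [← div_lt_iff₀ hS]
      exact (le_max_left _ _).trans_lt h1
    · rwa [lt_div_iff₀ hU] at h2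

namespace OrigamiNetwork

variable {V : Type*} {N : OrigamiNetwork V}

/-- The length of the side across `eᵢ` to the left of `eᵢ`, when the sides cross the creases at the
distances `r` and at the angle `θ`. -/
noncomputable def leftExt (N : OrigamiNetwork V) (v : V) (θ : ℝ) (r : ZMod 4 → ℝ) (i : ZMod 4) : ℝ :=
  (r (i + 1) * Real.sin θ - r i * Real.sin (θ + N.angle v i)) / Real.sin (N.angle v i)

/-- The length of the side across `eᵢ` to the right of `eᵢ`. -/
noncomputable def rightExt (N : OrigamiNetwork V) (v : V) (θ : ℝ) (r : ZMod 4 → ℝ) (i : ZMod 4) :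
    ℝ :=
  (r i * Real.sin (N.angle v (i - 1) - θ) + r (i - 1) * Real.sin θ) / Real.sin (N.angle v (i - 1))

theorem leftExt_linear (v : V) (θ a h : ℝ) (r r' : ZMod 4 → ℝ) (i : ZMod 4) :
    N.leftExt v θ (fun i => a * r i + h * r' i) i =
      a * N.leftExt v θ r i + h * N.leftExt v θ r' i := by
  simp only [leftExt]; ring

theorem rightExt_linear (v : V) (θ a h : ℝ) (r r' : ZMod 4 → ℝ) (i : ZMod 4) :
    N.rightExt v θ (fun i => a * r i + h * r' i) i =
      a * N.rightExt v θ r i + h * N.rightExt v θ r' i := by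
  simp only [rightExt]; ring

/-- `leftExt` and `rightExt` are the solution of the two real equations for the intersection of
consecutive sides. The distances `r` therefore parametrize all polygons at a given angle. -/
theorem meet_of_ext (hflat : N.IsFlatFoldable) (v : V) (θ : ℝ) (r : ZMod 4 → ℝ) (i : ZMod 4) :
    (r i + N.leftExt v θ r i * Complex.exp (θ * Complex.I) : ℂ) =
      (r (i + 1) - N.rightExt v θ r (i + 1) * Complex.exp (θ * Complex.I)) * N.turnBy v i := by
  have hs := (sin_angle_pos hflat v i).ne'
  have h1 := Real.sin_sq_add_cos_sq (N.angle v i)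
  have h2 := Real.sin_sq_add_cos_sq θ
  rw [leftExt, rightExt, add_sub_cancel_right, Real.sin_add, Real.sin_sub]
  apply Complex.ext
  · simp only [turnBy, Complex.add_re, Complex.mul_re, Complex.mul_im,
      Complex.sub_re, Complex.sub_im, Complex.ofReal_re, Complex.ofReal_im,
      Complex.exp_ofReal_mul_I_re, Complex.exp_ofReal_mul_I_im]
    generalize Real.sin (N.angle v i) = s at *
    generalize Real.cos (N.angle v i) = c at *
    generalize Real.sin θ = q at *
    generalize Real.cos θ = p at *
    field_simp
    obtain rfl | hc := eq_or_ne c 0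
    all_goals grind
  · simp only [turnBy, Complex.mul_re, Complex.mul_im, Complex.add_im,
      Complex.sub_re, Complex.sub_im, Complex.ofReal_re, Complex.ofReal_im,
      Complex.exp_ofReal_mul_I_re, Complex.exp_ofReal_mul_I_im]
    generalize Real.sin (N.angle v i) = s at *
    generalize Real.cos (N.angle v i) = c at *
    generalize Real.sin θ = q at *
    generalize Real.cos θ = p at *
    field_simp
    grind

/-- The creases of a vertex whose strip folds mainly along its left line. -/
def IsLeft (b i : ZMod 4) : Prop := i = b ∨ i = b + 1

instance (b i : ZMod 4) : Decidable (IsLeft b i) := inferInstanceAs (Decidable (_ ∨ _))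

/-- The part of a side at the main line of its strip. -/
noncomputable def mainExt (N : OrigamiNetwork V) (v : V) (b : ZMod 4) (r : ZMod 4 → ℝ) (i : ZMod 4) :
    ℝ :=
  if IsLeft b i then N.leftExt v (Real.pi - N.angle v b) r i
  else N.rightExt v (Real.pi - N.angle v b) r i

/-- The part of a side at the other line of its strip. -/
noncomputable def minorExt (N : OrigamiNetwork V) (v : V) (b : ZMod 4) (r : ZMod 4 → ℝ)
    (i : ZMod 4) : ℝ :=
  if IsLeft b i then N.rightExt v (Real.pi - N.angle v b) r i
  else N.leftExt v (Real.pi - N.angle v b) r i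

theorem mainExt_linear (v : V) (b : ZMod 4) (a h : ℝ) (r r' : ZMod 4 → ℝ) (i : ZMod 4) :
    N.mainExt v b (fun i => a * r i + h * r' i) i =
      a * N.mainExt v b r i + h * N.mainExt v b r' i := by
  simp only [mainExt]
  split_ifs
  · exact leftExt_linear _ _ _ _ _ _ _
  · exact rightExt_linear _ _ _ _ _ _ _

theorem minorExt_linear (v : V) (b : ZMod 4) (a h : ℝ) (r r' : ZMod 4 → ℝ) (i : ZMod 4) :
    N.minorExt v b (fun i => a * r i + h * r' i) i =
      a * N.minorExt v b r i + h * N.minorExt v b r' i := by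
  simp only [minorExt]
  split_ifs
  · exact rightExt_linear _ _ _ _ _ _ _
  · exact leftExt_linear _ _ _ _ _ _ _

set_option linter.unusedSimpArgs false in
/-- Two shapes of the central polygon: the second one only widens the minor sides of the strips. -/
theorem exists_profiles (hflat : N.IsFlatFoldable) (v : V) (b : ZMod 4) :
    ∃ r r' : ZMod 4 → ℝ, ∀ i, (0 < r' i ∨ r' i = 0 ∧ 0 < r i) ∧
      N.mainExt v b r' i = 0 ∧ 0 < N.mainExt v b r i ∧ 0 < N.minorExt v b r' i := by
  set α := N.angle v b with hα
  set β := N.angle v (b + 1) with hβ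
  have hS : 0 < Real.sin α := sin_angle_pos hflat v b
  have hT : 0 < Real.sin β := sin_angle_pos hflat v (b + 1)
  have hα2 : N.angle v (b + 2) = Real.pi - α := by linarith [hflat v b]
  have hβ2 : N.angle v (b + 3) = Real.pi - β := by
    have := hflat v (b + 1)
    rw [show b + 1 + 2 = b + 3 by ring] at this
    linarith
  have hDU : Real.sin (α - β) * Real.sin (α + β) < Real.sin α * Real.sin α := by
    have : Real.sin (α - β) * Real.sin (α + β) =
        Real.sin α * Real.sin α - Real.sin β * Real.sin β := by
      rw [Real.sin_sub, Real.sin_add]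
      linear_combination Real.sin α ^ 2 * Real.sin_sq_add_cos_sq β -
        Real.sin β ^ 2 * Real.sin_sq_add_cos_sq α
    rw [this]
    linarith [mul_pos hT hT]
  -- The identity `sin (α - β) * sin (α + β) = sin² α - sin² β` leaves room for both ratios: `ρ`
  -- makes the main extents positive and `g` the minor ones.
  obtain ⟨ρ, hρ, h1, h2⟩ := exists_pos_between hS hDU
  obtain ⟨g, hg, h3, h4⟩ := exists_pos_between (D := -Real.sin (α + β)) (U := -Real.sin (α - β)) hS
    (by linarith)
  have k : ∀ b : ZMod 4, b + 1 + 1 = b + 2 ∧ b + 2 + 1 = b + 3 ∧ b + 3 + 1 = b ∧ b - 1 = b + 3 ∧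
      b + 1 - 1 = b ∧ b + 2 - 1 = b + 1 ∧ b + 3 - 1 = b + 2 ∧
      b + 1 ≠ b ∧ b + 2 ≠ b ∧ b + 3 ≠ b ∧ b + 2 ≠ b + 1 ∧ b + 3 ≠ b + 1 ∧ b + 3 ≠ b + 2 := by
    decide
  obtain ⟨k1, k2, k3, k4, k5, k6, k7, n1, n2, n3, n4, n5, n6⟩ := k b
  have s1 : Real.sin (Real.pi - α) = Real.sin α := Real.sin_pi_sub α
  have s2 : Real.sin (Real.pi - β) = Real.sin β := Real.sin_pi_sub β
  have s3 : Real.sin (Real.pi - α + α) = 0 := by rw [sub_add_cancel, Real.sin_pi]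
  have s4 : Real.sin (Real.pi - β - (Real.pi - α)) = Real.sin (α - β) := by congr 1; ring
  have s5 : Real.sin (Real.pi - α + β) = Real.sin (α - β) := by
    rw [← Real.sin_pi_sub (α - β)]; congr 1; ring
  have s6 : Real.sin (β - (Real.pi - α)) = -Real.sin (α + β) := by
    rw [← Real.sin_sub_pi]; congr 1; ring
  have s7 : Real.sin (Real.pi - α + (Real.pi - β)) = -Real.sin (α + β) := by
    rw [← Real.sin_neg, ← Real.sin_add_two_pi (-(α + β))]; congr 1; ring
  -- At the angle `π - α` the main extents involve only the distances at `b + 1` and `b + 2`.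
  -- Distances at `b` and `b + 3` change the minor extents alone.
  refine ⟨fun i => if i = b + 1 then 1 else if i = b + 2 then ρ else 0,
    fun i => if i = b then g else if i = b + 3 then 1 else 0, ?_⟩
  intro i
  rcases ZMod.eq_add_of_four b i with h | h | h | h <;> rw [h]
  all_goals simp only [mainExt, minorExt, IsLeft, leftExt, rightExt, true_or, or_true, or_self, if_true,
    if_false, k1, k2, k3, k4, k5, k6, k7, n1, n2, n3, n4, n5, n6, n1.symm, n2.symm, n3.symm, n4.symm,
    n5.symm, n6.symm, hα2, hβ2, ← hα, ← hβ, s1, s2, s3, s4, s5, s6, s7, sub_self, Real.sin_zero]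
  · refine ⟨Or.inl hg, by simp, by simp [hS], div_pos (by linarith) hT⟩
  · refine ⟨by simp, by simp, div_pos (by linarith) hT, div_pos (by nlinarith) hS⟩
  · refine ⟨by simp [hρ], by simp, div_pos (by linarith) hT, div_pos (by linarith) hS⟩
  · refine ⟨by simp, by simp, div_pos (by nlinarith) hS, div_pos (by linarith) hT⟩

open Filter Topology in
/-- Central polygons with matching strips, at the angles at which only the main lines of the strips
fold. -/
theorem exists_flat_polygons [Finite V] (hflat : N.IsFlatFoldable) (hplanar : N.pattern.IsPlanar)
    (htree : N.graph.IsTree) (b : V → ZMod 4)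
    (hb : ∀ d, N.mate d ≠ d → (IsLeft (b d.1) d.2 ↔ ¬ IsLeft (b (N.mate d).1) (N.mate d).2)) :
    ∃ r : V → ZMod 4 → ℝ,
      (∀ v i, 0 < r v i ∧ 0 < N.leftExt v (Real.pi - N.angle v (b v)) (r v) i ∧
        0 < N.rightExt v (Real.pi - N.angle v (b v)) (r v) i) ∧
      ∀ d, N.mate d ≠ d →
        N.leftExt d.1 (Real.pi - N.angle d.1 (b d.1)) (r d.1) d.2 *
          Real.sin (Real.pi - N.angle d.1 (b d.1)) =
        N.rightExt (N.mate d).1 (Real.pi - N.angle (N.mate d).1 (b (N.mate d).1))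
          (r (N.mate d).1) (N.mate d).2 *
          Real.sin (Real.pi - N.angle (N.mate d).1 (b (N.mate d).1)) := by
  choose r r' hr using fun v => exists_profiles hflat v (b v)
  have hsin : ∀ v, 0 < Real.sin (Real.pi - N.angle v (b v)) := fun v => by
    rw [Real.sin_pi_sub]; exact sin_angle_pos hflat _ _
  obtain ⟨root⟩ := htree.connected.nonempty
  -- `f.1` scales the first profile and `f.2 M` the second. The coefficients are propagated for all
  -- `M` at once, and `M` is taken large only at the end, uniformly over the finitely many vertices.
  let R : V → ℝ × (ℝ → ℝ) → ℝ → ZMod 4 → ℝ := fun v f M i => f.1 * r v i + f.2 M * r' v i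
  have hmain : ∀ v f M i, N.mainExt v (b v) (R v f M) i = f.1 * N.mainExt v (b v) (r v) i := by
    intro v f M i
    rw [mainExt_linear, (hr v i).2.1, mul_zero, add_zero]
  have hminor : ∀ v f M i, N.minorExt v (b v) (R v f M) i =
      f.1 * N.minorExt v (b v) (r v) i + f.2 M * N.minorExt v (b v) (r' v) i := by
    intro v f M i
    rw [minorExt_linear]
  obtain ⟨f, -, hf, hrel⟩ := exists_compatible hplanar htree
    (fun v (f : ℝ × (ℝ → ℝ)) => 0 < f.1 ∧ Tendsto f.2 atTop atTop)
    (fun d f f' => ∀ M,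
      N.mainExt d.1 (b d.1) (R d.1 f M) d.2 * Real.sin (Real.pi - N.angle d.1 (b d.1)) =
        N.mainExt (N.mate d).1 (b (N.mate d).1) (R (N.mate d).1 f' M) (N.mate d).2 *
          Real.sin (Real.pi - N.angle (N.mate d).1 (b (N.mate d).1)) ∧
      N.minorExt d.1 (b d.1) (R d.1 f M) d.2 * Real.sin (Real.pi - N.angle d.1 (b d.1)) =
        N.minorExt (N.mate d).1 (b (N.mate d).1) (R (N.mate d).1 f' M) (N.mate d).2 *
          Real.sin (Real.pi - N.angle (N.mate d).1 (b (N.mate d).1)))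
    root (1, id) ⟨one_pos, tendsto_id⟩
    (by
      rintro d hd ⟨a, h⟩ ⟨ha, hh⟩
      obtain ⟨-, -, p1, p2⟩ := hr d.1 d.2
      obtain ⟨-, -, q1, q2⟩ := hr (N.mate d).1 (N.mate d).2
      simp only [hmain, hminor]
      set s := Real.sin (Real.pi - N.angle d.1 (b d.1))
      set s' := Real.sin (Real.pi - N.angle (N.mate d).1 (b (N.mate d).1))
      have hs : 0 < s := hsin _
      have hs' : 0 < s' := hsin _
      set P1 := N.mainExt d.1 (b d.1) (r d.1) d.2
      set P2 := N.minorExt d.1 (b d.1) (r' d.1) d.2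
      set P3 := N.minorExt d.1 (b d.1) (r d.1) d.2
      set Q1 := N.mainExt (N.mate d).1 (b (N.mate d).1) (r (N.mate d).1) (N.mate d).2
      set Q2 := N.minorExt (N.mate d).1 (b (N.mate d).1) (r' (N.mate d).1) (N.mate d).2
      set Q3 := N.minorExt (N.mate d).1 (b (N.mate d).1) (r (N.mate d).1) (N.mate d).2
      -- The main widths fix the first coefficient, as the second profile does not affect them. The
      -- minor widths then fix the second one as an affine function of `h` with positive slope, so
      -- it still tends to infinity.
      refine ⟨(a * P1 * s / (s' * Q1), fun M => h M * (P2 * s / (s' * Q2)) +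
        (a * P3 * s / s' - a * P1 * s / (s' * Q1) * Q3) / Q2), ⟨by positivity, ?_⟩, fun M => ⟨?_, ?_⟩⟩
      · exact tendsto_atTop_add_const_right _ _ (hh.atTop_mul_const (by positivity))
      · field_simp
      · field_simp
        ring)
    (by
      intro d f f' _ h M
      rw [N.mate_mate]
      exact ⟨(h M).1.symm, (h M).2.symm⟩)
  have hpos : ∀ v (p p' : ℝ), (0 < p' ∨ p' = 0 ∧ 0 < p) →
      ∀ᶠ M in atTop, 0 < (f v).1 * p + (f v).2 M * p' := by
    rintro v p p' (h | ⟨rfl, h⟩)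
    · exact (tendsto_atTop_add_const_left _ _ ((hf v).2.atTop_mul_const h)).eventually_gt_atTop 0
    · refine Eventually.of_forall fun M => ?_
      have := (hf v).1
      simp only [mul_zero, add_zero]
      positivity
  have hev : ∀ᶠ M in atTop, ∀ v i, 0 < R v (f v) M i ∧ 0 < N.mainExt v (b v) (R v (f v) M) i ∧
      0 < N.minorExt v (b v) (R v (f v) M) i := by
    refine eventually_all.2 fun v => eventually_all.2 fun i => ?_
    obtain ⟨h1, h2, h3, h4⟩ := hr v i
    filter_upwards [hpos v _ _ h1, hpos v _ _ (Or.inl h4)] with M h5 h6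
    refine ⟨h5, ?_, ?_⟩
    · rw [hmain]; exact mul_pos (hf v).1 h3
    · rw [hminor]; exact h6
  obtain ⟨M, hM⟩ := hev.exists
  refine ⟨fun v => R v (f v) M, fun v i => ?_, fun d hd => ?_⟩
  · obtain ⟨h1, h2, h3⟩ := hM v i
    refine ⟨h1, ?_⟩
    simp only [mainExt, minorExt] at h2 h3
    split_ifs at h2 h3
    · exact ⟨h2, h3⟩
    · exact ⟨h3, h2⟩
  · obtain ⟨h1, h2⟩ := hrel d hd M
    have h3 := hb d hd
    simp only [mainExt, minorExt] at h1 h2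
    by_cases h : IsLeft (b d.1) d.2
    · rw [if_pos h, if_neg (h3.1 h)] at h1
      exact h1
    · rw [if_neg h, if_pos (not_not.1 (fun h' => h (h3.2 h')))] at h2
      exact h2

end OrigamiNetwork

/-! ### Perturbing the polygon angles and choosing base corners. -/

/-- Sum and product determine a pair up to order, and absolute values fix the order. The nonnegative
product excludes the ambiguous pairs of opposite nonzero numbers. -/
theorem eq_of_add_eq_of_mul_eq {p q p' q' : ℝ} (h1 : p + q = p' + q') (h2 : p * q = p' * q')
    (h3 : 0 ≤ p * q) (h4 : |q| ≤ |p|) (h5 : |q'| ≤ |p'|) : p = p' := by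
  have h : (p - p') * (p - q') = 0 := by linear_combination p * h1 - h2
  rcases mul_eq_zero.1 h with h | h
  · linarith
  · obtain rfl : p = q' := by linarith
    obtain rfl : q = p' := by linarith
    have h6 : |p| = |q| := le_antisymm h5 h4
    have h7 : p * q = q * q := by
      rw [← abs_of_nonneg h3, abs_mul, h6, abs_mul_abs_self]
    have h8 : p * p = q * q := by rw [← abs_mul_abs_self p, h6, abs_mul_abs_self]
    have h9 : (p - q) * (p - q) = 0 := by linear_combination h8 - 2 * h7
    have := mul_self_eq_zero.1 h9
    linarith

namespace OrigamiNetwork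

variable {V : Type*} {N : OrigamiNetwork V}

section Perturbation

open Filter Topology

theorem tendsto_leftExt {ι : Type*} {l : Filter ι} (v : V) {θ : ι → ℝ} {θ₀ : ℝ}
    {r : ι → ZMod 4 → ℝ} {r₀ : ZMod 4 → ℝ} (hθ : Tendsto θ l (𝓝 θ₀))
    (hr : ∀ i, Tendsto (fun a => r a i) l (𝓝 (r₀ i))) (i : ZMod 4) :
    Tendsto (fun a => N.leftExt v (θ a) (r a) i) l (𝓝 (N.leftExt v θ₀ r₀ i)) :=
  (((hr _).mul ((Real.continuous_sin.tendsto _).comp hθ)).sub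
    ((hr _).mul ((Real.continuous_sin.tendsto _).comp (hθ.add_const _)))).div_const _

theorem tendsto_rightExt {ι : Type*} {l : Filter ι} (v : V) {θ : ι → ℝ} {θ₀ : ℝ}
    {r : ι → ZMod 4 → ℝ} {r₀ : ZMod 4 → ℝ} (hθ : Tendsto θ l (𝓝 θ₀))
    (hr : ∀ i, Tendsto (fun a => r a i) l (𝓝 (r₀ i))) (i : ZMod 4) :
    Tendsto (fun a => N.rightExt v (θ a) (r a) i) l (𝓝 (N.rightExt v θ₀ r₀ i)) :=
  (((hr _).mul ((Real.continuous_sin.tendsto _).comp (hθ.const_sub _))).add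
    ((hr _).mul ((Real.continuous_sin.tendsto _).comp hθ))).div_const _

/-- Central polygons with matching strips persist when their angles change a little. -/
theorem eventually_isPolygonData [Finite V] (hflat : N.IsFlatFoldable)
    (hplanar : N.pattern.IsPlanar) (htree : N.graph.IsTree) {θ₀ : V → ℝ}
    (hθ₀ : ∀ v, θ₀ v ∈ Set.Ioo 0 Real.pi) (r₀ : V → ZMod 4 → ℝ)
    (hpos : ∀ v i, 0 < r₀ v i ∧ 0 < N.leftExt v (θ₀ v) (r₀ v) i ∧
      0 < N.rightExt v (θ₀ v) (r₀ v) i)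
    (hmatch : ∀ d, N.mate d ≠ d →
      N.leftExt d.1 (θ₀ d.1) (r₀ d.1) d.2 * Real.sin (θ₀ d.1) =
        N.rightExt (N.mate d).1 (θ₀ (N.mate d).1) (r₀ (N.mate d).1) (N.mate d).2 *
          Real.sin (θ₀ (N.mate d).1)) :
    ∀ᶠ θ in 𝓝 θ₀, ∃ r x y, N.IsPolygonData θ r x y := by
  have hsin₀ : ∀ v, Real.sin (θ₀ v) ≠ 0 := fun v =>
    (Real.sin_pos_of_pos_of_lt_pi (hθ₀ v).1 (hθ₀ v).2).ne'
  have hθ : ∀ v, Tendsto (fun θ : V → ℝ => θ v) (𝓝 θ₀) (𝓝 (θ₀ v)) := fun v =>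
    (continuous_apply v).tendsto θ₀
  have hsin : ∀ v, Tendsto (fun θ : V → ℝ => Real.sin (θ v)) (𝓝 θ₀) (𝓝 (Real.sin (θ₀ v))) :=
    fun v => (Real.continuous_sin.tendsto _).comp (hθ v)
  obtain ⟨root⟩ := htree.connected.nonempty
  obtain ⟨R, -, hR, hrel⟩ := exists_compatible hplanar htree
    (fun v (R : (V → ℝ) → ZMod 4 → ℝ) => ∀ i, Tendsto (fun θ => R θ i) (𝓝 θ₀) (𝓝 (r₀ v i)))
    (fun d R R' => ∀ θ : V → ℝ, (∀ v, Real.sin (θ v) ≠ 0) →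
      N.leftExt d.1 (θ d.1) (R θ) d.2 * Real.sin (θ d.1) =
        N.rightExt (N.mate d).1 (θ (N.mate d).1) (R' θ) (N.mate d).2 *
          Real.sin (θ (N.mate d).1) ∧
      N.rightExt d.1 (θ d.1) (R θ) d.2 * Real.sin (θ d.1) =
        N.leftExt (N.mate d).1 (θ (N.mate d).1) (R' θ) (N.mate d).2 *
          Real.sin (θ (N.mate d).1))
    root (fun _ => r₀ root) (fun i => tendsto_const_nhds)
    (by
      intro d hd R hR
      have hm1 := hmatch d hd
      have hm2 := hmatch (N.mate d) (N.mate_mate_ne hd)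
      rw [N.mate_mate] at hm2
      set w := (N.mate d).1
      set j := (N.mate d).2
      have hj : Real.sin (N.angle w j) ≠ 0 := (sin_angle_pos hflat w j).ne'
      have hj' : Real.sin (N.angle w (j - 1)) ≠ 0 := (sin_angle_pos hflat w (j - 1)).ne'
      have kj : ∀ j : ZMod 4, j ≠ j + 1 ∧ j ≠ j - 1 ∧ j - 1 ≠ j + 1 := by decide
      obtain ⟨n1, n2, n3⟩ := kj j
      let Y : (V → ℝ) → ℝ := fun θ =>
        N.rightExt d.1 (θ d.1) (R θ) d.2 * Real.sin (θ d.1) / Real.sin (θ w)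
      let X : (V → ℝ) → ℝ := fun θ =>
        N.leftExt d.1 (θ d.1) (R θ) d.2 * Real.sin (θ d.1) / Real.sin (θ w)
      have hY : Tendsto Y (𝓝 θ₀) (𝓝 (N.leftExt w (θ₀ w) (r₀ w) j)) := by
        have := ((tendsto_rightExt (N := N) d.1 (hθ d.1) hR d.2).mul (hsin d.1)).div
          (hsin w) (hsin₀ w)
        rwa [← hm2, mul_div_cancel_right₀ _ (hsin₀ w)] at this
      have hX : Tendsto X (𝓝 θ₀) (𝓝 (N.rightExt w (θ₀ w) (r₀ w) j)) := by
        have := ((tendsto_leftExt (N := N) d.1 (hθ d.1) hR d.2).mul (hsin d.1)).div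
          (hsin w) (hsin₀ w)
        rwa [hm1, mul_div_cancel_right₀ _ (hsin₀ w)] at this
      -- The two extents of the side `j` are prescribed by the arriving strip. With `r₀ w j` kept,
      -- each of them is solved for the distance at one neighbouring crease; at `θ₀` this returns
      -- the original distances.
      refine ⟨fun θ k =>
        if k = j + 1 then (Y θ * Real.sin (N.angle w j) +
          r₀ w j * Real.sin (θ w + N.angle w j)) / Real.sin (θ w)
        else if k = j - 1 then (X θ * Real.sin (N.angle w (j - 1)) -
          r₀ w j * Real.sin (N.angle w (j - 1) - θ w)) / Real.sin (θ w)
        else r₀ w k, fun i => ?_, fun θ hθs => ⟨?_, ?_⟩⟩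
      · by_cases h1 : i = j + 1
        · subst h1
          simp only [if_true]
          have := ((hY.mul_const (Real.sin (N.angle w j))).add
            (((Real.continuous_sin.tendsto _).comp ((hθ w).add_const (N.angle w j))).const_mul
              (r₀ w j))).div (hsin w) (hsin₀ w)
          have e : r₀ w (j + 1) = (N.leftExt w (θ₀ w) (r₀ w) j * Real.sin (N.angle w j) +
              r₀ w j * Real.sin (θ₀ w + N.angle w j)) / Real.sin (θ₀ w) := by
            have := hsin₀ w
            simp only [leftExt]
            field_simp
            ring
          rw [e]
          exact this
        by_cases h2 : i = j - 1
        · subst h2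
          simp only [n3, if_true, if_false]
          have := ((hX.mul_const (Real.sin (N.angle w (j - 1)))).sub
            (((Real.continuous_sin.tendsto _).comp
              ((hθ w).const_sub (N.angle w (j - 1)))).const_mul (r₀ w j))).div (hsin w) (hsin₀ w)
          have e : r₀ w (j - 1) = (N.rightExt w (θ₀ w) (r₀ w) j * Real.sin (N.angle w (j - 1)) -
              r₀ w j * Real.sin (N.angle w (j - 1) - θ₀ w)) / Real.sin (θ₀ w) := by
            have := hsin₀ w
            simp only [rightExt]
            field_simp
            ring
          rw [e]
          exact this
        · simp only [h1, h2, if_false]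
          exact tendsto_const_nhds
      · have h0 := hθs w
        have h1 : N.leftExt d.1 (θ d.1) (R θ) d.2 * Real.sin (θ d.1) = X θ * Real.sin (θ w) :=
          (div_mul_cancel₀ _ h0).symm
        rw [h1]
        congr 1
        simp only [rightExt, n1, n2, n3, if_true, if_false]
        field_simp
        ring
      · have h0 := hθs w
        have h1 : N.rightExt d.1 (θ d.1) (R θ) d.2 * Real.sin (θ d.1) = Y θ * Real.sin (θ w) :=
          (div_mul_cancel₀ _ h0).symm
        rw [h1]
        congr 1
        simp only [leftExt, n1, n2, if_true, if_false]
        field_simp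
        ring)
    (by
      intro d R R' _ h θ hθs
      rw [N.mate_mate]
      exact ⟨(h θ hθs).2.symm, (h θ hθs).1.symm⟩)
  have h1 : ∀ᶠ θ : V → ℝ in 𝓝 θ₀, ∀ v, θ v ∈ Set.Ioo 0 Real.pi :=
    eventually_all.2 fun v => (hθ v).eventually (Ioo_mem_nhds (hθ₀ v).1 (hθ₀ v).2)
  have h2 : ∀ᶠ θ : V → ℝ in 𝓝 θ₀, ∀ v i, 0 < R v θ i ∧ 0 < N.leftExt v (θ v) (R v θ) i ∧
      0 < N.rightExt v (θ v) (R v θ) i := by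
    refine eventually_all.2 fun v => eventually_all.2 fun i => ?_
    obtain ⟨p1, p2, p3⟩ := hpos v i
    exact ((hR v i).eventually_const_lt p1).and
      (((tendsto_leftExt v (hθ v) (hR v) i).eventually_const_lt p2).and
        ((tendsto_rightExt v (hθ v) (hR v) i).eventually_const_lt p3))
  filter_upwards [h1, h2] with θ h1 h2
  refine ⟨fun d => R d.1 θ d.2, fun d => N.leftExt d.1 (θ d.1) (R d.1 θ) d.2,
    fun d => N.rightExt d.1 (θ d.1) (R d.1 θ) d.2, h1, fun d => (h2 _ _).1, fun d => (h2 _ _).2.1,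
    fun d => (h2 _ _).2.2, fun v i => meet_of_ext hflat v (θ v) (R v θ) i, fun d hd => ?_⟩
  exact (hrel d hd θ fun v => (Real.sin_pos_of_pos_of_lt_pi (h1 v).1 (h1 v).2).ne').1

end Perturbation

theorem isLeft_add_two : ∀ b i : ZMod 4, IsLeft (b + 2) i ↔ ¬ IsLeft b i := by decide

/-- Moving a base corner by two keeps the mode but exchanges the left and right main lines. So the
main line seen from one end of a crease can be made the main line seen from the other end. -/
theorem exists_bases (hplanar : N.pattern.IsPlanar) (htree : N.graph.IsTree) (m : V → FoldMode) :
    ∃ b : V → ZMod 4, (∀ v, IsBase (m v) (b v)) ∧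
      ∀ d, N.mate d ≠ d → (IsLeft (b d.1) d.2 ↔ ¬ IsLeft (b (N.mate d).1) (N.mate d).2) := by
  obtain ⟨root⟩ := htree.connected.nonempty
  obtain ⟨b₀, hb₀⟩ := exists_isBase (m root)
  obtain ⟨b, -, hb, hrel⟩ := exists_compatible hplanar htree (fun v b => IsBase (m v) b)
    (fun d b b' => IsLeft b d.2 ↔ ¬ IsLeft b' (N.mate d).2) root b₀ hb₀
    (by
      intro d _ b _
      obtain ⟨b', hb'⟩ := exists_isBase (m (N.mate d).1)
      by_cases h : IsLeft b d.2 ↔ ¬ IsLeft b' (N.mate d).2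
      · exact ⟨b', hb', h⟩
      · refine ⟨b' + 2, hb'.add_two, ?_⟩
        rw [isLeft_add_two]
        by_cases h1 : IsLeft b d.2 <;> simp_all)
    (by
      intro d b b' _ h
      rw [N.mate_mate]
      by_cases h1 : IsLeft b d.2 <;> simp_all)
  exact ⟨b, hb, hrel⟩

/-! ### Speeds of the double-line pattern and a common speed product. -/

/-- The multiplier of mode (a) at a corner with a sector angle and an angle of the central polygon
that have the tangents `a` and `x` of their halves. -/
noncomputable def ratioP (a x : ℝ) : ℝ := (1 - a * x) / (1 + a * x)

theorem abs_ratioP_lt_one {a x : ℝ} (ha : 0 < a) (hx : 0 < x) : |ratioP a x| < 1 := by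
  have := mul_pos ha hx
  rw [ratioP, abs_lt]
  constructor
  · rw [lt_div_iff₀ (by linarith)]; linarith
  · rw [div_lt_one (by linarith)]; linarith

theorem ratioP_mul_lt_one {a a' x : ℝ} (ha : 0 < a) (ha' : 0 < a') (hx : 0 < x) :
    |ratioP a x * ratioP a' x| < 1 := by
  rw [abs_mul]
  exact mul_lt_one_of_nonneg_of_lt_one_left (abs_nonneg _) (abs_ratioP_lt_one ha hx)
    (abs_ratioP_lt_one ha' hx).le

/-- With `α` the sector angle, both sides are real multiples of the same unit number, and the
multiplier is `cos ((θ + α) / 2) / cos ((θ - α) / 2)`. This is the sum condition at a corner without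
its scale. -/
theorem ratioP_identity (hflat : N.IsFlatFoldable) (v : V) (i : ZMod 4) {θ : ℝ}
    (hθ : θ ∈ Set.Ioo 0 Real.pi) :
    (ratioP (N.tanHalf v i) (Real.tan (θ / 2)) : ℂ) *
      (Complex.exp (θ * Complex.I) + N.turnBy v i) =
      1 + Complex.exp (θ * Complex.I) * N.turnBy v i := by
  have hx : 0 < Real.tan (θ / 2) :=
    Real.tan_pos_of_pos_of_lt_pi_div_two (by linarith [hθ.1]) (by linarith [hθ.2])
  have ha := tanHalf_pos hflat v i
  have hc : Real.cos (θ / 2) ≠ 0 :=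
    (Real.cos_pos_of_mem_Ioo ⟨by linarith [hθ.1, Real.pi_pos], by linarith [hθ.2]⟩).ne'
  have hd : (1 + N.tanHalf v i * Real.tan (θ / 2) : ℂ) ≠ 0 := by
    have : (1 + N.tanHalf v i * Real.tan (θ / 2) : ℝ) ≠ 0 := by positivity
    exact_mod_cast this
  have hd0 := one_sub_mul_I_ne_zero (N.tanHalf v i)
  have hd1 := one_sub_mul_I_ne_zero (Real.tan (θ / 2))
  rw [exp_mul_I_eq_tan_half hc, turnBy_eq hflat, ratioP]
  generalize Real.tan (θ / 2) = x at *
  generalize N.tanHalf v i = a at *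
  push_cast
  field_simp
  linear_combination (-4 * a * x) * Complex.I_sq

end OrigamiNetwork

open Filter Topology

namespace OrigamiNetwork

variable {V : Type*} {N : OrigamiNetwork V}

/-- The folding speeds of the sides of a central polygon. -/
def sideSpeed (k p q : ℝ) : ZMod 4 → ℝ := ![k * p * q, k * q, k, -(k * p)]

/-- The folding speeds of the left lines of the strips at a central polygon. -/
def leftSpeed (k p q : ℝ) : ZMod 4 → ℝ := ![k * q, k, k * p, -(k * p * q)]

/-- The folding speeds of the right lines of the strips at a central polygon. -/
def rightSpeed (k p q : ℝ) : ZMod 4 → ℝ := ![-(k * p), -(k * p * q), -(k * q), k]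

theorem sideSpeed_mul_leftSpeed (k p q : ℝ) (i : ZMod 4) :
    sideSpeed k p q i * leftSpeed k p q i =
      -(sideSpeed k p q (i + 1) * rightSpeed k p q (i + 1)) := by
  rcases ZMod.eq_add_of_four 0 i with rfl | rfl | rfl | rfl
  · change k * p * q * (k * q) = -(k * q * -(k * p * q))
    ring
  · change k * q * k = -(k * -(k * q))
    ring
  · change k * (k * p) = -(-(k * p) * k)
    ring
  · change -(k * p) * -(k * p * q) = -(k * p * q * -(k * p))
    ring

theorem add_sideSpeed (k p q : ℝ) {E : ℂ} {B : ZMod 4 → ℂ} (h0 : p * (E + B 0) = 1 + E * B 0)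
    (h1 : q * (E + B 1) = 1 + E * B 1) (h2 : B 0 * B 2 = -1) (h3 : B 1 * B 3 = -1) (i : ZMod 4) :
    (-(sideSpeed k p q i * E) + leftSpeed k p q i : ℂ) =
      -(sideSpeed k p q (i + 1) * E * B i) - rightSpeed k p q (i + 1) * B i := by
  have n0 : B 0 ≠ 0 := left_ne_zero_of_mul (h2 ▸ neg_ne_zero.2 one_ne_zero)
  have n1 : B 1 ≠ 0 := left_ne_zero_of_mul (h3 ▸ neg_ne_zero.2 one_ne_zero)
  rcases ZMod.eq_add_of_four 0 i with rfl | rfl | rfl | rfl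
  · change (-((k * p * q : ℝ) * E) + (k * q : ℝ) : ℂ) =
      -((k * q : ℝ) * E * B 0) - (-(k * p * q) : ℝ) * B 0
    push_cast
    linear_combination (-k * q : ℂ) * h0
  · change (-((k * q : ℝ) * E) + (k : ℝ) : ℂ) = -((k : ℝ) * E * B 1) - (-(k * q) : ℝ) * B 1
    push_cast
    linear_combination (-k : ℂ) * h1
  · change (-((k : ℝ) * E) + (k * p : ℝ) : ℂ) = -((-(k * p) : ℝ) * E * B 2) - (k : ℝ) * B 2
    push_cast
    -- `B 2 = -1 / B 0`, so the supplementary corner gives the same equation as the corner `0`.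
    refine mul_left_cancel₀ n0 ?_
    linear_combination (k : ℂ) * h0 + (k - k * p * E : ℂ) * h2
  · change (-((-(k * p) : ℝ) * E) + (-(k * p * q) : ℝ) : ℂ) =
      -((k * p * q : ℝ) * E * B 3) - (-(k * p) : ℝ) * B 3
    push_cast
    refine mul_left_cancel₀ n1 ?_
    linear_combination (-k * p : ℂ) * h1 + (k * p * q * E - k * p : ℂ) * h3

theorem leftSpeed_mul_rightSpeed (k p q : ℝ) (i : ZMod 4) :
    leftSpeed k p q i * rightSpeed k p q i = -(k ^ 2 * (p * q)) := by
  rcases ZMod.eq_add_of_four 0 i with rfl | rfl | rfl | rfl <;>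
    · simp [leftSpeed, rightSpeed]
      ring

theorem ratioP_mul_ne_one {a a' x : ℝ} (ha : 0 < a) (ha' : 0 < a') (hx : 0 < x) :
    1 - ratioP a x * ratioP a' x ≠ 0 := by
  have := (abs_lt.1 (ratioP_mul_lt_one ha ha' hx)).2
  linarith

/-- `ratioP a x` is `tanh (-log (a * x) / 2)`, so `(p - q) / (1 - p q)` is the hyperbolic tangent of
a difference in which `x` cancels. -/
theorem ratioP_sub_div {a a' x : ℝ} (ha : 0 < a) (ha' : 0 < a') (hx : 0 < x) (t : ℝ) :
    t / (1 - ratioP a x * ratioP a' x) * (ratioP a x - ratioP a' x) =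
      t * ((a' - a) / (a' + a)) := by
  have h1 : 1 + a * x ≠ 0 := by positivity
  have h2 : 1 + a' * x ≠ 0 := by positivity
  have h3 : a' + a ≠ 0 := by positivity
  have h4 : 1 - ratioP a x * ratioP a' x = 2 * (a' + a) * x / ((1 + a * x) * (1 + a' * x)) := by
    simp only [ratioP]
    field_simp
    ring
  have h5 : ratioP a x - ratioP a' x = 2 * (a' - a) * x / ((1 + a * x) * (1 + a' * x)) := by
    simp only [ratioP]
    field_simp
    ring
  rw [h4, h5]
  field_simp

/-- The speed product of the two lines of a strip, as a function of the tangent of half the angle of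
the central polygon, is a local surjection at the angle where one of the lines stops folding. -/
theorem map_nhds_speedProduct {a a' t : ℝ} (ha : 0 < a) (ha' : 0 < a') (hne : a ≠ a')
    (ht : t ≠ 0) :
    map (fun x => -((t / (1 - ratioP a x * ratioP a' x)) ^ 2 * (ratioP a x * ratioP a' x)))
      (𝓝 (1 / a)) = 𝓝 0 := by
  have hP : ∀ b : ℝ, 0 < b → HasStrictDerivAt (ratioP b)
      ((-b * (1 + b * (1 / a)) - (1 - b * (1 / a)) * b) / (1 + b * (1 / a)) ^ 2) (1 / a) := by
    intro b hb
    have h1 : HasStrictDerivAt (fun x : ℝ => 1 - b * x) (-b) (1 / a) := by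
      simpa using ((hasStrictDerivAt_id (1 / a)).const_mul b).const_sub 1
    have h2 : HasStrictDerivAt (fun x : ℝ => 1 + b * x) b (1 / a) := by
      simpa using ((hasStrictDerivAt_id (1 / a)).const_mul b).const_add 1
    exact h1.div h2 (by positivity)
  have hP0 : ratioP a (1 / a) = 0 := by
    rw [ratioP, mul_one_div_cancel ha.ne', sub_self, zero_div]
  have hQ0 : ratioP a' (1 / a) ≠ 0 := by
    have h1 : 1 - a' * (1 / a) ≠ 0 := by
      rw [mul_one_div, sub_ne_zero]
      exact fun h => hne ((div_eq_one_iff_eq ha.ne').1 h.symm).symm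
    exact div_ne_zero h1 (by positivity)
  obtain ⟨G', hG⟩ : ∃ G', HasStrictDerivAt
      (fun x => -((t / (1 - ratioP a x * ratioP a' x)) ^ 2 * ratioP a' x)) G' (1 / a) :=
    ⟨_, ((((hasStrictDerivAt_const (1 / a) t).div
      (((hP a ha).mul (hP a' ha')).const_sub 1) (by simp [-one_div, hP0])).pow 2).mul (hP a' ha')).neg⟩
  have hF := (hP a ha).mul hG
  have hval : -((t / (1 - ratioP a (1 / a) * ratioP a' (1 / a))) ^ 2 *
      (ratioP a (1 / a) * ratioP a' (1 / a))) = 0 := by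
    rw [hP0]
    ring
  have key := HasStrictDerivAt.map_nhds_eq (hF.congr_of_eventuallyEq
    (f₁ := fun x => -((t / (1 - ratioP a x * ratioP a' x)) ^ 2 * (ratioP a x * ratioP a' x)))
    (Eventually.of_forall fun x => by simp only [Pi.mul_apply]; ring)) (by
      -- The first factor vanishes at `1 / a`, so the derivative of the product is its derivative
      -- times the nonzero value of the second factor.
      have h1 : a * (1 / a) = 1 := mul_one_div_cancel ha.ne'
      rw [hP0, zero_mul, zero_mul, add_zero, sub_zero, h1]
      refine mul_ne_zero (by norm_num [ha.ne']) (neg_ne_zero.2 (mul_ne_zero ?_ hQ0))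
      simpa using ht)
  rwa [hval] at key

/-- The images of the neighbourhoods are neighbourhoods of `0`, and finitely many of them share a
positive number. -/
theorem exists_common_value [Finite V] {x₀ : V → ℝ} {F : V → ℝ → ℝ}
    (hF : ∀ v, map (F v) (𝓝 (x₀ v)) = 𝓝 0) {p : (V → ℝ) → Prop} (hp : ∀ᶠ x in 𝓝 x₀, p x) :
    ∃ x c, 0 < c ∧ p x ∧ ∀ v, F v (x v) = c := by
  rw [nhds_pi] at hp
  obtain ⟨I, U, hU, hUp⟩ := mem_pi'.1 hp
  have h1 : ∀ᶠ c in 𝓝 (0 : ℝ), ∀ v, c ∈ F v '' U v :=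
    eventually_all.2 fun v => by
      rw [← hF v]
      exact image_mem_map (hU v)
  obtain ⟨c, hc, hc0⟩ := ((h1.filter_mono nhdsWithin_le_nhds).and
    (self_mem_nhdsWithin : Set.Ioi (0 : ℝ) ∈ 𝓝[>] 0)).exists
  choose x hx hxc using hc
  exact ⟨x, c, hc0, hUp fun v _ => hx v, hxc⟩

/-- The multiplier at the base sector of the central polygon of `v`. -/
noncomputable def mulBase (N : OrigamiNetwork V) (b : V → ZMod 4) (v : V) (x : ℝ) : ℝ :=
  ratioP (N.tanHalf v (b v)) x

/-- The multiplier at the sector after the base sector of the central polygon of `v`. -/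
noncomputable def mulNext (N : OrigamiNetwork V) (b : V → ZMod 4) (v : V) (x : ℝ) : ℝ :=
  ratioP (N.tanHalf v (b v + 1)) x

/-- The speed scale of the central polygon of `v`. -/
noncomputable def scaleSpeed (N : OrigamiNetwork V) (b : V → ZMod 4) (s : V × ZMod 4 → ℝ) (v : V)
    (x : ℝ) : ℝ :=
  s (v, b v + 1) / (1 - N.mulBase b v x * N.mulNext b v x)

theorem exists_isDLSpeed (hflat : N.IsFlatFoldable) {m : V → FoldMode} {s : V × ZMod 4 → ℝ}
    (hs : N.IsFoldingMode m s) {b : V → ZMod 4} (hb : ∀ v, IsBase (m v) (b v))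
    (hopp : ∀ d, N.mate d ≠ d →
      (IsLeft (b d.1) d.2 ↔ ¬ IsLeft (b (N.mate d).1) (N.mate d).2))
    {θ : V → ℝ} (hθ : ∀ v, θ v ∈ Set.Ioo 0 Real.pi) {c : ℝ} (hc : 0 ≤ c)
    (hle : ∀ v, |N.mulBase b v (Real.tan (θ v / 2))| ≤ |N.mulNext b v (Real.tan (θ v / 2))|)
    (hval : ∀ v, -(N.scaleSpeed b s v (Real.tan (θ v / 2)) ^ 2 *
      (N.mulBase b v (Real.tan (θ v / 2)) * N.mulNext b v (Real.tan (θ v / 2)))) = c) :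
    ∃ S l r, N.IsDLSpeed θ S l r ∧ (∀ d, l d + r d = s d) ∧ (∀ d, l d * r d = c) ∧
      (c ≠ 0 → ∀ d, S d ≠ 0) := by
  have hx : ∀ v, 0 < Real.tan (θ v / 2) := fun v =>
    Real.tan_pos_of_pos_of_lt_pi_div_two (by linarith [(hθ v).1]) (by linarith [(hθ v).2])
  set P : V → ℝ := fun v => N.mulBase b v (Real.tan (θ v / 2)) with hP
  set Q : V → ℝ := fun v => N.mulNext b v (Real.tan (θ v / 2)) with hQ
  set K : V → ℝ := fun v => N.scaleSpeed b s v (Real.tan (θ v / 2)) with hK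
  have hP1 : ∀ v, |P v| < 1 := fun v => abs_ratioP_lt_one (tanHalf_pos hflat v _) (hx v)
  have hQ1 : ∀ v, |Q v| < 1 := fun v => abs_ratioP_lt_one (tanHalf_pos hflat v _) (hx v)
  have hPQ : ∀ v, 1 - P v * Q v ≠ 0 := fun v =>
    ratioP_mul_ne_one (tanHalf_pos hflat v _) (tanHalf_pos hflat v _) (hx v)
  let S : V × ZMod 4 → ℝ := fun d => sideSpeed (K d.1) (P d.1) (Q d.1) (d.2 - b d.1)
  let l : V × ZMod 4 → ℝ := fun d => leftSpeed (K d.1) (P d.1) (Q d.1) (d.2 - b d.1)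
  let r : V × ZMod 4 → ℝ := fun d => rightSpeed (K d.1) (P d.1) (Q d.1) (d.2 - b d.1)
  have hmul : ∀ d, l d * r d = c := fun d =>
    (leftSpeed_mul_rightSpeed _ _ _ _).trans (hval d.1)
  have hadd : ∀ d, l d + r d = s d := by
    rintro ⟨v, i⟩
    obtain ⟨h0, h2, h3⟩ := speeds_base hflat hs v (hb v)
    have e1 : K v * (P v - Q v) = s (v, b v + 1) * N.ratioQ v (b v) :=
      ratioP_sub_div (tanHalf_pos hflat v _) (tanHalf_pos hflat v _) (hx v) _
    have e2 : K v * (1 - P v * Q v) = s (v, b v + 1) := div_mul_cancel₀ _ (hPQ v)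
    rcases ZMod.eq_add_of_four (b v) i with rfl | rfl | rfl | rfl
    · simp [l, r, leftSpeed, rightSpeed, h0]
      linear_combination -e1
    · simp [l, r, leftSpeed, rightSpeed]
      linear_combination e2
    · simp [l, r, leftSpeed, rightSpeed, h2]
      linear_combination e1
    · simp [l, r, leftSpeed, rightSpeed, h3]
      linear_combination e2
  -- On the main lines the speeds dominate: at one crease by `hle`, at the next because both
  -- multipliers have absolute value below `1`.
  have hl : ∀ v i, IsLeft (b v) i → |r (v, i)| ≤ |l (v, i)| := by
    rintro v i (rfl | rfl)
    · simpa [l, r, leftSpeed, rightSpeed, abs_mul] using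
        mul_le_mul_of_nonneg_left (hle v) (abs_nonneg (K v))
    · simp [l, r, leftSpeed, rightSpeed, abs_mul, mul_assoc]
      exact mul_le_of_le_one_right (abs_nonneg _) (mul_le_one₀ (hP1 v).le (abs_nonneg _) (hQ1 v).le)
  have hr : ∀ v i, ¬ IsLeft (b v) i → |l (v, i)| ≤ |r (v, i)| := by
    intro v i hi
    rcases ZMod.eq_add_of_four (b v) i with rfl | rfl | rfl | rfl
    · exact absurd (Or.inl rfl) hi
    · exact absurd (Or.inr rfl) hi
    · simpa [l, r, leftSpeed, rightSpeed, abs_mul] using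
        mul_le_mul_of_nonneg_left (hle v) (abs_nonneg (K v))
    · simp [l, r, leftSpeed, rightSpeed, abs_mul, mul_assoc]
      exact mul_le_of_le_one_right (abs_nonneg _) (mul_le_one₀ (hP1 v).le (abs_nonneg _) (hQ1 v).le)
  refine ⟨S, l, r, ⟨fun v i => ?_, fun v i => ?_, fun d hd => ?_⟩, hadd, hmul, fun hc0 d h => ?_⟩
  · have e1 : ∀ b i : ZMod 4, b + i + 1 - b = i + 1 := fun b i => by ring
    obtain ⟨j, rfl⟩ : ∃ j, i = b v + j := ⟨i - b v, by ring⟩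
    simp only [S, l, r, e1, add_sub_cancel_left]
    exact sideSpeed_mul_leftSpeed _ _ _ _
  · have e1 : ∀ b i : ZMod 4, b + i + 1 - b = i + 1 := fun b i => by ring
    obtain ⟨j, rfl⟩ : ∃ j, i = b v + j := ⟨i - b v, by ring⟩
    simp only [S, l, r, e1, add_sub_cancel_left]
    have h0 := ratioP_identity hflat v (b v) (hθ v)
    have h1 := ratioP_identity hflat v (b v + 1) (hθ v)
    have h2 := turnBy_mul_turnBy hflat v (b v)
    have h3 := turnBy_mul_turnBy hflat v (b v + 1)
    rw [show b v + 1 + 2 = b v + 3 by ring] at h3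
    refine add_sideSpeed (K v) (P v) (Q v) (B := fun j => N.turnBy v (b v + j)) ?_ h1 ?_ h3 j
    · rw [add_zero]
      exact h0
    · rw [add_zero]
      exact h2
  · have h1 : l d + r d = l (N.mate d) + r (N.mate d) := by rw [hadd, hadd, hs.2]
    have h2 : l d * r d = l (N.mate d) * r (N.mate d) := by rw [hmul, hmul]
    have h3 : 0 ≤ l d * r d := (hmul d).symm ▸ hc
    -- The larger speed belongs to the left line at one end and to the right line at the other,
    -- which is the same line.
    by_cases hd1 : IsLeft (b d.1) d.2
    · exact eq_of_add_eq_of_mul_eq (h1.trans (add_comm _ _)) (h2.trans (mul_comm _ _)) h3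
        (hl _ _ hd1) (hr _ _ ((hopp d hd).1 hd1))
    · have hd2 : IsLeft (b (N.mate d).1) (N.mate d).2 := by
        by_contra h
        exact hd1 ((hopp d hd).2 h)
      have h4 : r d = l (N.mate d) := eq_of_add_eq_of_mul_eq ((add_comm _ _).trans h1)
        ((mul_comm _ _).trans h2) (by rwa [mul_comm]) (hr _ _ hd1) (hl _ _ hd2)
      linarith
  · have h1 : K d.1 ^ 2 * (P d.1 * Q d.1) ≠ 0 := fun h => hc0 <| by
      rw [← hval d.1]
      exact neg_eq_zero.2 h
    have hk : K d.1 ≠ 0 := fun h => h1 (by rw [h]; ring)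
    have hp : P d.1 ≠ 0 := fun h => h1 (by rw [h]; ring)
    have hq : Q d.1 ≠ 0 := fun h => h1 (by rw [h]; ring)
    have h2 : ∀ j, sideSpeed (K d.1) (P d.1) (Q d.1) j ≠ 0 := fun j =>
      ZMod.forall_four (p := fun j => sideSpeed (K d.1) (P d.1) (Q d.1) j ≠ 0) 0
        (mul_ne_zero (mul_ne_zero hk hp) hq) (mul_ne_zero hk hq) hk
        (neg_ne_zero.2 (mul_ne_zero hk hp)) j
    exact h2 _ h

theorem tan_half_pi_sub_angle (v : V) (i : ZMod 4) :
    Real.tan ((Real.pi - N.angle v i) / 2) = 1 / N.tanHalf v i := by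
  rw [sub_div, Real.tan_pi_div_two_sub, tanHalf, one_div]

theorem exists_speedProduct [Finite V] (hflat : N.IsFlatFoldable) (hplanar : N.pattern.IsPlanar)
    (htree : N.graph.IsTree) {m : V → FoldMode} {s : V × ZMod 4 → ℝ} (hs : N.IsFoldingMode m s)
    {b : V → ZMod 4} (hb : ∀ v, IsBase (m v) (b v))
    (hopp : ∀ d, N.mate d ≠ d →
      (IsLeft (b d.1) d.2 ↔ ¬ IsLeft (b (N.mate d).1) (N.mate d).2)) :
    ∃ θ : V → ℝ, ∃ c : ℝ, 0 ≤ c ∧ (∃ r x y, N.IsPolygonData θ r x y) ∧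
      (∀ v, |N.mulBase b v (Real.tan (θ v / 2))| ≤ |N.mulNext b v (Real.tan (θ v / 2))|) ∧
      (∀ v, -(N.scaleSpeed b s v (Real.tan (θ v / 2)) ^ 2 *
        (N.mulBase b v (Real.tan (θ v / 2)) * N.mulNext b v (Real.tan (θ v / 2)))) = c) ∧
      ((∀ d, s d ≠ 0) → c ≠ 0) := by
  obtain ⟨r₀, hpos, hmatch⟩ := exists_flat_polygons hflat hplanar htree b hopp
  have hθ₀ : ∀ v, Real.pi - N.angle v (b v) ∈ Set.Ioo 0 Real.pi := fun v =>
    ⟨by linarith [angle_lt_pi hflat v (b v)], by linarith [N.angle_pos v (b v)]⟩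
  have hev := eventually_isPolygonData hflat hplanar htree hθ₀ r₀ hpos hmatch
  have hbase : ∀ v, N.mulBase b v (1 / N.tanHalf v (b v)) = 0 := fun v => by
    rw [mulBase, ratioP, mul_one_div_cancel (tanHalf_pos hflat v _).ne', sub_self, zero_div]
  by_cases hne : ∀ d, s d ≠ 0
  -- Nonzero speeds make the two tangents differ at every base, so that the second multiplier does
  -- not vanish where the first one does.
  · have hQ : ∀ v, N.tanHalf v (b v) ≠ N.tanHalf v (b v + 1) := fun v h =>
      hne (v, b v) (by rw [(speeds_base hflat hs v (hb v)).1, ratioQ, h]; simp)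
    let x₀ : V → ℝ := fun v => 1 / N.tanHalf v (b v)
    have hF := fun v => map_nhds_speedProduct (tanHalf_pos hflat v (b v))
      (tanHalf_pos hflat v (b v + 1)) (hQ v) (hne (v, b v + 1))
    have hx₀ : (fun v => 2 * Real.arctan (x₀ v)) = fun v => Real.pi - N.angle v (b v) := by
      funext v
      simp only [x₀]
      rw [← tan_half_pi_sub_angle, Real.arctan_tan] <;> linarith [(hθ₀ v).1, (hθ₀ v).2, Real.pi_pos]
    have hcont : Tendsto (fun (x : V → ℝ) v => 2 * Real.arctan (x v)) (𝓝 x₀)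
        (𝓝 fun v => Real.pi - N.angle v (b v)) := by
      rw [← hx₀]
      have : Continuous fun (x : V → ℝ) v => 2 * Real.arctan (x v) := by fun_prop
      exact this.tendsto x₀
    have hle : ∀ᶠ x in 𝓝 x₀, ∀ v, |N.mulBase b v (x v)| ≤ |N.mulNext b v (x v)| := by
      refine eventually_all.2 fun v => ?_
      have hc : ∀ i, ContinuousAt (fun x : V → ℝ => |ratioP (N.tanHalf v i) (x v)|) x₀ := by
        intro i
        have h1 := tanHalf_pos hflat v i
        have h2 := tanHalf_pos hflat v (b v)
        have h3 : 1 + N.tanHalf v i * x₀ v ≠ 0 := by positivity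
        unfold ratioP
        fun_prop (disch := assumption)
      refine ((hc (b v)).eventually_lt (hc (b v + 1)) ?_).mono fun x hx => hx.le
      have h0 := hbase v
      have h2 := tanHalf_pos hflat v (b v)
      have h3 := tanHalf_pos hflat v (b v + 1)
      rw [mulBase] at h0
      simp only [x₀, h0, abs_zero, abs_pos]
      refine div_ne_zero ?_ (by positivity)
      rw [mul_one_div, sub_ne_zero]
      exact fun h => hQ v ((div_eq_one_iff_eq h2.ne').1 h.symm).symm
    obtain ⟨x, c, hc, ⟨hD, hle⟩, hval⟩ := exists_common_value hF ((hcont.eventually hev).and hle)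
    have hx : ∀ v, Real.tan (2 * Real.arctan (x v) / 2) = x v := fun v => by
      rw [mul_div_cancel_left₀ _ two_ne_zero, Real.tan_arctan]
    refine ⟨fun v => 2 * Real.arctan (x v), c, hc.le, hD, ?_, ?_, fun _ => hc.ne'⟩
    · simpa only [hx] using hle
    · intro v
      rw [hx]
      exact hval v
  -- If some speed vanishes, the special angles themselves are used, at which the speed product is
  -- `0`.
  · refine ⟨_, 0, le_rfl, hev.self_of_nhds, fun v => ?_, fun v => ?_, fun h => absurd h hne⟩
    · rw [tan_half_pi_sub_angle, hbase, abs_zero]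
      exact abs_nonneg _
    · rw [tan_half_pi_sub_angle, hbase]
      ring

end OrigamiNetwork


/-! ### Time change and the folding motion of the double-line version. -/

/-- The parameter of the motion of a double-line pattern in which the lines of every strip have the
speed product `c`. -/
noncomputable def stripTime (c τ : ℝ) : ℝ := 2 * τ / (1 + √(1 + 4 * c * τ ^ 2))

/-- `stripTime` is the small root of `c τ T² + T - τ = 0`, written so as to include `c = 0` and `τ =
0`. With `c ≥ 0` the root is real at all times. -/
theorem stripTime_spec {c : ℝ} (hc : 0 ≤ c) (τ : ℝ) :
    stripTime c τ = τ * (1 - c * stripTime c τ ^ 2) ∧ c * stripTime c τ ^ 2 < 1 := by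
  have h0 : 0 ≤ 4 * c * τ ^ 2 := by positivity
  have h1 : √(1 + 4 * c * τ ^ 2) ^ 2 = 1 + 4 * c * τ ^ 2 := Real.sq_sqrt (by positivity)
  have h2 : 0 ≤ √(1 + 4 * c * τ ^ 2) := Real.sqrt_nonneg _
  rw [stripTime]
  generalize √(1 + 4 * c * τ ^ 2) = w at *
  have h3 : 0 < 1 + w := by positivity
  have h4 : c * (2 * τ / (1 + w)) ^ 2 = (w ^ 2 - 1) / (1 + w) ^ 2 := by
    rw [h1]
    field_simp
    ring
  constructor
  · rw [h4]
    field_simp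
    ring
  · rw [h4, div_lt_one (by positivity)]
    linarith

theorem stripTime_ne_zero (c : ℝ) {τ : ℝ} (hτ : τ ≠ 0) : stripTime c τ ≠ 0 :=
  div_ne_zero (mul_ne_zero two_ne_zero hτ) (by positivity)

@[fun_prop]
theorem continuous_stripTime (c : ℝ) : Continuous (stripTime c) := by
  unfold stripTime
  exact Continuous.div (by fun_prop) (by fun_prop) fun τ => by positivity

namespace OrigamiNetwork

variable {V : Type*} {N : OrigamiNetwork V}

theorem exists_isFoldingMotion [Finite V] (hflat : N.IsFlatFoldable)
    (hplanar : N.pattern.IsPlanar) (htree : N.graph.IsTree) {m : V → FoldMode}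
    {s : V × ZMod 4 → ℝ} (hs : N.IsFoldingMode m s) :
    ∃ θ corner, N.IsDoubleLine θ corner ∧
      ∃ δ : ℝ → DLCrease V → ℝ, (N.doubleLine corner).IsFoldingMotion δ ∧
        (∀ τ d, δ τ (.leftLine d) + δ τ (.rightLine d) = modeMotion s τ d) ∧
        ((∀ d, s d ≠ 0) →
          (∀ τ e, τ ≠ 0 → δ τ e ≠ 0) ∧
          ∃ κ : V × ZMod 4 → ℝ, (∀ d, κ d ≠ 0) ∧
            ∀ τ d, Real.tan (δ τ (.leftLine d) / 2) =
              κ d * Real.tan (δ τ (.rightLine d) / 2)) := by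
  obtain ⟨b, hb, hopp⟩ := exists_bases hplanar htree m
  obtain ⟨θ, c, hc, ⟨r₀, x, y, D⟩, hle, hval, hc0⟩ :=
    exists_speedProduct hflat hplanar htree hs hb hopp
  obtain ⟨S, l, r, hS, hadd, hmul, hS0⟩ :=
    exists_isDLSpeed hflat hs hb hopp D.angle_mem hc hle hval
  obtain ⟨corner, hcorner⟩ := D.exists_isDoubleLine hflat hplanar
  have hside : ∀ v i, ∃ x : ℝ, 0 < x ∧ corner (v, i) =
      corner (v, i - 1) + x * (Complex.exp (θ v * Complex.I) * N.dir v i) := by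
    intro v i
    obtain ⟨r, x, y, -, hx, hy, h1, h2⟩ := hcorner.side v i
    refine ⟨x + y, add_pos hx hy, ?_⟩
    rw [h1, h2]
    push_cast
    ring
  have htan : ∀ t : ℝ, Real.tan (2 * Real.arctan t / 2) = t := fun t => by
    rw [mul_div_cancel_left₀ _ two_ne_zero, Real.tan_arctan]
  refine ⟨θ, corner, hcorner, fun τ e => 2 * Real.arctan (dlSpeed S l r e * stripTime c τ),
    ⟨?_, fun τ => ⟨fun e => CreasePattern.two_arctan_mem _, ?_⟩, ?_⟩, fun τ d => ?_, fun hne => ?_⟩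
  · refine continuous_pi fun e => ?_
    fun_prop
  · exact exists_dl_folded_state hplanar htree hS hside (fun d hd => hcorner.line d.1 d.2 hd)
      (fun d hd => hcorner.boundary d.1 d.2 hd) _
  · funext e
    simp [stripTime]
  · obtain ⟨hT, hT1⟩ := stripTime_spec hc τ
    have h1 : l d * stripTime c τ * (r d * stripTime c τ) = c * stripTime c τ ^ 2 := by
      rw [← hmul d]
      ring
    change 2 * Real.arctan (l d * stripTime c τ) + 2 * Real.arctan (r d * stripTime c τ) = _
    -- The product of the two tangents is `c T² < 1`, so the addition formula needs no correction by
    -- `π`. Its value `s T / (1 - c T²)` equals `s τ`.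
    rw [← mul_add, Real.arctan_add (h1 ▸ hT1), modeMotion, h1]
    congr 2
    rw [div_eq_iff (by linarith), ← add_mul, hadd]
    linear_combination s d * hT
  · have hl : ∀ d, l d ≠ 0 := fun d h => hc0 hne (by rw [← hmul d, h, zero_mul])
    have hr : ∀ d, r d ≠ 0 := fun d h => hc0 hne (by rw [← hmul d, h, mul_zero])
    refine ⟨fun τ e hτ => ?_, fun d => l d / r d, fun d => div_ne_zero (hl d) (hr d),
      fun τ d => ?_⟩
    · have h1 : dlSpeed S l r e ≠ 0 := by
        cases e with
        | side d => exact hS0 (hc0 hne) d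
        | leftLine d => exact hl d
        | rightLine d => exact hr d
      exact mul_ne_zero two_ne_zero (mt Real.arctan_eq_zero_iff.1
        (mul_ne_zero h1 (stripTime_ne_zero c hτ)))
    · simp only [htan, dlSpeed]
      rw [← mul_assoc, div_mul_cancel₀ _ (hr d)]

end OrigamiNetwork

theorem mainTheorem5 {V : Type*} [Finite V] (N : OrigamiNetwork V)
    (hflat : N.IsFlatFoldable) (hplanar : N.pattern.IsPlanar) (htree : N.graph.IsTree) :
    (∃ θ corner, N.IsDoubleLine θ corner ∧ (N.doubleLine corner).IsRigidlyFoldable) ∧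
    (∀ m : V → FoldMode, (∀ v i, modeVector (N.angle v 0) (N.angle v 1) (m v) i ≠ 0) →
      ∃ s, N.IsFoldingMode m s ∧ ∀ d, s d ≠ 0) ∧
    (∀ m s, N.IsFoldingMode m s →
      N.pattern.IsFoldingMotion (modeMotion s) ∧
      ∃ θ corner, N.IsDoubleLine θ corner ∧
        ∃ δ : ℝ → DLCrease V → ℝ, (N.doubleLine corner).IsFoldingMotion δ ∧
          (∀ τ d, δ τ (.leftLine d) + δ τ (.rightLine d) = modeMotion s τ d) ∧
          ((∀ d, s d ≠ 0) →
            (∀ τ e, τ ≠ 0 → δ τ e ≠ 0) ∧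
            ∃ κ : V × ZMod 4 → ℝ, (∀ d, κ d ≠ 0) ∧
              ∀ τ d, Real.tan (δ τ (.leftLine d) / 2) =
                κ d * Real.tan (δ τ (.rightLine d) / 2))) := by
  refine ⟨?_, fun m hm => OrigamiNetwork.exists_foldingMode_of_ne_zero hplanar htree hm,
    fun m s hs => ⟨OrigamiNetwork.modeMotion_isFoldingMotion hflat hplanar htree hs,
      OrigamiNetwork.exists_isFoldingMotion hflat hplanar htree hs⟩⟩
  obtain ⟨m, s, hs, d, hd⟩ := OrigamiNetwork.exists_foldingMode hplanar htree
  obtain ⟨θ, corner, h, δ, hδ, hsum, -⟩ :=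
    OrigamiNetwork.exists_isFoldingMotion hflat hplanar htree hs
  -- Were all fold angles zero at some `τ ≠ 0`, the two lines of the crease `d` would add up to
  -- zero, against `s d ≠ 0`.
  refine ⟨θ, corner, h, δ, hδ, fun τ hτ h0 => ?_⟩
  have h1 := hsum τ d
  rw [h0, modeMotion] at h1
  have h2 : Real.arctan (s d * τ) = 0 := by simpa using h1.symm
  exact mul_ne_zero hd hτ (Real.arctan_eq_zero_iff.1 h2)
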